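/- Let $\mathbb{P}_x=\mathbb{P}^n$ and $\mathbb{P}_t=\mathbb{P}^1$ be complex projective spaces, let $\mathcal{C}\subset\mathbb{P}_x\times\mathbb{P}_t$ be an irreducible closed curve (an integral closed subscheme of dimension one), and suppose that the projection $\pi:\mathcal{C}\to\mathbb{P}_t$ is dominant. For a dominant morphism $f:X\to Y$ of complex varieties with finite generic fibre, let $\deg f=[\mathbb{C}(X):\mathbb{C}(Y)]$, and let the branch locus $\mathcal{B}_f$ be the complement of the largest open subset of $Y$ over which $f$ is finite étale. For a base point $u\in Y(\mathbb{C})\setminus\mathcal{B}_f$, the Galois/monodromy group $\mathcal{G}_f$ is the group of permutations of the fibre $f^{-1}(u)$ induced by lifting loops in $Y(\mathbb{C})\setminus\mathcal{B}_f$ (with the classical topology) based at $u$. The map $\pi$ is called decomposable if there are a dense open subset $U\subseteq\mathbb{P}_t$, a variety $V$ (an integral scheme) and finite dominant morphisms $$\pi^{-1}(U)\xrightarrow{\ \alpha\ }V\xrightarrow{\ \beta\ }U$$ whose composite is the restriction of $\pi$, with $\deg\alpha\ge 2$ and $\deg\beta\ge 2$. A group acting on a finite set $\Omega$ is called imprimitive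 if the action is transitive and has a block other than $\emptyset$, the singletons and $\Omega$. Then, for every base point $u\in\mathbb{P}_t\setminus\mathcal{B}_\pi$: 1. $\pi$ is decomposable if and only if $\mathcal{G}_\pi$ is imprimitive. 2. For every decomposition $(U,V,\alpha,\beta)$ of $\pi$ with $a=\deg\alpha\ge2$ and $b=\deg\beta\ge2$, the group $\mathcal{G}_\pi$ is a subgroup of the wreath product $S_a\wr S_b=(S_a)^b\rtimes S_b$; more precisely, there are a bijection of $\pi^{-1}(u)$ with $\{1,\dots,b\}\times\{1,\dots,a\}$ and an injective homomorphism $\mathcal{G}_\pi\to S_a\wr S_b$ compatible with the actions, where $S_a\wr S_b$ acts on $b$ blocks of size $a$. Moreover, for every base point $v\in U\setminus\mathcal{B}_\beta$, the fibre $\beta^{-1}(v)$ has $b$ elements and $\mathcal{G}_\beta$, acting on it, is a transitive subgroup of $S_b$. -/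

import Mathlib

open AlgebraicGeometry CategoryTheory CategoryTheory.Limits TopologicalSpace

noncomputable section

namespace MonodromyDecomp

/-! ### Complex projective space as a scheme over `ℂ` -/

/-- The base `Spec ℂ`. -/
abbrev SpecC : Scheme.{0} := Spec (.of ℂ)

attribute [local instance] MvPolynomial.gradedAlgebra in
/-- The projective space `ℙⁿ` over `ℂ`, that is `Proj ℂ[x₀, …, xₙ]`. -/
def ProjSpace (n : ℕ) : Scheme.{0} :=
  Proj (MvPolynomial.homogeneousSubmodule (Fin (n + 1)) ℂ)

attribute [local instance] MvPolynomial.gradedAlgebra in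
/-- The structure morphism `ℙⁿ ⟶ Spec ℂ`. -/
def ProjSpace.structMap (n : ℕ) : ProjSpace n ⟶ SpecC :=
  Proj.toSpecZero (MvPolynomial.homogeneousSubmodule (Fin (n + 1)) ℂ) ≫
    Spec.map (CommRingCat.ofHom
      (algebraMap ℂ (MvPolynomial.homogeneousSubmodule (Fin (n + 1)) ℂ 0)))

/-- The product `ℙⁿ × ℙ¹` over `ℂ`. -/
abbrev ProjProd (n : ℕ) : Scheme.{0} :=
  pullback (ProjSpace.structMap n) (ProjSpace.structMap 1)

/-- The projection `ℙⁿ × ℙ¹ ⟶ ℙ¹`. -/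
abbrev projToLine (n : ℕ) : ProjProd n ⟶ ProjSpace 1 :=
  pullback.snd (ProjSpace.structMap n) (ProjSpace.structMap 1)

/-! ### Complex points and the classical (Euclidean) topology -/

/-- The complex points `X(ℂ)` of a scheme `X` with structure morphism `s : X ⟶ Spec ℂ`. -/
@[ext]
structure ComplexPoint {X : Scheme.{0}} (s : X ⟶ SpecC) : Type where
  /-- the underlying morphism -/
  hom : SpecC ⟶ X
  /-- it is a section of the structure morphism -/
  w : hom ≫ s = 𝟙 SpecC

namespace ComplexPoint

variable {X Y : Scheme.{0}} {s : X ⟶ SpecC}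

/-- The complex point `p` lies in the Zariski open subset `U`. -/
def LiesIn (p : ComplexPoint s) (U : X.Opens) : Prop := ⊤ ≤ p.hom ⁻¹ᵁ U

/-- The value `g(p) ∈ ℂ` of a regular function `g ∈ Γ(X, U)` at a complex point `p` of `U`. -/
def value (p : ComplexPoint s) {U : X.Opens} (h : p.LiesIn U) (g : Γ(X, U)) : ℂ :=
  (Scheme.ΓSpecIso (.of ℂ)).hom (p.hom.appLE U ⊤ h g)

/-- The classical topology on `X(ℂ)`: the coarsest one for which all Zariski open subsets are open
and all regular functions on Zariski open subsets are continuous. -/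
instance : TopologicalSpace (ComplexPoint s) :=
  TopologicalSpace.generateFrom
    {S | ∃ (U : X.Opens) (g : Γ(X, U)) (W : Set ℂ), IsOpen W ∧
      S = {p | ∃ h : p.LiesIn U, p.value h g ∈ W}}

/-- The map `X(ℂ) → Y(ℂ)` induced by a morphism `f : X ⟶ Y` of schemes over `ℂ`. -/
def map (f : X ⟶ Y) (s : Y ⟶ SpecC) (p : ComplexPoint (f ≫ s)) : ComplexPoint s where
  hom := p.hom ≫ f
  w := by rw [Category.assoc]; exact p.w

end ComplexPoint

/-! ### Branch locus and monodromy group -/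

/-- The complement of the branch locus of `f : X ⟶ Y`: the largest open subset of `Y` over which
`f` is finite étale. -/
def unbranchedLocus {X Y : Scheme.{0}} (f : X ⟶ Y) : Y.Opens :=
  sSup {W : Y.Opens | IsFinite (f ∣_ W) ∧ Etale (f ∣_ W)}

/-- The fibre of `X(ℂ) → Y(ℂ)` over the complex point `u` of `Y`. -/
abbrev Fiber {X Y : Scheme.{0}} (f : X ⟶ Y) {s : Y ⟶ SpecC} (u : ComplexPoint s) : Type :=
  {x : ComplexPoint (f ≫ s) // x.map f s = u}

/-- `σ` is the permutation of the fibre over `u` induced by the loop `γ`: for every point `x` of the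
fibre there is a lift of `γ` starting at `x` and ending at `σ x`. -/
def InducedBy {X Y : Scheme.{0}} (f : X ⟶ Y) {s : Y ⟶ SpecC} {u : ComplexPoint s}
    (γ : Path u u) (σ : Equiv.Perm (Fiber f u)) : Prop :=
  ∀ x : Fiber f u, ∃ Γ : Path x.1 (σ x).1, ∀ t, (Γ t).map f s = γ t

/-- The monodromy group of `f : X ⟶ Y` at the base point `u`: the group of the permutations of the
fibre over `u` that are induced by loops based at `u` in the complement of the branch locus. -/
def monodromyGroup {X Y : Scheme.{0}} (f : X ⟶ Y) {s : Y ⟶ SpecC} (u : ComplexPoint s)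
    (hu : u.LiesIn (unbranchedLocus f)) : Subgroup (Equiv.Perm (Fiber f u)) where
  carrier := {σ | ∃ γ : Path u u, (∀ t, (γ t).LiesIn (unbranchedLocus f)) ∧ InducedBy f γ σ}
  one_mem' := by
    refine ⟨Path.refl u, fun t => hu, fun x => ⟨Path.refl x.1, fun t => x.2⟩⟩
  mul_mem' := by
    rintro σ τ ⟨γ, hγ, h⟩ ⟨δ, hδ, k⟩
    refine ⟨δ.trans γ, fun t => ?_, fun x => ?_⟩
    · rw [Path.trans_apply]
      split_ifs
      · exact hδ _
      · exact hγ _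
    · obtain ⟨Γ, hΓ⟩ := k x
      obtain ⟨Δ, hΔ⟩ := h (τ x)
      have key : ∀ t, ((Γ.trans Δ) t).map f s = (δ.trans γ) t := by
        intro t
        rw [Path.trans_apply, Path.trans_apply]
        split_ifs
        · exact hΓ _
        · exact hΔ _
      exact ⟨Γ.trans Δ, key⟩
  inv_mem' := by
    rintro σ ⟨γ, hγ, h⟩
    refine ⟨γ.symm, fun t => hγ _, fun x => ?_⟩
    obtain ⟨Γ, hΓ⟩ := h (σ⁻¹ x)
    exact ⟨Γ.symm.cast (by simp) rfl, fun t => hΓ _⟩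

/-- A group acting on `Ω` is imprimitive if the action is transitive and has a block
other than `∅`, the singletons and `Ω`. -/
def IsImprimitive (G Ω : Type) [Group G] [MulAction G Ω] : Prop :=
  MulAction.IsPretransitive G Ω ∧
    ∃ B : Set Ω, MulAction.IsBlock G B ∧ ¬ MulAction.IsTrivialBlock B

/-! ### Decompositions of a dominant map -/

/-- The degree of a dominant morphism between integral schemes: the degree of the extension of
function fields (the residue fields of the generic points). It is `0` for an infinite extension. -/
def degree {X Y : Scheme.{0}} [IrreducibleSpace X] (f : X ⟶ Y) : ℕ :=
  f.residueDegree (genericPoint X)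

/-- A factorization `π⁻¹(U) ⟶ V ⟶ U` of a morphism `π : X ⟶ Y` over a dense open `U ⊆ Y`,
through a variety `V`, by finite dominant morphisms `α` and `β`. -/
structure Decomposition {X Y : Scheme.{0}} (π : X ⟶ Y) where
  /-- the open subset of the target -/
  U : Y.Opens
  dense : Dense (U : Set Y)
  /-- the intermediate variety -/
  V : Scheme.{0}
  isIntegral : IsIntegral V
  /-- the first map -/
  α : (π ⁻¹ᵁ U).toScheme ⟶ V
  /-- the second map -/
  β : V ⟶ U.toScheme
  isFinite_α : IsFinite α
  isFinite_β : IsFinite β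
  isDominant_α : IsDominant α
  isDominant_β : IsDominant β
  fac : α ≫ β = π ∣_ U

attribute [instance] Decomposition.isIntegral

namespace Decomposition

variable {X Y : Scheme.{0}} {π : X ⟶ Y}

/-- The preimage of the dense open `U` under a dominant map is an irreducible space. -/
theorem irreducibleSpace_preimage [IsIntegral X] [IsDominant π] (D : Decomposition π) :
    IrreducibleSpace (π ⁻¹ᵁ D.U).toScheme := by
  have hX : Nonempty X := inferInstance
  have hY : Nonempty Y := hX.map π
  obtain ⟨y, hy⟩ := D.dense.nonempty
  obtain ⟨x, hx⟩ := π.denseRange.exists_mem_open D.U.isOpen ⟨y, hy⟩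
  have : Nonempty (π ⁻¹ᵁ D.U).toScheme := ⟨⟨x, hx⟩⟩
  infer_instance

/-- The degree of `α`. -/
def degα [IsIntegral X] [IsDominant π] (D : Decomposition π) : ℕ :=
  haveI := D.irreducibleSpace_preimage
  degree D.α

/-- The degree of `β`. -/
def degβ (D : Decomposition π) : ℕ := degree D.β

/-- The decomposition is nontrivial: both factors have degree at least two. -/
def IsNontrivial [IsIntegral X] [IsDominant π] (D : Decomposition π) : Prop :=
  2 ≤ D.degα ∧ 2 ≤ D.degβ

end Decomposition

/-- The dominant map `π` is (nontrivially) decomposable. -/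
def IsDecomposable {X Y : Scheme.{0}} (π : X ⟶ Y) [IsIntegral X] [IsDominant π] : Prop :=
  ∃ D : Decomposition π, D.IsNontrivial

/-! ### Wreath products of symmetric groups -/

/-- The action of `S_b` on `(S_a)^b` by permuting the factors. -/
def wreathAut (a b : ℕ) :
    Equiv.Perm (Fin b) →* MulAut (Fin b → Equiv.Perm (Fin a)) where
  toFun τ :=
    { toFun := fun f j => f (τ⁻¹ j)
      invFun := fun f j => f (τ j)
      left_inv := fun f => by ext; simp
      right_inv := fun f => by ext; simp
      map_mul' := fun f g => rfl }
  map_one' := rfl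
  map_mul' τ ρ := by ext f j; simp [mul_inv_rev]

/-- The wreath product `S_a ≀ S_b = (S_a)^b ⋊ S_b`. -/
abbrev Wreath (a b : ℕ) : Type :=
  (Fin b → Equiv.Perm (Fin a)) ⋊[wreathAut a b] Equiv.Perm (Fin b)

/-- The imprimitive action of `S_a ≀ S_b` on `{1, …, b} × {1, …, a}`, that is on `b` blocks of size
`a`: the pair `(f, τ)` sends `(j, i)` to `(τ j, f (τ j) i)`. -/
instance (a b : ℕ) : SMul (Wreath a b) (Fin b × Fin a) where
  smul w x := (w.right x.1, w.left (w.right x.1) x.2)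

instance (a b : ℕ) : MulAction (Wreath a b) (Fin b × Fin a) where
  one_smul x := rfl
  mul_smul w w' x := by
    change ((w * w').right x.1, (w * w').left ((w * w').right x.1) x.2) =
      (w.right (w'.right x.1),
        w.left (w.right (w'.right x.1)) (w'.left (w'.right x.1) x.2))
    simp [wreathAut]

end MonodromyDecomp

end

set_option linter.unusedSectionVars false
set_option linter.style.haveILetI false

noncomputable section

namespace MonodromyDecomp

/-! ### Holomorphic functions of moderate growth -/

section Growth

open Polynomial Filter Topology

/-! The work is done over charts of the line: affine opens whose ring `R` is `ℂ[τ]` localized at a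
polynomial `g`. Where `π` is finite étale over a chart, its preimage has a ring `A` that is a domain
and a finite `R`-module. The roots of the minimal polynomial of a suitable element of `A` continue
holomorphically, so over small discs the complex points of `A` are `deg π` disjoint graphs of
holomorphic sections (`exists_localSystem`). Hence `π` is a covering on complex points off the
branch locus, and loops lift.

The bridge from topology to algebra is `exists_apply_mul_eq`: a function on the points of `A` that
is holomorphic along the sections and grows at most polynomially at the missing points of the chart
is a quotient of elements of `A`. Its traces are rational by Liouville's theorem, and Lagrange
interpolation at the conjugates of a primitive element recovers the function from traces. For the
indicator function of a clopen set this yields connectedness of the space of points, hence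
transitivity of the monodromy.

Imprimitive implies decomposable: parallel transport spreads a nontrivial block `B` to a partition
of every fibre over the chart. Let `a` separate the fibre over `u`, let `y` be a point of it outside
`B`, and consider the product of `y(a) - z'(a)` over the class of `z`. This function of `z` is
rational, constant on classes, zero at `y` and nonzero on `B`. Cleared of denominators it is an `h`
in `A` outside the fraction field of `R`, while `a` lies outside the fraction field of `R[h]`
because `h` does not separate the points of `B`. The intermediate variety is `Spec R[h]`
(`exists_intermediate`, `exists_decomposition`).

Decomposable implies imprimitive: having the same image in `V` is a relation on fibres, available
only over `U` and off the ramification of `β`, whereas `u` and the loops may meet the isolated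
points left out. Over a punctured disc the relation between two sections of `π` is constant, because
a punctured disc is connected; so it extends over the centre (`Continued`, `exists_relSheets`) and
is invariant under transport. It has `deg β` classes. By transitivity they have equal size, which is
`deg α` by multiplicativity of degrees, and a group preserving such a partition embeds in the wreath
product. The statement on `β` is the transitivity result applied over the open subscheme `U`. -/

theorem exists_polynomial_of_growth (N : ℕ) : ∀ {f : ℂ → ℂ}, Differentiable ℂ f →
    ∀ M : ℝ, (∀ z, ‖f z‖ ≤ M * (1 + ‖z‖) ^ N) → ∃ p : ℂ[X], ∀ z, f z = p.eval z := by
  induction N with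
  | zero =>
    intro f hf M h
    refine ⟨C (f 0), fun z => ?_⟩
    rw [eval_C]
    refine hf.apply_eq_apply_of_bounded ?_ z 0
    refine (Metric.isBounded_closedBall (x := (0 : ℂ)) (r := M)).subset ?_
    rintro _ ⟨y, rfl⟩
    simpa using h y
  | succ N ih =>
    intro f hf M h
    -- The quotient `(f(z) - f(0)) / z` is entire and its growth exponent is one less; Liouville's
    -- theorem is the base of the induction.
    have hd : Differentiable ℂ (dslope f 0) := by
      rw [← differentiableOn_univ] at hf ⊢
      exact (Complex.differentiableOn_dslope Filter.univ_mem).2 hf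
    obtain ⟨M', hM'⟩ := (isCompact_closedBall (0 : ℂ) 1).exists_bound_of_continuousOn
      hd.continuous.continuousOn
    have hM0 : 0 ≤ M := by simpa using (norm_nonneg _).trans (h 0)
    have hM'0 : 0 ≤ M' := (norm_nonneg _).trans (hM' 0 (by simp))
    -- `M'` serves on the unit disc. Outside it `1 + ‖z‖ ≤ 2 * ‖z‖` allows the division by `‖z‖`, at
    -- the price of the factor 2.
    obtain ⟨p, hp⟩ := ih hd (2 * M + ‖f 0‖ + M') fun z => by
      have hz : 1 ≤ (1 + ‖z‖) ^ N := one_le_pow₀ (by simp)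
      rcases le_total ‖z‖ 1 with h1 | h1
      · calc _ ≤ M' := hM' z (by simpa using h1)
          _ ≤ (2 * M + ‖f 0‖ + M') * 1 := by linarith [norm_nonneg (f 0)]
          _ ≤ _ := by gcongr
      · have hz0 : z ≠ 0 := by rintro rfl; simp at h1; linarith
        have hzp : 0 < ‖z‖ := norm_pos_iff.2 hz0
        rw [dslope_of_ne _ hz0, slope_def_field, sub_zero, norm_div, div_le_iff₀ hzp]
        calc _ ≤ ‖f z‖ + ‖f 0‖ := norm_sub_le _ _
          _ ≤ M * (1 + ‖z‖) ^ N * (1 + ‖z‖) + ‖f 0‖ := by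
            have := h z; rw [pow_succ, ← mul_assoc] at this; linarith
          _ ≤ M * (1 + ‖z‖) ^ N * (2 * ‖z‖) + ‖f 0‖ * (1 + ‖z‖) ^ N * ‖z‖ := by
            gcongr
            · linarith
            · rw [mul_assoc]
              refine le_mul_of_one_le_right (norm_nonneg _) ?_
              nlinarith
          _ ≤ _ := by
            have : 0 ≤ M' * (1 + ‖z‖) ^ N * ‖z‖ := by positivity
            linarith
    refine ⟨C (f 0) + X * p, fun z => ?_⟩
    have := sub_smul_dslope f 0 z
    rw [hp, sub_zero, smul_eq_mul] at this
    simp only [eval_add, eval_C, eval_mul, eval_X]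
    rw [this]; ring

/-- The weight against which growth near infinity and near the zeros of `g` is measured. -/
def weight (g : ℂ[X]) (t : ℂ) : ℝ := (1 + ‖t‖) * (1 + ‖g.eval t‖⁻¹)

theorem one_le_weight (g : ℂ[X]) (t : ℂ) : 1 ≤ weight g t := by
  unfold weight
  have h1 : 0 ≤ ‖t‖ := norm_nonneg _
  have h2 : 0 ≤ ‖g.eval t‖⁻¹ := by positivity
  nlinarith [mul_nonneg h1 h2]

/-- A function `ψ` on a set with a coordinate `x` has moderate growth. -/
def Moderate {S : Type*} (g : ℂ[X]) (x : S → ℂ) (ψ : S → ℂ) : Prop :=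
  ∃ (N : ℕ) (M : ℝ), 0 ≤ M ∧ ∀ s, ‖ψ s‖ ≤ M * weight g (x s) ^ N

namespace Moderate

variable {S : Type*} {g : ℂ[X]} {x : S → ℂ} {ψ χ : S → ℂ}

theorem of_le (h : Moderate g x ψ) (hle : ∀ s, ‖χ s‖ ≤ ‖ψ s‖) : Moderate g x χ := by
  obtain ⟨N, M, hM, h⟩ := h
  exact ⟨N, M, hM, fun s => (hle s).trans (h s)⟩

theorem const (c : ℂ) : Moderate g x (fun _ => c) := ⟨0, ‖c‖, norm_nonneg _, fun s => by simp⟩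

theorem add (h : Moderate g x ψ) (k : Moderate g x χ) : Moderate g x (fun s => ψ s + χ s) := by
  obtain ⟨N, M, hM, h⟩ := h
  obtain ⟨N', M', hM', k⟩ := k
  refine ⟨N + N', M + M', by positivity, fun s => ?_⟩
  have hw := one_le_weight g (x s)
  calc _ ≤ ‖ψ s‖ + ‖χ s‖ := norm_add_le _ _
    _ ≤ M * weight g (x s) ^ N + M' * weight g (x s) ^ N' := add_le_add (h s) (k s)
    _ ≤ M * weight g (x s) ^ (N + N') + M' * weight g (x s) ^ (N + N') := by
      gcongr <;> first | exact hw | omega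
    _ = _ := by ring

theorem mul (h : Moderate g x ψ) (k : Moderate g x χ) : Moderate g x (fun s => ψ s * χ s) := by
  obtain ⟨N, M, hM, h⟩ := h
  obtain ⟨N', M', hM', k⟩ := k
  refine ⟨N + N', M * M', by positivity, fun s => ?_⟩
  have hw := one_le_weight g (x s)
  rw [norm_mul]
  calc _ ≤ (M * weight g (x s) ^ N) * (M' * weight g (x s) ^ N') :=
        mul_le_mul (h s) (k s) (norm_nonneg _) (by positivity)
    _ = _ := by ring

theorem pow (h : Moderate g x ψ) (n : ℕ) : Moderate g x (fun s => ψ s ^ n) := by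
  induction n with
  | zero => simpa using const 1
  | succ n ih => simpa [pow_succ] using ih.mul h

theorem sum {ι : Type*} {I : Finset ι} {ψ : ι → S → ℂ} (h : ∀ i ∈ I, Moderate g x (ψ i)) :
    Moderate g x (fun s => ∑ i ∈ I, ψ i s) := by
  classical
  induction I using Finset.induction_on with
  | empty => simpa using const 0
  | insert a I ha ih =>
    simp only [Finset.sum_insert ha]
    exact (h a (by simp)).add (ih fun i hi => h i (by simp [hi]))

theorem coord : Moderate g x x := by
  refine ⟨1, 1, by norm_num, fun s => ?_⟩
  have h2 : 0 ≤ ‖g.eval (x s)‖⁻¹ := by positivity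
  have h1 := norm_nonneg (x s)
  simp only [weight, pow_one, one_mul]
  nlinarith [mul_nonneg h1 h2]

theorem eval (p : ℂ[X]) : Moderate g x (fun s => p.eval (x s)) := by
  simp only [eval_eq_sum_range]
  exact sum fun i _ => (const _).mul (coord.pow _)

theorem inv_eval : Moderate g x (fun s => (g.eval (x s))⁻¹) := by
  refine ⟨1, 1, by norm_num, fun s => ?_⟩
  have h2 : 0 ≤ ‖g.eval (x s)‖⁻¹ := by positivity
  have h1 := norm_nonneg (x s)
  simp only [weight, pow_one, one_mul, norm_inv]
  nlinarith [mul_nonneg h1 h2]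

end Moderate

/-- Cauchy's bound, from dividing by the power of exponent `n - 1` when `‖a‖ ≥ 1`. It makes integral
elements grow moderately. -/
theorem norm_le_of_monic_root (n : ℕ) (a : ℂ) (c : ℕ → ℂ)
    (h : a ^ n = ∑ j ∈ Finset.range n, c j * a ^ j) :
    ‖a‖ ≤ 1 + ∑ j ∈ Finset.range n, ‖c j‖ := by
  have hs : 0 ≤ ∑ j ∈ Finset.range n, ‖c j‖ := Finset.sum_nonneg fun _ _ => norm_nonneg _
  rcases le_total ‖a‖ 1 with h1 | h1
  · linarith
  rcases n with _ | n
  · simp at h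
  have hp : 0 < ‖a‖ ^ n := by positivity
  have : ‖a‖ * ‖a‖ ^ n ≤ (∑ j ∈ Finset.range (n + 1), ‖c j‖) * ‖a‖ ^ n := by
    calc _ = ‖a ^ (n + 1)‖ := by rw [norm_pow, pow_succ']
      _ ≤ ∑ j ∈ Finset.range (n + 1), ‖c j * a ^ j‖ := by rw [h]; exact norm_sum_le _ _
      _ ≤ ∑ j ∈ Finset.range (n + 1), ‖c j‖ * ‖a‖ ^ n := by
        refine Finset.sum_le_sum fun j hj => ?_
        rw [norm_mul, norm_pow]
        gcongr
        have := Finset.mem_range.1 hj; omega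
      _ = _ := by rw [Finset.sum_mul]
  have := le_of_mul_le_mul_right this hp
  linarith

/-- A holomorphic function of moderate growth outside the zeros of `g` is rational. -/
theorem exists_rational_of_moderate {g : ℂ[X]} (hg : g ≠ 0) {F : ℂ → ℂ}
    (hF : ∀ t, g.eval t ≠ 0 → DifferentiableAt ℂ F t)
    (hm : Moderate g (fun t : {t : ℂ // g.eval t ≠ 0} => t.1) (fun t => F t)) :
    ∃ (n : ℕ) (p : ℂ[X]), ∀ t, g.eval t ≠ 0 → g.eval t ^ n * F t = p.eval t := by
  obtain ⟨N, M, hM, h⟩ := hm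
  -- The power `g ^ N` already makes `F` bounded near a zero of `g`. One more factor makes the
  -- product tend to 0 there, which is the value `G` has at the zero, so the singularity is
  -- removable without redefining `G`.
  set G : ℂ → ℂ := fun t => g.eval t ^ (N + 1) * F t with hG
  have bound : ∀ t, ‖G t‖ ≤ ‖g.eval t‖ * (M * ((1 + ‖t‖) * (1 + ‖g.eval t‖)) ^ N) := by
    intro t
    by_cases ht : g.eval t = 0
    · simp [hG, ht]
    have hpos : 0 < ‖g.eval t‖ := norm_pos_iff.2 ht
    calc ‖G t‖ = ‖g.eval t‖ * (‖g.eval t‖ ^ N * ‖F t‖) := by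
          simp only [hG, norm_mul, norm_pow]; ring
      _ ≤ ‖g.eval t‖ * (‖g.eval t‖ ^ N * (M * weight g t ^ N)) := by
          gcongr; exact h ⟨t, ht⟩
      _ = _ := by
          have : ‖g.eval t‖ * weight g t = (1 + ‖t‖) * (1 + ‖g.eval t‖) := by
            unfold weight; field_simp; ring
          rw [← this, mul_pow]; ring
  have hroots : ∀ z, ∃ s ∈ 𝓝 z, ∀ t ∈ s, t ≠ z → g.eval t ≠ 0 := by
    intro z
    refine ⟨((g.roots.toFinset.erase z : Finset ℂ) : Set ℂ)ᶜ, ?_, fun t ht htz h0 => ?_⟩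
    · exact (Finset.finite_toSet _).isClosed.isOpen_compl.mem_nhds (by simp)
    · exact ht (by simp [htz, hg, h0])
  have hd : Differentiable ℂ G := by
    intro z
    by_cases hz : g.eval z = 0
    · obtain ⟨s, hs, hs'⟩ := hroots z
      refine DifferentiableOn.differentiableAt ?_ hs
      refine (Complex.differentiableOn_compl_singleton_and_continuousAt_iff hs).1
        ⟨fun t ht => ?_, ?_⟩
      · have : DifferentiableAt ℂ G t :=
          (g.differentiable.differentiableAt.pow _).mul (hF t (hs' t ht.1 ht.2))
        exact this.differentiableWithinAt
      · have hG0 : G z = 0 := by simp [hG, hz]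
        rw [ContinuousAt, hG0]
        refine squeeze_zero_norm bound ?_
        have hc : Continuous fun t : ℂ =>
            ‖g.eval t‖ * (M * ((1 + ‖t‖) * (1 + ‖g.eval t‖)) ^ N) := by
          have := g.continuous
          fun_prop
        have := hc.tendsto z
        simpa [hz] using this
    · exact (g.differentiable.differentiableAt.pow _).mul (hF z hz)
  -- For the polynomial 1 the weight is `2 * (1 + ‖t‖)`, so moderate growth becomes ordinary
  -- polynomial growth.
  have hpm : Moderate 1 (fun t : ℂ => t) (fun t => g.eval t) := Moderate.eval g
  obtain ⟨k, C, hC, hk⟩ := hpm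
  have hw1 : ∀ t, weight 1 t = 2 * (1 + ‖t‖) := fun t => by simp [weight]; ring
  obtain ⟨p, hp⟩ := exists_polynomial_of_growth (k + (1 + k) * N) hd
    (C * 2 ^ k * (M * (1 + C * 2 ^ k) ^ N)) fun t => by
      have h1 : ‖g.eval t‖ ≤ C * 2 ^ k * (1 + ‖t‖) ^ k := by
        have := hk t; rw [hw1, mul_pow] at this; linarith
      have h0 : 1 ≤ (1 + ‖t‖) ^ k := one_le_pow₀ (by simp)
      have h2 : 1 + ‖g.eval t‖ ≤ (1 + C * 2 ^ k) * (1 + ‖t‖) ^ k := by nlinarith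
      calc ‖G t‖ ≤ _ := bound t
        _ ≤ (C * 2 ^ k * (1 + ‖t‖) ^ k) *
            (M * ((1 + ‖t‖) * ((1 + C * 2 ^ k) * (1 + ‖t‖) ^ k)) ^ N) := by gcongr
        _ = _ := by rw [mul_pow, mul_pow]; ring
  exact ⟨N + 1, p, fun t _ => hp t⟩

/-- The implicit function theorem at a simple root, where the partial derivative is multiplication
by the nonzero number `F'`. -/
theorem exists_holomorphic_root {F : ℂ × ℂ → ℂ} {w y F' : ℂ} (hF : ContDiffAt ℂ 1 F (w, y))
    (h0 : F (w, y) = 0) (hy : HasDerivAt (fun z => F (w, z)) F' y) (hF' : F' ≠ 0) :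
    ∃ r : ℂ → ℂ, r w = y ∧ (∀ᶠ t in 𝓝 w, F (t, r t) = 0) ∧
      ∀ᶠ t in 𝓝 w, DifferentiableAt ℂ r t := by
  have hinv : (fderiv ℂ F (w, y) ∘L .inr ℂ ℂ ℂ).IsInvertible := by
    have h1 : HasFDerivAt F (fderiv ℂ F (w, y)) (w, y) :=
      (hF.differentiableAt (by norm_num)).hasFDerivAt
    have h2 : HasFDerivAt (fun z : ℂ => ((w, z) : ℂ × ℂ)) (.inr ℂ ℂ ℂ) y :=
      hasFDerivAt_prodMk_right w y
    have h3 := (h1.comp y h2).unique hy.hasFDerivAt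
    rw [h3]
    refine ⟨ContinuousLinearEquiv.unitsEquivAut ℂ (Units.mk0 F' hF'), ?_⟩
    ext; simp
  refine ⟨hF.implicitFunction one_ne_zero hinv, hF.implicitFunction_apply_self one_ne_zero hinv,
    ?_, ?_⟩
  · simpa [h0] using hF.eventually_apply_implicitFunction one_ne_zero hinv
  · have := (hF.contDiffAt_implicitFunction one_ne_zero hinv).eventually (by simp)
    exact this.mono fun t ht => ht.differentiableAt (by norm_num)

end Growth

/-! ### Coordinate rings of open subsets of the affine line -/

section LineCoord

open Polynomial Filter Topology

/-- A coordinate `τ` identifying `R` with the localization `ℂ[τ]_g`. -/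
structure LineCoord (R : Type) [CommRing R] [Algebra ℂ R] where
  /-- the coordinate -/
  τ : R
  /-- the polynomial that is inverted -/
  g : ℂ[X]
  inj : Function.Injective (aeval τ : ℂ[X] →ₐ[ℂ] R)
  isUnit : IsUnit (aeval τ g)
  surj : ∀ r : R, ∃ (n : ℕ) (p : ℂ[X]), aeval τ g ^ n * r = aeval τ p

namespace LineCoord

variable {R : Type} [CommRing R] [Algebra ℂ R] (c : LineCoord R)

include c in
theorem nontrivial : Nontrivial R := c.inj.nontrivial

theorem g_ne_zero : c.g ≠ 0 := by
  have := c.nontrivial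
  intro h
  have := c.isUnit
  rw [h, map_zero] at this
  exact not_isUnit_zero this

include c in
theorem isDomain : IsDomain R := by
  have := c.nontrivial
  have : NoZeroDivisors R := ⟨fun {r r'} h => by
    obtain ⟨n, p, hp⟩ := c.surj r
    obtain ⟨m, q, hq⟩ := c.surj r'
    have h1 : aeval c.τ (p * q) = aeval c.τ (0 : ℂ[X]) := by
      rw [map_mul, ← hp, ← hq, map_zero]
      linear_combination aeval c.τ c.g ^ n * aeval c.τ c.g ^ m * h
    have h2 := c.inj h1
    rcases mul_eq_zero.1 h2 with h3 | h3
    · left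
      rw [h3, map_zero] at hp
      exact (c.isUnit.pow n).mul_right_eq_zero.1 hp
    · right
      rw [h3, map_zero] at hq
      exact (c.isUnit.pow m).mul_right_eq_zero.1 hq⟩
  exact NoZeroDivisors.to_isDomain R

-- As for any localization of a principal ideal ring, a generator of the contraction to `ℂ[τ]`
-- generates the ideal. This makes `R` integrally closed and finite torsion-free `R`-modules free.
include c in
theorem isPrincipalIdealRing : IsPrincipalIdealRing R := by
  refine ⟨fun I => ?_⟩
  obtain ⟨p, hp⟩ := IsPrincipalIdealRing.principal (I.comap (aeval c.τ : ℂ[X] →ₐ[ℂ] R))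
  refine ⟨aeval c.τ p, le_antisymm (fun r hr => ?_) ?_⟩
  · obtain ⟨n, q, hq⟩ := c.surj r
    have h1 : q ∈ I.comap (aeval c.τ : ℂ[X] →ₐ[ℂ] R) := by
      rw [Ideal.mem_comap, ← hq]; exact I.mul_mem_left _ hr
    rw [hp] at h1
    obtain ⟨b, rfl⟩ := Ideal.mem_span_singleton'.1 h1
    obtain ⟨u, hu⟩ := c.isUnit.pow n
    refine Ideal.mem_span_singleton'.2 ⟨↑u⁻¹ * aeval c.τ b, ?_⟩
    rw [mul_assoc, ← map_mul, ← hq, ← hu, Units.inv_mul_cancel_left]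
  · have : p ∈ I.comap (aeval c.τ : ℂ[X] →ₐ[ℂ] R) := by
      rw [hp]; exact Ideal.mem_span_singleton_self p
    exact (Ideal.span_singleton_le_iff_mem _).2 this

include c in
theorem finiteType : Algebra.FiniteType ℂ R := by
  obtain ⟨v, hv⟩ := c.isUnit.exists_left_inv
  classical
  refine ⟨⟨({c.τ, v} : Finset R), ?_⟩⟩
  rw [eq_top_iff]
  rintro r -
  obtain ⟨n, p, hp⟩ := c.surj r
  have hr : r = v ^ n * aeval c.τ p := by
    rw [← hp, ← mul_assoc, ← mul_pow, hv, one_pow, one_mul]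
  rw [hr]
  refine mul_mem (pow_mem (Algebra.subset_adjoin (by simp)) _) ?_
  exact Algebra.adjoin_mono (by simp) (aeval_mem_adjoin_singleton ℂ c.τ)

theorem apply_aeval (y : R →ₐ[ℂ] ℂ) (p : ℂ[X]) : y (aeval c.τ p) = p.eval (y c.τ) := by
  rw [← aeval_algHom_apply, coe_aeval_eq_eval]

theorem eval_g_ne_zero (y : R →ₐ[ℂ] ℂ) : c.g.eval (y c.τ) ≠ 0 := by
  rw [← c.apply_aeval]; exact (c.isUnit.map y).ne_zero

/-- The value of `r` at the point with coordinate `t`. -/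
def val (r : R) (t : ℂ) : ℂ :=
  (c.surj r).choose_spec.choose.eval t / c.g.eval t ^ (c.surj r).choose

/-- `val` is computed from a chosen fraction; injectivity of evaluation at `τ` makes the choice
immaterial. -/
theorem val_eq {r : R} {n : ℕ} {p : ℂ[X]} (h : aeval c.τ c.g ^ n * r = aeval c.τ p) {t : ℂ}
    (ht : c.g.eval t ≠ 0) : c.val r t = p.eval t / c.g.eval t ^ n := by
  unfold val
  have h' := (c.surj r).choose_spec.choose_spec
  set m := (c.surj r).choose
  set q := (c.surj r).choose_spec.choose
  rw [div_eq_div_iff (pow_ne_zero _ ht) (pow_ne_zero _ ht)]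
  have : aeval c.τ (q * c.g ^ n) = aeval c.τ (p * c.g ^ m) := by
    simp only [map_mul, map_pow, ← h, ← h']; ring
  simpa using congrArg (eval t) (c.inj this)

theorem apply_eq_val (y : R →ₐ[ℂ] ℂ) (r : R) : y r = c.val r (y c.τ) := by
  obtain ⟨n, p, h⟩ := c.surj r
  rw [c.val_eq h (c.eval_g_ne_zero y), eq_div_iff (pow_ne_zero _ (c.eval_g_ne_zero y))]
  have := congrArg y h
  rw [map_mul, map_pow, c.apply_aeval, c.apply_aeval] at this
  rw [← this, mul_comm]

/-- The point with coordinate `t`. -/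
def ev (t : ℂ) (ht : c.g.eval t ≠ 0) : R →ₐ[ℂ] ℂ :=
  AlgHom.mk' (R := ℂ) (A := R) (B := ℂ)
    { toFun := fun r => c.val r t
      map_one' := by rw [c.val_eq (n := 0) (p := 1) (by simp) ht]; simp
      map_zero' := by rw [c.val_eq (n := 0) (p := 0) (by simp) ht]; simp
      map_mul' := fun r r' => by
        obtain ⟨n, p, h⟩ := c.surj r
        obtain ⟨m, q, h'⟩ := c.surj r'
        rw [c.val_eq h ht, c.val_eq h' ht, c.val_eq (n := n + m) (p := p * q) (by
          rw [map_mul, ← h, ← h']; ring) ht, eval_mul, pow_add]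
        field_simp
      map_add' := fun r r' => by
        obtain ⟨n, p, h⟩ := c.surj r
        obtain ⟨m, q, h'⟩ := c.surj r'
        rw [c.val_eq h ht, c.val_eq h' ht, c.val_eq (n := n + m)
          (p := c.g ^ m * p + c.g ^ n * q) (by
            simp only [map_add, map_mul, map_pow, ← h, ← h']; ring) ht]
        simp only [eval_add, eval_mul, eval_pow, pow_add]
        field_simp }
    (fun a r => by
      obtain ⟨n, p, h⟩ := c.surj r
      change c.val (a • r) t = a • c.val r t
      rw [c.val_eq h ht, c.val_eq (n := n) (p := C a * p) (by
        rw [map_mul, ← h, aeval_C, Algebra.smul_def]; ring) ht, eval_mul, eval_C, smul_eq_mul,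
        mul_div_assoc])

theorem ev_apply (t : ℂ) (ht : c.g.eval t ≠ 0) (r : R) : c.ev t ht r = c.val r t := rfl

theorem val_τ {t : ℂ} (ht : c.g.eval t ≠ 0) : c.val c.τ t = t := by
  rw [c.val_eq (n := 0) (p := X) (by simp) ht]; simp

theorem ev_τ (t : ℂ) (ht : c.g.eval t ≠ 0) : c.ev t ht c.τ = t := c.val_τ ht

theorem eq_ev (y : R →ₐ[ℂ] ℂ) : y = c.ev (y c.τ) (c.eval_g_ne_zero y) :=
  AlgHom.ext fun r => c.apply_eq_val y r

theorem ext_point {y y' : R →ₐ[ℂ] ℂ} (h : y c.τ = y' c.τ) : y = y' :=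
  AlgHom.ext fun r => by rw [c.apply_eq_val, h, ← c.apply_eq_val]

theorem differentiableAt_val (r : R) {t : ℂ} (ht : c.g.eval t ≠ 0) :
    DifferentiableAt ℂ (c.val r) t := by
  unfold val
  exact (Polynomial.differentiable _).differentiableAt.div
    ((Polynomial.differentiable _).differentiableAt.pow _) (pow_ne_zero _ ht)

theorem isOpen_eval_ne_zero (p : ℂ[X]) : IsOpen {t : ℂ | p.eval t ≠ 0} :=
  isOpen_ne_fun p.continuous continuous_const

theorem contDiffAt_val (r : R) {t : ℂ} (ht : c.g.eval t ≠ 0) {n : WithTop ℕ∞} :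
    ContDiffAt ℂ n (c.val r) t := by
  have : DifferentiableOn ℂ (c.val r) {t | c.g.eval t ≠ 0} := fun t ht =>
    (c.differentiableAt_val r ht).differentiableWithinAt
  exact (this.analyticAt ((isOpen_eval_ne_zero c.g).mem_nhds ht)).contDiffAt

theorem moderate_val {S : Type*} (x : S → ℂ) (r : R) :
    Moderate c.g x (fun s => c.val r (x s)) := by
  unfold val
  simp only [div_eq_mul_inv, ← inv_pow]
  exact (Moderate.eval _).mul (Moderate.inv_eval.pow _)

theorem exists_polynomial_of_ne_zero {r : R} (hr : r ≠ 0) :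
    ∃ p : ℂ[X], p ≠ 0 ∧ ∀ t, c.g.eval t ≠ 0 → p.eval t ≠ 0 → c.val r t ≠ 0 := by
  obtain ⟨n, p, h⟩ := c.surj r
  refine ⟨p, ?_, fun t ht hp => ?_⟩
  · rintro rfl
    rw [map_zero] at h
    exact hr ((c.isUnit.pow n).mul_right_eq_zero.1 h)
  · rw [c.val_eq h ht]
    exact div_ne_zero hp (pow_ne_zero _ ht)

theorem exists_val_eq_of_moderate {F : ℂ → ℂ}
    (hF : ∀ t, c.g.eval t ≠ 0 → DifferentiableAt ℂ F t)
    (hm : Moderate c.g (fun t : {t : ℂ // c.g.eval t ≠ 0} => t.1) (fun t => F t)) :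
    ∃ r : R, ∀ t, c.g.eval t ≠ 0 → F t = c.val r t := by
  obtain ⟨n, p, h⟩ := exists_rational_of_moderate c.g_ne_zero hF hm
  obtain ⟨v, hv⟩ := c.isUnit.exists_left_inv
  refine ⟨v ^ n * aeval c.τ p, fun t ht => ?_⟩
  rw [c.val_eq (n := n) (p := p) _ ht, ← h t ht, mul_div_cancel_left₀ _ (pow_ne_zero _ ht)]
  rw [← mul_assoc, ← mul_pow, mul_comm _ v, hv, one_pow, one_mul]

end LineCoord

end LineCoord

/-! ### Points of finite algebras -/

section Points

open Polynomial Filter Topology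

variable {R : Type} [CommRing R] [Algebra ℂ R] (c : LineCoord R)
  {A : Type} [CommRing A] [Algebra ℂ A] [Algebra R A] [IsScalarTower ℂ R A]

/-- The complex points of a `ℂ`-algebra. -/
abbrev Points (A : Type) [CommRing A] [Algebra ℂ A] : Type := A →ₐ[ℂ] ℂ

/-- The restriction of a point of an `R`-algebra to `R`. -/
def Points.res (R : Type) [CommRing R] [Algebra ℂ R] {A : Type} [CommRing A] [Algebra ℂ A]
    [Algebra R A] [IsScalarTower ℂ R A] (x : Points A) : Points R :=
  x.comp (IsScalarTower.toAlgHom ℂ R A)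

/-- The coordinate of a point. -/
def LineCoord.coord (x : Points A) : ℂ := x (algebraMap R A c.τ)

theorem LineCoord.apply_algebraMap (x : Points A) (r : R) :
    x (algebraMap R A r) = c.val r (c.coord x) :=
  c.apply_eq_val (x.res R) r

theorem LineCoord.eval_g_coord (x : Points A) : c.g.eval (c.coord x) ≠ 0 :=
  c.eval_g_ne_zero (x.res R)

theorem LineCoord.apply_aeval' (x : Points A) (P : R[X]) (a : A) :
    x (aeval a P) = (P.map (c.ev (c.coord x) (c.eval_g_coord x) : R →+* ℂ)).eval (x a) := by
  rw [Polynomial.eval_map, ← AlgHom.coe_toRingHom x, aeval_def, hom_eval₂]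
  congr 1
  ext r
  exact c.apply_algebraMap x r

/-- The data of `d` holomorphic sections over a disc around `t₀`, through all points. -/
structure LocalSystem (A : Type) [CommRing A] [Algebra ℂ A] [Algebra R A] [IsScalarTower ℂ R A]
    (d : ℕ) (t₀ : ℂ) where
  /-- the radius -/
  ε : ℝ
  pos : 0 < ε
  sub : ∀ t ∈ Metric.ball t₀ ε, c.g.eval t ≠ 0
  /-- the sections -/
  s : Fin d → ℂ → Points A
  coord_s : ∀ i, ∀ t ∈ Metric.ball t₀ ε, c.coord (s i t) = t
  hol : ∀ i a, DifferentiableOn ℂ (fun t => s i t a) (Metric.ball t₀ ε)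
  inj : ∀ t ∈ Metric.ball t₀ ε, ∀ i j, s i t = s j t → i = j
  surj : ∀ x : Points A, c.coord x ∈ Metric.ball t₀ ε → ∃ i, x = s i (c.coord x)

/-- The fibre over `t` is separated by an element whose minimal polynomial has degree the rank of
`A` and is separable at `t`. -/
def LineCoord.Good (A : Type) [CommRing A] [Algebra R A] (t : ℂ) : Prop :=
  ∃ (ht : c.g.eval t ≠ 0) (a : A), (minpoly R a).natDegree = Module.finrank R A ∧
    ((minpoly R a).map (c.ev t ht : R →+* ℂ)).Separable

section
variable [IsDomain R] [IsIntegrallyClosed R] [IsDomain A] [Module.Finite R A]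
  [Module.IsTorsionFree R A]

/-- The derivative of the minimal polynomial of a primitive element multiplies `A` into `R[a]`. -/
theorem exists_aeval_derivative_mul (K L : Type) [Field K] [Field L] [Algebra R K]
    [IsFractionRing R K] [Algebra A L] [IsFractionRing A L] [Algebra K L] [Algebra R L]
    [IsScalarTower R K L] [IsScalarTower R A L] [FiniteDimensional K L] [CharZero K]
    {a : A} (ha : (minpoly R a).natDegree = Module.finrank K L) (b : A) :
    ∃ H : R[X], aeval a (minpoly R a).derivative * b = aeval a H := by
  have hinj : Function.Injective (algebraMap A L) := IsFractionRing.injective A L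
  have hia : IsIntegral R a := Algebra.IsIntegral.isIntegral a
  have hiL : ∀ b : A, IsIntegral R (algebraMap A L b) := fun b =>
    (Algebra.IsIntegral.isIntegral b).algebraMap
  have hmR : minpoly R (algebraMap A L a) = minpoly R a := minpoly.algebraMap_eq hinj a
  have hm : minpoly K (algebraMap A L a) = (minpoly R a).map (algebraMap R K) := by
    rw [minpoly.isIntegrallyClosed_eq_field_fractions' K (hiL a), hmR]
  have hprim : IntermediateField.adjoin K {algebraMap A L a} = ⊤ := by
    rw [Field.primitive_element_iff_minpoly_natDegree_eq, hm,
      (minpoly.monic hia).natDegree_map, ha]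
  have htop : Algebra.adjoin K {algebraMap A L a} = ⊤ := by
    rw [← IntermediateField.adjoin_simple_toSubalgebra_of_isAlgebraic
      (Algebra.IsAlgebraic.isAlgebraic _), hprim]
    rfl
  -- Euler: the dual of `R[a]` for the trace form is `P'(a)⁻¹ R[a]`, with `P` the minimal
  -- polynomial. Traces of integral elements lie in the integrally closed ring `R`, so `A` is
  -- contained in this dual.
  have key := traceForm_dualSubmodule_adjoin R K htop (hiL a)
  have hb : algebraMap A L b ∈ (Algebra.traceForm K L).dualSubmodule
      (Subalgebra.toSubmodule (Algebra.adjoin R {algebraMap A L a})) := by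
    rw [LinearMap.BilinForm.mem_dualSubmodule]
    intro y hy
    obtain ⟨Q, rfl⟩ : ∃ Q : R[X], algebraMap A L (aeval a Q) = y := by
      rw [Subalgebra.mem_toSubmodule, Algebra.adjoin_singleton_eq_range_aeval] at hy
      obtain ⟨Q, rfl⟩ := hy
      exact ⟨Q, (aeval_algebraMap_apply L a Q).symm⟩
    rw [Algebra.traceForm_apply, ← map_mul]
    obtain ⟨r, hr⟩ := IsIntegrallyClosed.isIntegral_iff.1
      (Algebra.isIntegral_trace (L := K) (hiL (b * aeval a Q)))
    exact Submodule.mem_one.2 ⟨r, hr⟩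
  rw [key, Submodule.mem_smul_pointwise_iff_exists] at hb
  obtain ⟨z, hz, hzb⟩ := hb
  rw [Subalgebra.mem_toSubmodule, Algebra.adjoin_singleton_eq_range_aeval] at hz
  obtain ⟨H, rfl⟩ := hz
  refine ⟨H, hinj ?_⟩
  have hsep : aeval (algebraMap A L a) (derivative (minpoly K (algebraMap A L a))) ≠ 0 :=
    (Algebra.IsSeparable.isSeparable K (algebraMap A L a)).aeval_derivative_ne_zero
      (minpoly.aeval _ _)
  rw [map_mul, ← hzb, ← aeval_algebraMap_apply, ← aeval_algebraMap_apply, smul_eq_mul]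
  rw [hm, Polynomial.derivative_map, aeval_map_algebraMap] at hsep ⊢
  exact mul_inv_cancel_left₀ hsep _

omit [IsIntegrallyClosed R] [IsDomain A] [IsDomain R] in
theorem bijective_algebraMap_quotient [Algebra.FiniteType ℂ R] (M : Ideal A) [M.IsMaximal] :
    Function.Bijective (algebraMap ℂ (A ⧸ M)) := by
  letI := Ideal.Quotient.field M
  have : Algebra.FiniteType R A := inferInstance
  have : Algebra.FiniteType ℂ A := Algebra.FiniteType.trans (S := R) ‹_› ‹_›
  have : Algebra.FiniteType ℂ (A ⧸ M) := inferInstance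
  have : Module.Finite ℂ (A ⧸ M) := finite_of_finite_type_of_isJacobsonRing ℂ (A ⧸ M)
  exact IsAlgClosed.algebraMap_bijective_of_isIntegral

/-- The point of a maximal ideal. -/
theorem exists_point_of_isMaximal [Algebra.FiniteType ℂ R] (M : Ideal A) [M.IsMaximal] :
    ∃ x : Points A, ∀ a, x a = 0 ↔ a ∈ M := by
  let e := AlgEquiv.ofBijective (Algebra.ofId ℂ (A ⧸ M)) (bijective_algebraMap_quotient (R := R) M)
  refine ⟨(e.symm : (A ⧸ M) →ₐ[ℂ] ℂ).comp (Ideal.Quotient.mkₐ ℂ M), fun a => ?_⟩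
  simp [Ideal.Quotient.eq_zero_iff_mem]

/-- Points of `R` together with a root of the minimal polynomial of `a` lift to points of `A`. -/
theorem exists_point_of_isRoot (a : A) {t : ℂ} (ht : c.g.eval t ≠ 0) {y : ℂ}
    (hy : ((minpoly R a).map (c.ev t ht : R →+* ℂ)).IsRoot y) :
    ∃ x : Points A, c.coord x = t ∧ x a = y := by
  have hia : IsIntegral R a := Algebra.IsIntegral.isIntegral a
  have := c.finiteType
  -- Since `R` is integrally closed, `R[a]` is `R[Y]` modulo the minimal polynomial, so the pair
  -- `(t, y)` defines a homomorphism `R[a] → ℂ`. A maximal ideal of `A` over its kernel is the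
  -- wanted point.
  let S := Algebra.adjoin R {a}
  let e := minpoly.equivAdjoin hia
  let ψ : S →+* ℂ := (AdjoinRoot.lift (c.ev t ht : R →+* ℂ) y
    (by rwa [← Polynomial.eval_map])).comp (e.symm : S →+* AdjoinRoot (minpoly R a))
  have hψR : ∀ r : R, ψ (algebraMap R S r) = c.val r t := fun r => by
    simp only [ψ, RingHom.comp_apply, RingHom.coe_coe, AlgEquiv.commutes, AdjoinRoot.algebraMap_eq,
      AdjoinRoot.lift_of, c.ev_apply]
  have hψa : ∀ h : a ∈ S, ψ ⟨a, h⟩ = y := fun h => by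
    have : e (AdjoinRoot.root _) = ⟨a, h⟩ := by
      ext; simp [e, minpoly.coe_equivAdjoin]
    simp only [ψ, RingHom.comp_apply, RingHom.coe_coe, ← this, AlgEquiv.symm_apply_apply,
      AdjoinRoot.lift_root]
  have hψC : ∀ z : ℂ, ψ (algebraMap R S (algebraMap ℂ R z)) = z := fun z => by
    rw [hψR, ← c.ev_apply t ht, AlgHom.commutes]; rfl
  have hsurj : Function.Surjective ψ := fun z => ⟨_, hψC z⟩
  have := RingHom.ker_isMaximal_of_surjective ψ hsurj
  have hSA : Function.Injective (algebraMap S A) := Subtype.val_injective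
  have : Algebra.IsIntegral S A := Algebra.IsIntegral.tower_top (R := R)
  obtain ⟨M, hM, hMc⟩ := Ideal.exists_ideal_over_maximal_of_isIntegral (S := A) (RingHom.ker ψ)
    (by rw [(RingHom.injective_iff_ker_eq_bot _).1 hSA]; exact bot_le)
  obtain ⟨x, hx⟩ := exists_point_of_isMaximal (R := R) M
  have key : ∀ z : S, x z = ψ z := fun z => by
    have h1 : z - algebraMap R S (algebraMap ℂ R (ψ z)) ∈ Ideal.comap (algebraMap S A) M := by
      rw [hMc, RingHom.mem_ker, map_sub, hψC, sub_self]
    rw [Ideal.mem_comap, ← hx, map_sub, map_sub, sub_eq_zero] at h1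
    rw [← show algebraMap S A z = z from rfl, h1, ← IsScalarTower.algebraMap_apply R S A,
      ← IsScalarTower.algebraMap_apply ℂ R A, AlgHom.commutes]
    rfl
  refine ⟨x, ?_, ?_⟩
  · have := key (algebraMap R S c.τ)
    rw [hψR, c.val_τ ht] at this
    exact this
  · exact (key ⟨a, Algebra.self_mem_adjoin_singleton R a⟩).trans (hψa _)

/-- The value of a polynomial `H ∈ R[Y]` at the point with coordinate `t` and at `Y = y`. -/
def LineCoord.bieval (H : R[X]) (t y : ℂ) : ℂ :=
  ∑ j ∈ Finset.range (H.natDegree + 1), c.val (H.coeff j) t * y ^ j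

theorem LineCoord.bieval_eq (H : R[X]) {t : ℂ} (ht : c.g.eval t ≠ 0) (y : ℂ) :
    c.bieval H t y = (H.map (c.ev t ht : R →+* ℂ)).eval y := by
  rw [Polynomial.eval_map, eval₂_eq_sum_range]
  rfl

theorem LineCoord.apply_aeval_eq_bieval (x : Points A) (H : R[X]) (a : A) :
    x (aeval a H) = c.bieval H (c.coord x) (x a) := by
  rw [c.apply_aeval', c.bieval_eq H (c.eval_g_coord x)]

theorem LineCoord.differentiableAt_bieval (H : R[X]) {t : ℂ} (ht : c.g.eval t ≠ 0) {r : ℂ → ℂ}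
    (hr : DifferentiableAt ℂ r t) : DifferentiableAt ℂ (fun t => c.bieval H t (r t)) t := by
  unfold bieval
  have := fun j => c.differentiableAt_val (H.coeff j) ht
  fun_prop

theorem LineCoord.contDiffAt_bieval (H : R[X]) {t : ℂ} (ht : c.g.eval t ≠ 0) (y : ℂ) :
    ContDiffAt ℂ 1 (fun u : ℂ × ℂ => c.bieval H u.1 u.2) (t, y) := by
  unfold bieval
  refine ContDiffAt.sum fun j _ => ContDiffAt.mul ?_ (contDiffAt_snd.pow _)
  exact ContDiffAt.comp (t, y) (c.contDiffAt_val (H.coeff j) ht) contDiffAt_fst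

/-- The roots of the specialized minimal polynomial `P` are simple at `t₀` and continue
holomorphically. By `hcond` a point over `t` satisfies `P'(t, x a) * x b = H(t, x a)`, so the value
at `a` determines the point and every other value is holomorphic in `t`. -/
theorem exists_localSystem {d : ℕ} {a : A} (ha : (minpoly R a).natDegree = d)
    (hcond : ∀ b : A, ∃ H : R[X], aeval a (minpoly R a).derivative * b = aeval a H)
    {t₀ : ℂ} (ht₀ : c.g.eval t₀ ≠ 0)
    (hsep : ((minpoly R a).map (c.ev t₀ ht₀ : R →+* ℂ)).Separable) :
    Nonempty (LocalSystem c A d t₀) := by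
  classical
  have hia : IsIntegral R a := Algebra.IsIntegral.isIntegral a
  set P := minpoly R a with hP
  have hmon : P.Monic := minpoly.monic hia
  have hdeg : ∀ t (ht : c.g.eval t ≠ 0), (P.map (c.ev t ht : R →+* ℂ)).natDegree = d :=
    fun t ht => by rw [hmon.natDegree_map, ha]
  set P₀ := P.map (c.ev t₀ ht₀ : R →+* ℂ) with hP₀
  have hcard : P₀.roots.toFinset.card = d := by
    rw [Multiset.toFinset_card_of_nodup (nodup_roots hsep), ← hdeg t₀ ht₀]
    exact (IsAlgClosed.splits P₀).natDegree_eq_card_roots.symm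
  let y := (Finset.equivFinOfCardEq hcard).symm
  have hroot : ∀ i, P₀.IsRoot (y i) := fun i => by
    have := (y i).2
    rw [Multiset.mem_toFinset] at this
    exact isRoot_of_mem_roots this
  have hder : ∀ i, P₀.derivative.eval (y i : ℂ) ≠ 0 := fun i =>
    hsep.eval₂_derivative_ne_zero (RingHom.id ℂ) (hroot i)
  have hIFT : ∀ i, ∃ r : ℂ → ℂ, r t₀ = y i ∧ (∀ᶠ t in 𝓝 t₀, c.bieval P t (r t) = 0) ∧
      ∀ᶠ t in 𝓝 t₀, DifferentiableAt ℂ r t := fun i => by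
    refine exists_holomorphic_root (F := fun u => c.bieval P u.1 u.2)
      (c.contDiffAt_bieval P ht₀ _) ?_ (F' := P₀.derivative.eval (y i : ℂ)) ?_ (hder i)
    · rw [c.bieval_eq P ht₀]; exact hroot i
    · simp only [c.bieval_eq P ht₀]; exact P₀.hasDerivAt _
  choose r hr0 hr1 hr2 using hIFT
  have hcont : ∀ i, ContinuousAt (r i) t₀ := fun i => (hr2 i).self_of_nhds.continuousAt
  have hg : ∀ᶠ t in 𝓝 t₀, c.g.eval t ≠ 0 := (LineCoord.isOpen_eval_ne_zero c.g).mem_nhds ht₀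
  have hne : ∀ i, ∀ᶠ t in 𝓝 t₀, c.bieval P.derivative t (r i t) ≠ 0 := fun i => by
    refine ((c.differentiableAt_bieval P.derivative ht₀
      (hr2 i).self_of_nhds).continuousAt).eventually_ne ?_
    rw [c.bieval_eq _ ht₀, hr0, ← derivative_map]
    exact hder i
  have hdist : ∀ i j, ∀ᶠ t in 𝓝 t₀, r i t = r j t → i = j := fun i j => by
    by_cases hij : i = j
    · exact Eventually.of_forall fun _ _ => hij
    · have : r i t₀ ≠ r j t₀ := by
        rw [hr0, hr0]
        exact fun h => hij (y.injective (Subtype.ext h))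
      exact (((hcont i).ne_iff_eventually_ne (hcont j)).1 this).mono fun t ht h => (ht h).elim
  have hall : ∀ᶠ t in 𝓝 t₀, c.g.eval t ≠ 0 ∧ (∀ i, c.bieval P t (r i t) = 0) ∧
      (∀ i, DifferentiableAt ℂ (r i) t) ∧ (∀ i, c.bieval P.derivative t (r i t) ≠ 0) ∧
      ∀ i j, r i t = r j t → i = j := by
    refine hg.and ((eventually_all.2 hr1).and ((eventually_all.2 hr2).and
      ((eventually_all.2 hne).and (eventually_all.2 fun i => eventually_all.2 (hdist i)))))
  obtain ⟨ε, hε, hball⟩ := Metric.eventually_nhds_iff_ball.1 hall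
  -- Outside the disc the sections take a junk value, a point over `t₀`.
  have hex : ∀ i t, ∃ x : Points A, t ∈ Metric.ball t₀ ε → c.coord x = t ∧ x a = r i t := by
    intro i t
    by_cases ht : t ∈ Metric.ball t₀ ε
    · obtain ⟨h1, h2, -⟩ := hball t ht
      obtain ⟨x, hx⟩ := exists_point_of_isRoot c a h1 (y := r i t)
        (by rw [IsRoot.def, ← c.bieval_eq P h1]; exact h2 i)
      exact ⟨x, fun _ => hx⟩
    · obtain ⟨x, hx⟩ := exists_point_of_isRoot c a ht₀ (hroot i)
      exact ⟨x, fun h => (ht h).elim⟩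
  choose s hs using hex
  have hs1 : ∀ i, ∀ t ∈ Metric.ball t₀ ε, c.coord (s i t) = t := fun i t ht => (hs i t ht).1
  have hs2 : ∀ i, ∀ t ∈ Metric.ball t₀ ε, s i t a = r i t := fun i t ht => (hs i t ht).2
  have hformula : ∀ (x : Points A) (b : A) (H : R[X]), aeval a P.derivative * b = aeval a H →
      c.bieval P.derivative (c.coord x) (x a) * x b = c.bieval H (c.coord x) (x a) := by
    intro x b H h
    rw [← c.apply_aeval_eq_bieval, ← c.apply_aeval_eq_bieval, ← h, map_mul]
  refine ⟨⟨ε, hε, fun t ht => (hball t ht).1, s, hs1, fun i b => ?_, fun t ht i j hij => ?_,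
    fun x hx => ?_⟩⟩
  · obtain ⟨H, hH⟩ := hcond b
    have hEq : Set.EqOn (fun t => s i t b)
        (fun t => c.bieval H t (r i t) / c.bieval P.derivative t (r i t))
        (Metric.ball t₀ ε) := fun t ht => by
      have := hformula (s i t) b H hH
      rw [hs1 i t ht, hs2 i t ht] at this
      rw [eq_div_iff ((hball t ht).2.2.2.1 i), ← this, mul_comm]
    refine DifferentiableOn.congr (fun t ht => ?_) hEq
    obtain ⟨h1, h2, h3, h4, h5⟩ := hball t ht
    exact ((c.differentiableAt_bieval H h1 (h3 i)).div
      (c.differentiableAt_bieval _ h1 (h3 i)) (h4 i)).differentiableWithinAt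
  · refine (hball t ht).2.2.2.2 i j ?_
    rw [← hs2 i t ht, ← hs2 j t ht, hij]
  · set t := c.coord x
    obtain ⟨h1, h2, h3, h4, h5⟩ := hball t hx
    have hne0 : P.map (c.ev t h1 : R →+* ℂ) ≠ 0 := (hmon.map _).ne_zero
    have hsub : Finset.univ.image (fun i => r i t) ⊆
        (P.map (c.ev t h1 : R →+* ℂ)).roots.toFinset := by
      intro z hz
      obtain ⟨i, -, rfl⟩ := Finset.mem_image.1 hz
      rw [Multiset.mem_toFinset, mem_roots hne0, IsRoot.def, ← c.bieval_eq P h1]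
      exact h2 i
    -- The `d` continued roots are distinct and `P` has degree `d`, so no root is missed.
    have heq := Finset.eq_of_subset_of_card_le hsub (by
      rw [Finset.card_image_of_injective _ fun i j hij => h5 i j hij, Finset.card_univ,
        Fintype.card_fin]
      exact (Multiset.toFinset_card_le _).trans ((card_roots' _).trans (hdeg t h1).le))
    have hxa : x a ∈ Finset.univ.image (fun i => r i t) := by
      rw [heq, Multiset.mem_toFinset, mem_roots hne0, IsRoot.def, ← c.bieval_eq P h1,
        ← c.apply_aeval_eq_bieval, minpoly.aeval, map_zero]
    obtain ⟨i, -, hi⟩ := Finset.mem_image.1 hxa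
    refine ⟨i, AlgHom.ext fun b => ?_⟩
    obtain ⟨H, hH⟩ := hcond b
    have e1 := hformula x b H hH
    have e2 := hformula (s i t) b H hH
    rw [← hi] at e1
    rw [hs1 i t hx, hs2 i t hx, ← e1] at e2
    exact (mul_left_cancel₀ (h4 i) e2).symm

end

end Points

/-! ### Points with an unramified fibre. -/

section Good

open Polynomial Filter Topology

variable {R : Type} [CommRing R] [Algebra ℂ R] (c : LineCoord R)
  {A : Type} [CommRing A] [Algebra ℂ A] [Algebra R A] [IsScalarTower ℂ R A]
  [IsDomain R] [IsIntegrallyClosed R] [IsDomain A] [Module.Finite R A] [Module.IsTorsionFree R A]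

/-- The nonzero constant term of an integral equation for `q` is a multiple of `q`. Thus
denominators can always be taken in `R`. -/
theorem exists_mul_eq_algebraMap {q : A} (hq : q ≠ 0) :
    ∃ (q' : A) (r : R), r ≠ 0 ∧ q * q' = algebraMap R A r := by
  obtain ⟨r, hr, q', h⟩ := (Algebra.IsIntegral.isIntegral (R := R) q).isAlgebraic.exists_nonzero_dvd
    (mem_nonZeroDivisors_of_ne_zero hq)
  exact ⟨q', r, hr, h.symm⟩

include c in
/-- There is an integral primitive element. -/
theorem exists_natDegree_minpoly_eq_finrank :
    ∃ a : A, (minpoly R a).natDegree = Module.finrank R A := by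
  let K := FractionRing R
  let L := FractionRing A
  letI : Algebra K L := FractionRing.liftAlgebra R L
  have : Module.Finite K L := Module.Finite.of_isLocalization R A (nonZeroDivisors R)
  have : CharZero K := charZero_of_injective_algebraMap (R := ℂ) (algebraMap ℂ K).injective
  obtain ⟨α, hα⟩ := Field.exists_primitive_element K L
  obtain ⟨a₁, a₂, ha₂, rfl⟩ := IsFractionRing.div_surjective A α
  -- The primitive element `a₁ / a₂` equals `a₁ * q' / r`, and dropping the factor `1 / r` from the
  -- base field leaves a primitive element in `A`.
  obtain ⟨q', r, hr, hq⟩ := exists_mul_eq_algebraMap (R := R) (nonZeroDivisors.ne_zero ha₂)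
  refine ⟨a₁ * q', ?_⟩
  have hi := (Algebra.IsIntegral.isIntegral (R := R) (a₁ * q'))
  have hm : minpoly K (algebraMap A L (a₁ * q')) =
      (minpoly R (a₁ * q')).map (algebraMap R K) := by
    rw [minpoly.isIntegrallyClosed_eq_field_fractions' K hi.algebraMap,
      minpoly.algebraMap_eq (IsFractionRing.injective A L)]
  rw [← IsFractionRing.finrank_eq R K A L, ← (minpoly.monic hi).natDegree_map (algebraMap R K),
    ← hm, ← Field.primitive_element_iff_minpoly_natDegree_eq, eq_top_iff, ← hα,
    IntermediateField.adjoin_simple_le_iff]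
  have h2 : algebraMap A L a₂ ≠ 0 := by
    simpa using nonZeroDivisors.ne_zero ha₂
  have hr' : algebraMap R L r ≠ 0 := by
    simpa using hr
  have h3 : algebraMap A L a₂ * algebraMap A L q' = algebraMap R L r := by
    rw [← map_mul, hq, ← IsScalarTower.algebraMap_apply]
  have : algebraMap A L a₁ / algebraMap A L a₂ =
      algebraMap A L (a₁ * q') * (algebraMap R L r)⁻¹ := by
    rw [map_mul, div_eq_iff h2, ← h3]
    have h4 : algebraMap A L q' ≠ 0 := fun h => hr' (by rw [← h3, h, mul_zero])
    rw [mul_assoc _ _⁻¹, mul_inv, mul_comm (algebraMap A L a₂)⁻¹, inv_mul_cancel_right₀ h2,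
      mul_inv_cancel_right₀ h4]
  rw [this]
  refine mul_mem (IntermediateField.mem_adjoin_simple_self K _) (inv_mem ?_)
  rw [IsScalarTower.algebraMap_apply R K L]
  exact IntermediateField.algebraMap_mem _ _

variable {c} in
theorem LineCoord.Good.localSystem {t : ℂ} (h : c.Good A t) :
    Nonempty (LocalSystem c A (Module.finrank R A) t) := by
  obtain ⟨ht, a, ha, hsep⟩ := h
  let K := FractionRing R
  let L := FractionRing A
  letI : Algebra K L := FractionRing.liftAlgebra R L
  have : Module.Finite K L := Module.Finite.of_isLocalization R A (nonZeroDivisors R)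
  have : CharZero K := charZero_of_injective_algebraMap (R := ℂ) (algebraMap ℂ K).injective
  exact exists_localSystem c ha (exists_aeval_derivative_mul K L
    (by rw [ha, IsFractionRing.finrank_eq R K A L])) ht hsep

theorem aeval_derivative_minpoly_ne_zero (a : A) :
    aeval a (minpoly R a).derivative ≠ 0 := by
  let K := FractionRing R
  let L := FractionRing A
  letI : Algebra K L := FractionRing.liftAlgebra R L
  have hia := Algebra.IsIntegral.isIntegral (R := R) a
  have : Module.Finite K L := Module.Finite.of_isLocalization R A (nonZeroDivisors R)
  have : CharZero K := charZero_of_injective_algebraMap (R := ℂ) (algebraMap ℂ K).injective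
  intro h0
  have hm : minpoly K (algebraMap A L a) = (minpoly R a).map (algebraMap R K) := by
    rw [minpoly.isIntegrallyClosed_eq_field_fractions' K hia.algebraMap,
      minpoly.algebraMap_eq (IsFractionRing.injective A L)]
  refine (Algebra.IsSeparable.isSeparable K (algebraMap A L a)).aeval_derivative_ne_zero
    (minpoly.aeval K (algebraMap A L a)) ?_
  rw [hm, derivative_map, aeval_map_algebraMap, aeval_algebraMap_apply, h0, map_zero]

/-- A nonzero multiple `r ∈ R` of `P'(a)` vanishes wherever the minimal polynomial `P` acquires a
multiple root, since such a root lifts to a point of `A`. So only finitely many points are bad. -/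
theorem LineCoord.exists_polynomial_good :
    ∃ p : ℂ[X], p ≠ 0 ∧ ∀ t, c.g.eval t ≠ 0 → p.eval t ≠ 0 → c.Good A t := by
  obtain ⟨a, ha⟩ := exists_natDegree_minpoly_eq_finrank c (A := A)
  obtain ⟨b, r, hr, hb⟩ := exists_mul_eq_algebraMap (R := R) (aeval_derivative_minpoly_ne_zero (R := R) a)
  obtain ⟨p, hp, hpt⟩ := c.exists_polynomial_of_ne_zero hr
  refine ⟨p, hp, fun t ht h => ⟨ht, a, ha, ?_⟩⟩
  rw [Polynomial.separable_def, Polynomial.isCoprime_iff_aeval_ne_zero_of_isAlgClosed (k := ℂ) ℂ]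
  intro y
  by_contra! hy
  obtain ⟨x, hx, hxa⟩ := exists_point_of_isRoot c a ht (y := y) (by simpa using hy.1)
  have h1 := congrArg x hb
  rw [map_mul, c.apply_aeval_eq_bieval, c.apply_algebraMap, hx, hxa, c.bieval_eq _ ht,
    ← derivative_map] at h1
  refine hpt t ht h (h1.symm.trans ?_)
  have := hy.2
  rw [coe_aeval_eq_eval] at this
  rw [this, zero_mul]

/-- The values of `a` are rank many distinct roots of a polynomial of degree at most the rank.
Equality must hold throughout, which gives both the degree and the separability. -/
theorem LineCoord.good_of_card_le {t : ℂ} (ht : c.g.eval t ≠ 0) {I : Type} [Fintype I]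
    (x : I → Points A) (hx : ∀ i, c.coord (x i) = t) (a : A)
    (hinj : Function.Injective fun i => x i a) (hcard : Fintype.card I = Module.finrank R A) :
    c.Good A t := by
  classical
  let K := FractionRing R
  let L := FractionRing A
  letI : Algebra K L := FractionRing.liftAlgebra R L
  have : Module.Finite K L := Module.Finite.of_isLocalization R A (nonZeroDivisors R)
  have hi := Algebra.IsIntegral.isIntegral (R := R) a
  have hm : minpoly K (algebraMap A L a) = (minpoly R a).map (algebraMap R K) := by
    rw [minpoly.isIntegrallyClosed_eq_field_fractions' K hi.algebraMap,
      minpoly.algebraMap_eq (IsFractionRing.injective A L)]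
  have hle : (minpoly R a).natDegree ≤ Module.finrank R A := by
    rw [← IsFractionRing.finrank_eq R K A L, ← (minpoly.monic hi).natDegree_map (algebraMap R K),
      ← hm]
    exact minpoly.natDegree_le _
  set Q := (minpoly R a).map (c.ev t ht : R →+* ℂ) with hQ
  have hQm : Q.Monic := (minpoly.monic hi).map _
  have hQd : Q.natDegree = (minpoly R a).natDegree := (minpoly.monic hi).natDegree_map _
  have hsub : Finset.univ.image (fun i => x i a) ⊆ Q.roots.toFinset := by
    intro z hz
    obtain ⟨i, -, rfl⟩ := Finset.mem_image.1 hz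
    have h := c.apply_aeval_eq_bieval (x i) (minpoly R a) a
    rw [minpoly.aeval, map_zero, hx, c.bieval_eq _ ht] at h
    rw [Multiset.mem_toFinset, mem_roots hQm.ne_zero, IsRoot.def, ← h]
  have h1 := Finset.card_le_card hsub
  rw [Finset.card_image_of_injective _ hinj, Finset.card_univ, hcard] at h1
  have h2 := Multiset.toFinset_card_le Q.roots
  have h3 := card_roots' Q
  refine ⟨ht, a, by omega, ?_⟩
  rw [← nodup_roots_iff_of_splits hQm.ne_zero (IsAlgClosed.splits _),
    ← Multiset.toFinset_card_eq_card_iff_nodup]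
  omega

-- The fibre `ℂ ⊗ A` is étale over `ℂ`, hence a product of copies of `ℂ`, as many as the rank of the
-- free module `A`. The projections are the points needed for `good_of_card_le`.
open TensorProduct in
theorem LineCoord.good_of_etale [IsPrincipalIdealRing R] [Algebra.Etale R A] {t : ℂ}
    (ht : c.g.eval t ≠ 0) : c.Good A t := by
  letI : Algebra R ℂ := (c.ev t ht : R →+* ℂ).toAlgebra
  have : Module.Free R A := Module.free_of_finite_type_torsion_free'
  let T := ℂ ⊗[R] A
  obtain ⟨I, _, F, _, _, e, hF⟩ :=
    (Algebra.FormallyEtale.iff_exists_algEquiv_prod ℂ T).1 inferInstance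
  have := Fintype.ofFinite I
  let f : ∀ i, ℂ ≃ₐ[ℂ] F i := fun i => AlgEquiv.ofBijective (Algebra.ofId ℂ (F i))
    IsAlgClosed.algebraMap_bijective_of_isIntegral
  let e' : T ≃ₐ[ℂ] (I → ℂ) := e.trans (AlgEquiv.piCongrRight fun i => (f i).symm)
  have hcard : Fintype.card I = Module.finrank R A := by
    rw [← Module.finrank_baseChange (R := ℂ), ← Module.finrank_fintype_fun_eq_card ℂ]
    exact e'.symm.toLinearEquiv.finrank_eq
  have hRT : ∀ r : R, (1 : ℂ) ⊗ₜ[R] algebraMap R A r = algebraMap ℂ T (c.val r t) := fun r => by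
    rw [Algebra.algebraMap_eq_smul_one, ← TensorProduct.smul_tmul, Algebra.smul_def, mul_one]
    rfl
  let x : I → Points A := fun i =>
    { ((Pi.evalRingHom (fun _ : I => ℂ) i).comp (e' : T →+* (I → ℂ))).comp
        (Algebra.TensorProduct.includeRight : A →ₐ[R] T).toRingHom with
      commutes' := fun z => by
        change e' ((1 : ℂ) ⊗ₜ[R] algebraMap ℂ A z) i = z
        rw [IsScalarTower.algebraMap_apply ℂ R A, hRT, ← c.ev_apply t ht, AlgHom.commutes,
          AlgEquiv.commutes]
        rfl }
  -- `A` maps onto the fibre because `R → ℂ` is onto, so some `a` takes the distinct values 0, 1, 2,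
  -- … at the points.
  obtain ⟨a, ha⟩ := Algebra.TensorProduct.includeRight_surjective (R := R) (S := ℂ) (T := A)
    (fun z => ⟨algebraMap ℂ R z, (c.ev t ht).commutes z⟩)
    (e'.symm fun i => ((Fintype.equivFin I i : ℕ) : ℂ))
  refine c.good_of_card_le ht x (fun i => ?_) a (fun i j hij => ?_) hcard
  · change e' ((1 : ℂ) ⊗ₜ[R] algebraMap R A c.τ) i = t
    rw [hRT, AlgEquiv.commutes, c.val_τ ht]
    rfl
  · have h : ∀ i, x i a = ((Fintype.equivFin I i : ℕ) : ℂ) := fun i => by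
      change e' (Algebra.TensorProduct.includeRight a) i = _
      rw [ha, AlgEquiv.apply_symm_apply]
    simp only [h, Nat.cast_inj] at hij
    exact (Fintype.equivFin I).injective (Fin.ext hij)

end Good

/-! ### The topology on the points of a finite algebra -/

section PointsTopology

open Polynomial Filter Topology

/-- The topology of pointwise convergence. -/
instance (A : Type) [CommRing A] [Algebra ℂ A] : TopologicalSpace (Points A) :=
  TopologicalSpace.induced (fun x a => x a) inferInstance

namespace Points

variable {A : Type} [CommRing A] [Algebra ℂ A]

theorem continuous_apply (a : A) : Continuous fun x : Points A => x a :=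
  (_root_.continuous_apply a).comp continuous_induced_dom

theorem continuous_iff {S : Type*} [TopologicalSpace S] {f : S → Points A} :
    Continuous f ↔ ∀ a, Continuous fun s => f s a :=
  continuous_induced_rng.trans continuous_pi_iff

theorem continuousOn_iff {S : Type*} [TopologicalSpace S] {f : S → Points A} {U : Set S} :
    ContinuousOn f U ↔ ∀ a, ContinuousOn (fun s => f s a) U := by
  simp only [continuousOn_iff_continuous_domRestrict]
  exact continuous_iff

instance : T2Space (Points A) := by
  refine T2Space.of_injective_continuous (f := fun x : Points A => (x : A → ℂ)) (fun x y h => ?_)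
    continuous_induced_dom
  exact DFunLike.coe_injective h

end Points

theorem eventually_eval_ne_zero {p : ℂ[X]} (hp : p ≠ 0) (u : ℂ) :
    ∀ᶠ t in 𝓝[≠] u, p.eval t ≠ 0 := by
  have : ∀ᶠ t in 𝓝[≠] u, t ∈ ((p.roots.toFinset.erase u : Finset ℂ) : Set ℂ)ᶜ :=
    nhdsWithin_le_nhds ((Finset.finite_toSet _).isClosed.isOpen_compl.mem_nhds (by simp))
  filter_upwards [this, self_mem_nhdsWithin] with t ht htu h0
  exact ht (by simpa [hp, h0] using htu)

variable {R : Type} [CommRing R] [Algebra ℂ R] {c : LineCoord R}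
  {A : Type} [CommRing A] [Algebra ℂ A] [Algebra R A] [IsScalarTower ℂ R A]

theorem LineCoord.continuous_coord : Continuous (c.coord : Points A → ℂ) :=
  Points.continuous_apply _

namespace LocalSystem

variable {d : ℕ} {t₀ : ℂ} (S : LocalSystem c A d t₀)

/-- The disc over which the sections are defined. -/
abbrev disc : Set ℂ := Metric.ball t₀ S.ε

theorem isOpen_disc : IsOpen S.disc := Metric.isOpen_ball

theorem center_mem : t₀ ∈ S.disc := Metric.mem_ball_self S.pos

theorem continuousOn_s (i : Fin d) : ContinuousOn (S.s i) S.disc :=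
  Points.continuousOn_iff.2 fun a => (S.hol i a).continuousOn

theorem isPreconnected_disc : IsPreconnected S.disc := (convex_ball _ _).isPreconnected

theorem exists_section (x : Points A) (hx : c.coord x ∈ S.disc) :
    ∃ i, S.s i (c.coord x) = x := (S.surj x hx).imp fun _ h => h.symm

/-- The sections exhaust the fibre, so lying on one sheet means avoiding the finitely many others,
an open condition in a Hausdorff space. -/
theorem isOpen_sheet (i : Fin d) :
    IsOpen {x : Points A | c.coord x ∈ S.disc ∧ x = S.s i (c.coord x)} := by
  have hU : IsOpen {x : Points A | c.coord x ∈ S.disc} :=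
    S.isOpen_disc.preimage c.continuous_coord
  rw [isOpen_iff_mem_nhds]
  rintro x ⟨hx, hxi⟩
  have hne : ∀ j, j ≠ i → ∀ᶠ y in 𝓝 x, y ≠ S.s j (c.coord y) := by
    intro j hj
    have hc : ContinuousAt (fun y : Points A => S.s j (c.coord y)) x :=
      ContinuousAt.comp (g := S.s j) ((S.continuousOn_s j).continuousAt (S.isOpen_disc.mem_nhds hx))
        c.continuous_coord.continuousAt
    refine (continuousAt_id.ne_iff_eventually_ne hc).1 fun h => hj ?_
    exact S.inj _ hx j i (h.symm.trans hxi)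
  filter_upwards [hU.mem_nhds hx,
    eventually_all.2 fun j => eventually_imp_distrib_left.2 (hne j)] with y hy hy'
  obtain ⟨j, hj⟩ := S.surj y hy
  refine ⟨hy, ?_⟩
  by_cases hji : j = i
  · rwa [← hji]
  · exact (hy' j hji hj).elim

/-- One path in the disc is lifted along all sections simultaneously, so the lifts run in parallel.
-/
theorem exists_path {t t' : ℂ} (ht : t ∈ S.disc) (ht' : t' ∈ S.disc) :
    ∃ Γ : ∀ i, Path (S.s i t) (S.s i t'), ∀ i j x, c.coord (Γ i x) = c.coord (Γ j x) := by
  obtain ⟨γ, hγ⟩ := ((convex_ball t₀ S.ε).isPathConnected ⟨t, ht⟩).joinedIn t ht t' ht'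
  have hr : Set.range γ ⊆ S.disc := by rintro _ ⟨x, rfl⟩; exact hγ x
  refine ⟨fun i => γ.map' ((S.continuousOn_s i).mono hr), fun i j x => ?_⟩
  change c.coord (S.s i (γ x)) = c.coord (S.s j (γ x))
  rw [S.coord_s i _ (hγ x), S.coord_s j _ (hγ x)]

theorem fiber_eq {t : ℂ} (ht : t ∈ S.disc) :
    {x : Points A | c.coord x = t} = (fun i => S.s i t) '' ((Finset.univ : Finset (Fin d)) : Set _) := by
  ext x
  constructor
  · rintro rfl
    obtain ⟨i, hi⟩ := S.exists_section x ht
    exact ⟨i, by simp, hi⟩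
  · rintro ⟨i, -, rfl⟩
    exact S.coord_s i t ht

end LocalSystem

/-! ### Rationality of locally holomorphic functions of moderate growth. -/

section Rationality

variable [IsDomain R] [IsIntegrallyClosed R] [IsDomain A] [Module.Finite R A]
  [Module.IsTorsionFree R A]

theorem exists_eval_ne_zero_of_ne_zero (c : LineCoord R) {b : A} (hb : b ≠ 0) :
    ∃ p : ℂ[X], p ≠ 0 ∧ ∀ x : Points A, p.eval (c.coord x) ≠ 0 → x b ≠ 0 := by
  obtain ⟨b', r, hr, h⟩ := exists_mul_eq_algebraMap (R := R) hb
  obtain ⟨p, hp, hpt⟩ := c.exists_polynomial_of_ne_zero hr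
  refine ⟨p, hp, fun x hx h0 => hpt _ (c.eval_g_coord x) hx ?_⟩
  rw [← c.apply_algebraMap, ← h, map_mul, h0, zero_mul]

/-- An integral equation has coefficients of moderate growth, and Cauchy's root bound
`norm_le_of_monic_root` passes the growth on to `a`. -/
theorem moderate_apply (c : LineCoord R) (a : A) :
    Moderate c.g (c.coord : Points A → ℂ) (fun x => x a) := by
  have hmon := minpoly.monic (Algebra.IsIntegral.isIntegral (R := R) a)
  set P := minpoly R a
  have h1 : Moderate c.g (c.coord : Points A → ℂ) (fun x => 1 +
      ∑ j ∈ Finset.range P.natDegree, ((‖-c.val (P.coeff j) (c.coord x)‖ : ℝ) : ℂ)) := by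
    refine (Moderate.const 1).add (Moderate.sum fun j _ => ?_)
    exact (c.moderate_val _ (P.coeff j)).of_le fun x => by simp
  refine h1.of_le fun x => ?_
  have hnn : 0 ≤ ∑ j ∈ Finset.range P.natDegree, ‖-c.val (P.coeff j) (c.coord x)‖ :=
    Finset.sum_nonneg fun _ _ => norm_nonneg _
  have h2 : x (aeval a P) = 0 := by rw [minpoly.aeval, map_zero]
  rw [c.apply_aeval_eq_bieval, LineCoord.bieval, Finset.sum_range_succ, hmon.coeff_natDegree] at h2
  have h3 : c.val 1 (c.coord x) = 1 := by
    rw [← c.apply_algebraMap, map_one, map_one]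
  rw [h3, one_mul, add_eq_zero_iff_eq_neg', ← Finset.sum_neg_distrib] at h2
  have h4 := norm_le_of_monic_root P.natDegree (x a) (fun j => -c.val (P.coeff j) (c.coord x))
    (by simpa only [neg_mul] using h2)
  rw [← Complex.ofReal_sum, ← Complex.ofReal_one, ← Complex.ofReal_add, Complex.norm_real,
    Real.norm_of_nonneg (by linarith)]
  exact h4

/-- `ψ` is holomorphic along suitable local sections near every point of the base. -/
def LineCoord.LocHol (c : LineCoord R) (ψ : Points A → ℂ) : Prop :=
  ∀ t, c.g.eval t ≠ 0 → ∃ S : LocalSystem c A (Module.finrank R A) t,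
    ∀ i, DifferentiableOn ℂ (fun t => ψ (S.s i t)) S.disc

theorem LocalSystem.finsum_fiber {d : ℕ} {t₀ : ℂ} (S : LocalSystem c A d t₀) (ψ : Points A → ℂ)
    {t : ℂ} (ht : t ∈ S.disc) : ∑ᶠ x ∈ {x : Points A | c.coord x = t}, ψ x = ∑ i, ψ (S.s i t) := by
  rw [S.fiber_eq ht, finsum_mem_image (fun i _ j _ h => S.inj t ht i j h),
    finsum_mem_coe_finset]

/-- The trace of a locally holomorphic function of moderate growth is a regular function. -/
theorem exists_val_eq_finsum {ψ : Points A → ℂ} (hψ : c.LocHol ψ)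
    (hm : Moderate c.g c.coord ψ) :
    ∃ r : R, ∀ t, c.g.eval t ≠ 0 → ∑ᶠ x ∈ {x : Points A | c.coord x = t}, ψ x = c.val r t := by
  refine c.exists_val_eq_of_moderate (fun t ht => ?_) ?_
  · obtain ⟨S, hS⟩ := hψ t ht
    have : DifferentiableOn ℂ (fun t => ∑ i, ψ (S.s i t)) S.disc :=
      DifferentiableOn.fun_sum fun i _ => hS i
    exact (this.congr fun t ht => S.finsum_fiber ψ ht).differentiableAt
      (S.isOpen_disc.mem_nhds S.center_mem)
  · obtain ⟨N, M, hM, h⟩ := hm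
    refine ⟨N, Module.finrank R A * M, by positivity, fun t => ?_⟩
    obtain ⟨S, hS⟩ := hψ t t.2
    simp only [S.finsum_fiber ψ S.center_mem]
    refine (norm_sum_le _ _).trans ((Finset.sum_le_sum fun i _ => h (S.s i t)).trans ?_)
    simp [S.coord_s _ _ S.center_mem, mul_assoc]

theorem exists_aeval_derivative_mul' {a : A}
    (ha : (minpoly R a).natDegree = Module.finrank R A) (b : A) :
    ∃ H : R[X], aeval a (minpoly R a).derivative * b = aeval a H := by
  let K := FractionRing R
  let L := FractionRing A
  letI : Algebra K L := FractionRing.liftAlgebra R L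
  have : Module.Finite K L := Module.Finite.of_isLocalization R A (nonZeroDivisors R)
  have : CharZero K := charZero_of_injective_algebraMap (R := ℂ) (algebraMap ℂ K).injective
  exact exists_aeval_derivative_mul K L (by rw [ha, IsFractionRing.finrank_eq R K A L]) b

/-- Where `P'(a)` does not vanish, the identity `P'(a) * b = H(a)` determines the value at every
`b`. -/
theorem Points.ext_of_apply_eq (c : LineCoord R) {a : A}
    (ha : (minpoly R a).natDegree = Module.finrank R A) {x x' : Points A}
    (hc : c.coord x = c.coord x') (h : x a = x' a)
    (hd : x (aeval a (minpoly R a).derivative) ≠ 0) : x = x' := by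
  refine AlgHom.ext fun b => ?_
  obtain ⟨H, hH⟩ := exists_aeval_derivative_mul' ha b
  have h1 := congrArg x hH
  have h2 := congrArg x' hH
  rw [map_mul, c.apply_aeval_eq_bieval x H] at h1
  rw [map_mul, c.apply_aeval_eq_bieval x', c.apply_aeval_eq_bieval x', ← h, ← hc, ← h1,
    ← c.apply_aeval_eq_bieval] at h2
  exact (mul_left_cancel₀ hd h2).symm

/-- A locally holomorphic function of moderate growth on the points of `A` is a quotient of
elements of `A`. -/
theorem exists_apply_mul_eq {ψ : Points A → ℂ} (hψ : c.LocHol ψ) (hm : Moderate c.g c.coord ψ) :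
    ∃ p q : A, q ≠ 0 ∧ ∀ x : Points A, x q * ψ x = x p := by
  obtain ⟨a, ha⟩ := exists_natDegree_minpoly_eq_finrank c (A := A)
  set P := minpoly R a with hP
  -- Over `A` one has `P = (Y - a) * Q`. Specialized at a point `x'`, `Q` vanishes at the values of
  -- `a` at the other points of the fibre and takes the value `x'(P'(a))` at its own. So the sum of
  -- `ψ(x') * Q_{x'}(x a)` over the fibre of `x` is `ψ(x) * x(P'(a))`, at least where `P'(a)` is
  -- nonzero. As a polynomial in `x a` its coefficients are traces, which lie in `R`.
  set Q := minpolyDiv R a with hQ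
  have htr : ∀ j, ∃ r : R, ∀ t, c.g.eval t ≠ 0 →
      ∑ᶠ x ∈ {x : Points A | c.coord x = t}, ψ x * x (Q.coeff j) = c.val r t := fun j => by
    refine exists_val_eq_finsum (fun t ht => ?_) (hm.mul (moderate_apply c _))
    obtain ⟨S, hS⟩ := hψ t ht
    exact ⟨S, fun i => (hS i).mul (S.hol i _)⟩
  choose r hr using htr
  let p₀ : A := ∑ j ∈ Finset.range (Q.natDegree + 1), algebraMap R A (r j) * a ^ j
  let D : A := aeval a P.derivative
  have hD : D ≠ 0 := aeval_derivative_minpoly_ne_zero a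
  have key : ∀ x : Points A, x D ≠ 0 → x D * ψ x = x p₀ := by
    intro x hx
    obtain ⟨t, ht⟩ : ∃ t, t = c.coord x := ⟨_, rfl⟩
    have hgt : c.g.eval t ≠ 0 := by rw [ht]; exact c.eval_g_coord x
    obtain ⟨S, hS⟩ := hψ t hgt
    obtain ⟨i, hi⟩ : ∃ i, S.s i t = x := by
      have := S.exists_section x (by rw [← ht]; exact S.center_mem)
      rwa [← ht] at this
    have hQx : ∀ j, (Q.map ((S.s j t : A →ₐ[ℂ] ℂ) : A →+* ℂ)).eval (x a) * (x a - S.s j t a) =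
        0 := fun j => by
      have h1 := congrArg (fun F : A[X] => (F.map ((S.s j t : A →ₐ[ℂ] ℂ) : A →+* ℂ)).eval (x a))
        (minpolyDiv_spec R a)
      simp only [Polynomial.map_mul, Polynomial.map_sub, map_X, map_C, eval_mul, eval_sub, eval_X,
        eval_C, RingHom.coe_coe, Polynomial.map_map] at h1
      rw [h1]
      have h2 : ((S.s j t : A →ₐ[ℂ] ℂ) : A →+* ℂ).comp (algebraMap R A) =
          (x : A →+* ℂ).comp (algebraMap R A) := RingHom.ext fun r => by
        simp only [RingHom.comp_apply, RingHom.coe_coe, c.apply_algebraMap,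
          S.coord_s j t S.center_mem, ← ht]
      rw [h2, ← Polynomial.map_map]
      have h3 := Polynomial.eval₂_at_apply (p := P.map (algebraMap R A)) (x : A →+* ℂ) a
      rw [Polynomial.eval_map]
      refine h3.trans ?_
      rw [Polynomial.eval_map, ← aeval_def, minpoly.aeval, map_zero]
    have hsum : x p₀ = ∑ j, ψ (S.s j t) * (Q.map ((S.s j t : A →ₐ[ℂ] ℂ) : A →+* ℂ)).eval (x a) := by
      simp only [p₀, map_sum, map_mul, map_pow, c.apply_algebraMap, ← ht]
      simp only [← hr _ t hgt, S.finsum_fiber _ S.center_mem, Finset.sum_mul]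
      rw [Finset.sum_comm]
      refine Finset.sum_congr rfl fun j _ => ?_
      rw [Polynomial.eval_map, eval₂_eq_sum_range, Finset.mul_sum]
      exact Finset.sum_congr rfl fun k _ => by rw [RingHom.coe_coe]; ring
    rw [hsum, Finset.sum_eq_single i]
    · rw [hi, mul_comm]
      congr 1
      have h3 := Polynomial.eval₂_at_apply (p := Q) (x : A →+* ℂ) a
      rw [Polynomial.eval_map]
      refine Eq.symm (h3.trans ?_)
      rw [eval_minpolyDiv_self]
      rfl
    · intro j _ hj
      have : x a ≠ S.s j t a := fun h => hj (by
        refine (S.inj t S.center_mem _ _ ?_).symm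
        rw [hi]
        exact Points.ext_of_apply_eq c ha (by rw [S.coord_s j t S.center_mem, ht]) h hx)
      have := (mul_eq_zero.1 (hQx j)).resolve_right (sub_ne_zero.2 this)
      rw [this, mul_zero]
    · simp
  -- Multiplying by `D` once more makes the identity hold also at the zeros of `D`.
  refine ⟨p₀ * D, D * D, mul_ne_zero hD hD, fun x => ?_⟩
  rw [map_mul, map_mul]
  by_cases hx : x D = 0
  · simp [hx]
  · rw [← key x hx]; ring

end Rationality

end PointsTopology

/-! ### Connectedness and intermediate algebras -/

section Connected

open Polynomial Filter Topology

variable {R : Type} [CommRing R] [Algebra ℂ R] {c : LineCoord R}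
  {A : Type} [CommRing A] [Algebra ℂ A] [Algebra R A] [IsScalarTower ℂ R A]
  [IsDomain R] [IsIntegrallyClosed R] [IsDomain A] [Module.Finite R A] [Module.IsTorsionFree R A]

theorem LocalSystem.eventually_mem_disc {d : ℕ} {t₀ : ℂ} (S : LocalSystem c A d t₀) :
    ∀ᶠ t in 𝓝[≠] t₀, t ∈ S.disc :=
  nhdsWithin_le_nhds (S.isOpen_disc.mem_nhds S.center_mem)

/-- An element vanishing on a nonempty open set of points is zero. -/
theorem eq_zero_of_apply_eq_zero_on_open (hgood : ∀ t, c.g.eval t ≠ 0 → c.Good A t)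
    {O : Set (Points A)} (hO : IsOpen O) (hne : O.Nonempty) {b : A} (h : ∀ x ∈ O, x b = 0) :
    b = 0 := by
  by_contra hb
  obtain ⟨x, hx⟩ := hne
  obtain ⟨p, hp, hpt⟩ := exists_eval_ne_zero_of_ne_zero c hb
  obtain ⟨S⟩ := (hgood _ (c.eval_g_coord x)).localSystem
  obtain ⟨i, hi⟩ := S.exists_section x S.center_mem
  have hc : ContinuousAt (S.s i) (c.coord x) :=
    (S.continuousOn_s i).continuousAt (S.isOpen_disc.mem_nhds S.center_mem)
  have hev : ∀ᶠ t in 𝓝[≠] (c.coord x), S.s i t ∈ O :=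
    nhdsWithin_le_nhds (hc (hO.mem_nhds (by rwa [hi])))
  obtain ⟨t, ⟨h1, h2⟩, h3⟩ := ((hev.and (eventually_eval_ne_zero hp _)).and
    S.eventually_mem_disc).exists
  exact hpt (S.s i t) (by rwa [S.coord_s i t h3]) (h _ h1)

/-- The space of points of a finite étale domain is connected. -/
theorem eq_empty_or_univ_of_isClopen (hgood : ∀ t, c.g.eval t ≠ 0 → c.Good A t)
    {O : Set (Points A)} (hO : IsClopen O) : O = ∅ ∨ O = Set.univ := by
  classical
  -- The indicator function is constant along each section, discs being connected, so it is a
  -- quotient `p / q`. Then `p = q` on `O` and `p = 0` off `O`; if both sets were nonempty, both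
  -- identities would hold in `A` and force `q = 0`.
  have hhol : c.LocHol (fun x : Points A => if x ∈ O then 1 else 0) := by
    intro t ht
    obtain ⟨S⟩ := (hgood t ht).localSystem
    refine ⟨S, fun i => ?_⟩
    have hpre := S.isPreconnected_disc.image _ (S.continuousOn_s i)
    by_cases h : S.s i t ∈ O
    · have := hpre.subset_isClopen hO ⟨_, ⟨t, S.center_mem, rfl⟩, h⟩
      refine (differentiableOn_const (1 : ℂ)).congr fun t' ht' => ?_
      exact if_pos (this ⟨t', ht', rfl⟩)
    · have := hpre.subset_isClopen hO.compl ⟨_, ⟨t, S.center_mem, rfl⟩, h⟩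
      refine (differentiableOn_const (0 : ℂ)).congr fun t' ht' => ?_
      exact if_neg (this ⟨t', ht', rfl⟩)
  have hmod : Moderate c.g (c.coord : Points A → ℂ) (fun x => if x ∈ O then 1 else 0) :=
    (Moderate.const 1).of_le fun x => by split_ifs <;> simp
  obtain ⟨p, q, hq, h⟩ := exists_apply_mul_eq hhol hmod
  by_contra! hcon
  have h1 : p - q = 0 := eq_zero_of_apply_eq_zero_on_open hgood hO.isOpen
    hcon.1 fun x hx => by
      rw [map_sub, ← h, if_pos hx, mul_one, sub_self]
  have h2 : p = 0 := eq_zero_of_apply_eq_zero_on_open hgood hO.compl.isOpen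
    (Set.nonempty_compl.2 hcon.2) fun x hx => by
      rw [← h, if_neg hx, mul_zero]
  rw [h2, zero_sub, neg_eq_zero] at h1
  exact hq h1

/-- Sheets over discs are path connected, so path components are open, hence clopen. -/
theorem joined_points (hgood : ∀ t, c.g.eval t ≠ 0 → c.Good A t) (x y : Points A) :
    Joined x y := by
  have hnhds : ∀ y : Points A, ∀ᶠ z in 𝓝 y, Joined y z := by
    intro y
    obtain ⟨S⟩ := (hgood _ (c.eval_g_coord y)).localSystem
    obtain ⟨i, hi⟩ := S.exists_section y S.center_mem
    filter_upwards [(S.isOpen_sheet i).mem_nhds ⟨S.center_mem, hi.symm⟩] with z hz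
    obtain ⟨Γ, -⟩ := S.exists_path S.center_mem hz.1
    exact ⟨(Γ i).cast hi.symm hz.2⟩
  have hclopen : IsClopen {z | Joined x z} := by
    constructor
    · rw [← isOpen_compl_iff, isOpen_iff_mem_nhds]
      intro y hy
      filter_upwards [hnhds y] with z hz hxz
      exact hy (hxz.trans hz.symm)
    · rw [isOpen_iff_mem_nhds]
      intro y hy
      filter_upwards [hnhds y] with z hz
      exact hy.trans hz
  rcases eq_empty_or_univ_of_isClopen hgood hclopen with h | h
  · exact absurd (show x ∈ {z | Joined x z} from Joined.refl x) (by rw [h]; simp)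
  · exact (h ▸ Set.mem_univ y : y ∈ {z | Joined x z})

/-- `z` and `z'` are the ends of two paths over the same path in the base that start in `B`. -/
def Parallel (c : LineCoord R) (B : Set (Points A)) (z z' : Points A) : Prop :=
  ∃ (x x' : Points A) (Γ : Path x z) (Γ' : Path x' z'), x ∈ B ∧ x' ∈ B ∧
    ∀ t, c.coord (Γ t) = c.coord (Γ' t)

namespace Parallel

variable {B : Set (Points A)}

theorem coord_eq {z z' : Points A} (h : Parallel c B z z') : c.coord z = c.coord z' := by
  obtain ⟨x, x', Γ, Γ', hx, hx', h⟩ := h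
  simpa using h 1

theorem of_mem {u : ℂ} (hB : ∀ x ∈ B, c.coord x = u) {z z' : Points A} (hz : z ∈ B)
    (hz' : z' ∈ B) : Parallel c B z z' :=
  ⟨z, z', Path.refl z, Path.refl z', hz, hz', fun t => (hB z hz).trans (hB z' hz').symm⟩

theorem trans_path {z z' y y' : Points A} (h : Parallel c B z z') (Δ : Path z y) (Δ' : Path z' y')
    (hΔ : ∀ t, c.coord (Δ t) = c.coord (Δ' t)) : Parallel c B y y' := by
  obtain ⟨x, x', Γ, Γ', hx, hx', h⟩ := h
  refine ⟨x, x', Γ.trans Δ, Γ'.trans Δ', hx, hx', fun t => ?_⟩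
  rw [Path.trans_apply, Path.trans_apply]
  split_ifs
  · exact h _
  · exact hΔ _

/-- Transport along the sections shows that being parallel depends on the pair of sheets only and
not on the point of the disc. -/
theorem section_iff {d : ℕ} {t₀ : ℂ} (S : LocalSystem c A d t₀) {t t' : ℂ} (ht : t ∈ S.disc)
    (ht' : t' ∈ S.disc) (i j : Fin d) :
    Parallel c B (S.s i t) (S.s j t) ↔ Parallel c B (S.s i t') (S.s j t') := by
  constructor
  · obtain ⟨Γ, hΓ⟩ := S.exists_path ht ht'
    exact fun h => h.trans_path (Γ i) (Γ j) (hΓ i j)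
  · obtain ⟨Γ, hΓ⟩ := S.exists_path ht' ht
    exact fun h => h.trans_path (Γ i) (Γ j) (hΓ i j)

end Parallel

/-- The product of `w - a` over a parallelism class. -/
def classProd (c : LineCoord R) (B : Set (Points A)) (w : ℂ) (a : A) (z : Points A) : ℂ :=
  ∏ᶠ z' ∈ {z' | Parallel c B z z'}, (w - z' a)

-- The index set on the right is taken at the centre `t₀`: it does not vary with `t`, so the product
-- is visibly holomorphic along the sections.
open Classical in
theorem classProd_section (B : Set (Points A)) (w : ℂ) (a : A) {d : ℕ} {t₀ : ℂ}
    (S : LocalSystem c A d t₀) {t : ℂ} (ht : t ∈ S.disc) (i : Fin d) :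
    classProd c B w a (S.s i t) =
      ∏ j ∈ Finset.univ.filter (fun j => Parallel c B (S.s i t₀) (S.s j t₀)), (w - S.s j t a) := by
  have : {z' | Parallel c B (S.s i t) z'} = (fun j => S.s j t) ''
      ((Finset.univ.filter (fun j => Parallel c B (S.s i t₀) (S.s j t₀)) : Finset (Fin d)) :
        Set (Fin d)) := by
    ext z
    constructor
    · intro hz
      have hzt : c.coord z = t := hz.coord_eq.symm.trans (S.coord_s i t ht)
      obtain ⟨j, hj⟩ := S.exists_section z (by rw [hzt]; exact ht)
      rw [hzt] at hj
      refine ⟨j, ?_, hj⟩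
      simp only [Finset.coe_filter, Finset.mem_univ, true_and, Set.mem_ofPred_eq]
      rw [Parallel.section_iff S S.center_mem ht, hj]
      exact hz
    · rintro ⟨j, hj, rfl⟩
      simp only [Finset.coe_filter, Finset.mem_univ, true_and, Set.mem_ofPred_eq] at hj
      exact (Parallel.section_iff S S.center_mem ht i j).1 hj
  rw [classProd, this, finprod_mem_image (fun i _ j _ h => S.inj t ht i j h),
    finprod_mem_coe_finset]

theorem locHol_classProd (hgood : ∀ t, c.g.eval t ≠ 0 → c.Good A t) (B : Set (Points A)) (w : ℂ)
    (a : A) : c.LocHol (classProd c B w a) := by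
  classical
  intro t ht
  obtain ⟨S⟩ := (hgood t ht).localSystem
  refine ⟨S, fun i => ?_⟩
  refine DifferentiableOn.congr ?_ fun t ht => classProd_section B w a S ht i
  exact DifferentiableOn.fun_finsetProd fun j _ => (differentiableOn_const w).sub (S.hol j a)

theorem moderate_classProd (hgood : ∀ t, c.g.eval t ≠ 0 → c.Good A t) (B : Set (Points A)) (w : ℂ)
    (a : A) : Moderate c.g c.coord (classProd c B w a) := by
  classical
  obtain ⟨N, M, hM, h⟩ := (Moderate.const w).add ((moderate_apply c a).mul (Moderate.const (-1)))
  -- A class may have fewer points than the rank. With `M + 1` in place of `M` each bounding factor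
  -- is at least 1, so the full power is still an upper bound.
  refine ⟨N * Module.finrank R A, (M + 1) ^ Module.finrank R A, by positivity, fun x => ?_⟩
  obtain ⟨S⟩ := (hgood _ (c.eval_g_coord x)).localSystem
  obtain ⟨i, hi⟩ := S.exists_section x S.center_mem
  have h1 : 1 ≤ (M + 1) * weight c.g (c.coord x) ^ N := by
    have := one_le_pow₀ (one_le_weight c.g (c.coord x)) (n := N)
    nlinarith
  conv_lhs => rw [← hi]
  rw [classProd_section B w a S S.center_mem i, norm_prod, pow_mul, ← mul_pow]
  calc _ ≤ ∏ j ∈ Finset.univ.filter (fun j => Parallel c B (S.s i (c.coord x))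
        (S.s j (c.coord x))), ((M + 1) * weight c.g (c.coord x) ^ N) := by
        refine Finset.prod_le_prod (fun _ _ => norm_nonneg _) fun j _ => ?_
        have h2 : ‖w + S.s j (c.coord x) a * -1‖ ≤ _ := h (S.s j (c.coord x))
        rw [S.coord_s j _ S.center_mem, mul_neg_one, ← sub_eq_add_neg] at h2
        refine h2.trans ?_
        have := one_le_pow₀ (one_le_weight c.g (c.coord x)) (n := N)
        gcongr
        linarith
    _ ≤ _ := by
        rw [Finset.prod_const]
        refine pow_le_pow_right₀ h1 ?_
        exact (Finset.card_le_univ _).trans (by simp)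

/-- A proper block with at least two points in a fibre gives a proper intermediate algebra. -/
theorem exists_intermediate (hgood : ∀ t, c.g.eval t ≠ 0 → c.Good A t) {u : ℂ}
    (hu : c.g.eval u ≠ 0) {B : Set (Points A)} (hB : ∀ x ∈ B, c.coord x = u)
    {x₁ x₂ y : Points A} (hx₁ : x₁ ∈ B) (hx₂ : x₂ ∈ B) (hne : x₁ ≠ x₂) (hy : y ∉ B)
    (hyu : c.coord y = u)
    (hinv : ∀ (x x' z z' : Points A) (Γ : Path x z) (Γ' : Path x' z'), x ∈ B → x' ∈ B → z ∈ B →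
      (∀ t, c.coord (Γ t) = c.coord (Γ' t)) → z' ∈ B) :
    ∃ h : A, (∀ r s : R, s ≠ 0 → algebraMap R A s * h ≠ algebraMap R A r) ∧
      ∃ a : A, ∀ s : R, s ≠ 0 → algebraMap R A s * a ∉ Algebra.adjoin R {h} := by
  classical
  obtain ⟨hu', a, ha, hsep⟩ := hgood u hu
  have hsepa : ∀ x x' : Points A, c.coord x = u → c.coord x' = u → x a = x' a → x = x' := by
    intro x x' hx hx' hxx'
    refine Points.ext_of_apply_eq c ha (hx.trans hx'.symm) hxx' ?_
    rw [c.apply_aeval_eq_bieval, hx, c.bieval_eq _ hu, ← derivative_map]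
    refine hsep.eval₂_derivative_ne_zero (RingHom.id ℂ) ?_
    have := c.apply_aeval_eq_bieval x (minpoly R a) a
    rw [minpoly.aeval, map_zero, hx, c.bieval_eq _ hu] at this
    exact this.symm
  -- By `hinv` the class of a point of `B` is `B` itself and does not spill over in the fibre.
  have hBclass : ∀ x ∈ B, ∀ z, Parallel c B x z ↔ z ∈ B := by
    refine fun x hx z => ⟨?_, fun hz => Parallel.of_mem hB hx hz⟩
    rintro ⟨w, w', Γ, Γ', hw, hw', h⟩
    exact hinv w w' x z Γ Γ' hw hw' hx h
  -- The parameter `y a` makes the product vanish at `y`; as `a` separates the fibre, it does not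
  -- vanish on `B`. The element `h = p * q'` equals this product times `r₀ ∈ R`.
  obtain ⟨p, q, hq, hpq⟩ := exists_apply_mul_eq (locHol_classProd hgood B (y a) a)
    (moderate_classProd hgood B (y a) a)
  obtain ⟨q', r₀, hr₀, hqq'⟩ := exists_mul_eq_algebraMap (R := R) hq
  set ψ := classProd c B (y a) a with hψ
  have hval : ∀ x : Points A, x (p * q') = c.val r₀ (c.coord x) * ψ x := fun x => by
    rw [map_mul, ← hpq, ← c.apply_algebraMap, ← hqq', map_mul]; ring
  obtain ⟨S⟩ := (hgood u hu).localSystem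
  have hsec : ∀ x : Points A, c.coord x = u → ∃ i, S.s i u = x := fun x hx => by
    have := S.exists_section x (by rw [hx]; exact S.center_mem)
    rwa [hx] at this
  obtain ⟨i₁, hi₁⟩ := hsec x₁ (hB _ hx₁)
  obtain ⟨i₂, hi₂⟩ := hsec x₂ (hB _ hx₂)
  obtain ⟨j, hj⟩ := hsec y hyu
  obtain ⟨p₀, hp₀, hpt₀⟩ := c.exists_polynomial_of_ne_zero hr₀
  refine ⟨p * q', fun r s hs hrs => ?_, a, fun s hs hmem => ?_⟩
  -- A fraction of elements of `R` would take the same value on the sheets of `x₁` and `y`. The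
  -- product separates them at `u`, hence also at nearby `t`, which can be chosen off the zeros of
  -- `r₀` and `s`.
  · obtain ⟨p₁, hp₁, hpt₁⟩ := c.exists_polynomial_of_ne_zero hs
    have hcont : ∀ i, ContinuousAt (fun t => ψ (S.s i t)) u := fun i => by
      refine ContinuousAt.congr (f := fun t => ∏ j ∈ Finset.univ.filter
        (fun j => Parallel c B (S.s i u) (S.s j u)), (y a - S.s j t a)) ?_ ?_
      · refine tendsto_finsetProd _ fun j _ => ?_
        exact (continuousAt_const.sub
          ((S.hol j a).continuousOn.continuousAt (S.isOpen_disc.mem_nhds S.center_mem)))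
      · filter_upwards [S.isOpen_disc.mem_nhds S.center_mem] with t ht
        exact (classProd_section B (y a) a S ht i).symm
    have hψy : ψ (S.s j u) = 0 := by
      rw [hψ, classProd_section B (y a) a S S.center_mem j]
      refine Finset.prod_eq_zero (i := j) ?_ (by rw [hj, sub_self])
      simp only [Finset.mem_filter, Finset.mem_univ, true_and]
      -- By definition classes consist of ends of paths from `B`; connectedness ensures that `y` is
      -- reached and belongs to its own class.
      obtain ⟨Γ⟩ := joined_points hgood x₁ (S.s j u)
      exact ⟨x₁, x₁, Γ, Γ, hx₁, hx₁, fun _ => rfl⟩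
    have hψx : ψ (S.s i₁ u) ≠ 0 := by
      rw [hψ, classProd_section B (y a) a S S.center_mem i₁, Finset.prod_ne_zero_iff]
      intro k hk
      simp only [Finset.mem_filter, Finset.mem_univ, true_and, hi₁, hBclass x₁ hx₁] at hk
      rw [sub_ne_zero]
      intro h
      rw [hsepa _ _ hyu (hB _ hk) h] at hy
      exact hy hk
    have hev : ∀ᶠ t in 𝓝[≠] u, ψ (S.s i₁ t) ≠ ψ (S.s j t) :=
      nhdsWithin_le_nhds (((hcont i₁).ne_iff_eventually_ne (hcont j)).1 (by rwa [hψy]))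
    obtain ⟨t, ⟨⟨h1, h2⟩, h3⟩, h4⟩ := (((hev.and (eventually_eval_ne_zero hp₀ u)).and
      (eventually_eval_ne_zero hp₁ u)).and S.eventually_mem_disc).exists
    have h5 : ∀ i, c.val s t * (c.val r₀ t * ψ (S.s i t)) = c.val r t := fun i => by
      have := congrArg (S.s i t) hrs
      rwa [map_mul, hval, c.apply_algebraMap, c.apply_algebraMap, S.coord_s i t h4] at this
    have hgt := S.sub t h4
    exact h1 (mul_left_cancel₀ (hpt₀ t hgt h2) (mul_left_cancel₀ (hpt₁ t hgt h3)
      ((h5 i₁).trans (h5 j).symm)))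
  -- If `s * a` were a polynomial in `h`, then `a` would agree on the sheets of `x₁` and `x₂`, where
  -- `h` agrees; but `a` separates these sheets near `u`.
  · obtain ⟨p₁, hp₁, hpt₁⟩ := c.exists_polynomial_of_ne_zero hs
    rw [Algebra.adjoin_singleton_eq_range_aeval] at hmem
    obtain ⟨H, hH⟩ := hmem
    have hcont : ∀ i, ContinuousAt (fun t => S.s i t a) u := fun i =>
      (S.hol i a).continuousOn.continuousAt (S.isOpen_disc.mem_nhds S.center_mem)
    have hev : ∀ᶠ t in 𝓝[≠] u, S.s i₁ t a ≠ S.s i₂ t a :=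
      nhdsWithin_le_nhds (((hcont i₁).ne_iff_eventually_ne (hcont i₂)).1 fun h => hne (by
        rw [hi₁, hi₂] at h
        exact hsepa _ _ (hB _ hx₁) (hB _ hx₂) h))
    obtain ⟨t, ⟨h1, h3⟩, h4⟩ := ((hev.and (eventually_eval_ne_zero hp₁ u)).and
      S.eventually_mem_disc).exists
    have hψeq : ψ (S.s i₁ t) = ψ (S.s i₂ t) := by
      rw [hψ, classProd_section B (y a) a S h4 i₁, classProd_section B (y a) a S h4 i₂, hi₁, hi₂]
      simp only [hBclass x₁ hx₁, hBclass x₂ hx₂]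
    have h5 : ∀ i, c.val s t * S.s i t a = c.bieval H t (c.val r₀ t * ψ (S.s i t)) := fun i => by
      have h6 := congrArg (S.s i t) hH
      have h7 := c.apply_aeval_eq_bieval (S.s i t) H (p * q')
      rw [hval, S.coord_s i t h4] at h7
      rw [map_mul, c.apply_algebraMap, S.coord_s i t h4] at h6
      exact h6.symm.trans h7
    refine h1 (mul_left_cancel₀ (hpt₁ t (S.sub t h4) h3) ?_)
    rw [h5, h5, hψeq]

end Connected

/-! ### Complex points of affine open subschemes -/

section AffinePoints

open Filter Topology

variable {X Y : Scheme.{0}}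

theorem le_preimage_top (f : X ⟶ Y) (U : X.Opens) : U ≤ f ⁻¹ᵁ ⊤ := le_top

/-- The structure map of the sections over `U` of a scheme over `ℂ`. -/
def appC (s : X ⟶ SpecC) (U : X.Opens) : CommRingCat.of ℂ ⟶ Γ(X, U) :=
  (Scheme.ΓSpecIso (.of ℂ)).inv ≫ s.appLE ⊤ U (le_preimage_top s U)

/-- The `ℂ`-algebra of sections over `U` of a scheme `X` with structure morphism `s`. -/
def Sec (_ : X ⟶ SpecC) (U : X.Opens) : Type := Γ(X, U)

instance (s : X ⟶ SpecC) (U : X.Opens) : CommRing (Sec s U) := inferInstanceAs (CommRing Γ(X, U))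

instance (s : X ⟶ SpecC) (U : X.Opens) : Algebra ℂ (Sec s U) := (appC s U).hom.toAlgebra

instance (f : X ⟶ Y) (s : Y ⟶ SpecC) (W : Y.Opens) : Algebra (Sec s W) (Sec (f ≫ s) (f ⁻¹ᵁ W)) :=
  (f.app W).hom.toAlgebra

instance (f : X ⟶ Y) (s : Y ⟶ SpecC) (W : Y.Opens) :
    IsScalarTower ℂ (Sec s W) (Sec (f ≫ s) (f ⁻¹ᵁ W)) :=
  IsScalarTower.of_algebraMap_eq' (by
    change (appC (f ≫ s) (f ⁻¹ᵁ W)).hom = (f.app W).hom.comp (appC s W).hom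
    rw [← CommRingCat.hom_comp]
    congr 1
    rw [appC, appC, Category.assoc, Scheme.Hom.app_eq_appLE, Scheme.Hom.appLE_comp_appLE])

theorem fromSpec_comp_eq (s : X ⟶ SpecC) {U : X.Opens} (hU : IsAffineOpen U) :
    hU.fromSpec ≫ s = Spec.map (appC s U) := by
  rw [← IsAffineOpen.SpecMap_appLE_fromSpec s (isAffineOpen_top SpecC) hU
      (le_preimage_top s U),
    IsAffineOpen.fromSpec_top, Scheme.isoSpec_Spec_inv, appC, Spec.map_comp]

namespace ComplexPoint

variable {s : X ⟶ SpecC}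

/-- The point of `X` underlying a complex point. -/
def pt (p : ComplexPoint s) : X := p.hom (default : PrimeSpectrum ℂ)

theorem liesIn_iff (p : ComplexPoint s) (U : X.Opens) : p.LiesIn U ↔ p.pt ∈ U := by
  constructor
  · intro h
    exact h (x := (default : PrimeSpectrum ℂ)) trivial
  · rintro h x -
    have hx : x = (default : PrimeSpectrum ℂ) := Subsingleton.elim (α := PrimeSpectrum ℂ) _ _
    rw [hx]
    exact h

theorem liesIn_map (f : X ⟶ Y) (s : Y ⟶ SpecC) (p : ComplexPoint (f ≫ s)) (W : Y.Opens) :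
    (p.map f s).LiesIn W ↔ p.LiesIn (f ⁻¹ᵁ W) := Iff.rfl

theorem LiesIn.mono {p : ComplexPoint s} {U V : X.Opens} (h : p.LiesIn U) (hUV : U ≤ V) :
    p.LiesIn V := (p.liesIn_iff V).2 (hUV ((p.liesIn_iff U).1 h))

/-- Evaluation of sections at a complex point. -/
def toPoint (p : ComplexPoint s) {U : X.Opens} (h : p.LiesIn U) : Points (Sec s U) :=
  { ((p.hom.appLE U ⊤ h) ≫ (Scheme.ΓSpecIso (.of ℂ)).hom).hom with
    commutes' := fun z => by
      change ((appC s U) ≫ (p.hom.appLE U ⊤ h) ≫ (Scheme.ΓSpecIso (.of ℂ)).hom) z = z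
      have : (appC s U) ≫ (p.hom.appLE U ⊤ h) ≫ (Scheme.ΓSpecIso (.of ℂ)).hom = 𝟙 _ := by
        have h1 : ∀ (t : SpecC ⟶ SpecC) (e : (⊤ : SpecC.Opens) ≤ t ⁻¹ᵁ ⊤), t = 𝟙 _ →
            t.appLE ⊤ ⊤ e = 𝟙 _ := by
          rintro _ _ rfl
          exact (Category.id_comp _).trans (SpecC.presheaf.map_id _)
        have h2 := (Scheme.Hom.appLE_comp_appLE p.hom s ⊤ U ⊤ (le_preimage_top s U) h).trans
          (h1 _ _ p.w)
        rw [appC, Category.assoc, ← Category.assoc (s.appLE _ _ _)]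
        exact (congrArg (fun k => (Scheme.ΓSpecIso (.of ℂ)).inv ≫ k ≫
          (Scheme.ΓSpecIso (.of ℂ)).hom) h2).trans (by rw [Category.id_comp, Iso.inv_hom_id])
      rw [this]; rfl }

theorem toPoint_apply (p : ComplexPoint s) {U : X.Opens} (h : p.LiesIn U) (g : Γ(X, U)) :
    p.toPoint h g = p.value h g := rfl

theorem value_res (p : ComplexPoint s) {U V : X.Opens} (h : p.LiesIn V) (i : V ≤ U) (g : Γ(X, U)) :
    p.value h (X.presheaf.map (homOfLE i).op g) = p.value (h.mono i) g := by
  unfold value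
  rw [← Scheme.Hom.map_appLE p.hom h (homOfLE i).op]
  rfl

theorem toPoint_map (f : X ⟶ Y) (s : Y ⟶ SpecC) (p : ComplexPoint (f ≫ s)) {W : Y.Opens}
    (h : p.LiesIn (f ⁻¹ᵁ W)) :
    (p.map f s).toPoint (U := W) h = (p.toPoint h).res (Sec s W) := by
  refine AlgHom.ext fun g => ?_
  change (Scheme.ΓSpecIso (.of ℂ)).hom ((p.hom ≫ f).appLE W ⊤ h g) =
    (Scheme.ΓSpecIso (.of ℂ)).hom (p.hom.appLE (f ⁻¹ᵁ W) ⊤ h (f.app W g))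
  exact congrArg (fun k : Γ(Y, W) ⟶ Γ(SpecC, ⊤) => (Scheme.ΓSpecIso (.of ℂ)).hom (k g))
    (Scheme.Hom.comp_appLE p.hom f W ⊤ h)

theorem liesIn_basicOpen (p : ComplexPoint s) {U : X.Opens} (h : p.LiesIn U) (f : Γ(X, U)) :
    p.LiesIn (X.basicOpen f) ↔ p.value h f ≠ 0 := by
  constructor
  · intro hf
    have h1 := RingedSpace.isUnit_res_basicOpen X.toRingedSpace f
    have h2 := h1.map (p.toPoint hf)
    rw [← value_res p hf (X.basicOpen_le f)]
    exact h2.ne_zero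
  · intro hf
    have h1 : IsUnit (p.hom.appLE U ⊤ h f) := by
      have := (isUnit_iff_ne_zero.2 hf).map (Scheme.ΓSpecIso (.of ℂ)).inv.hom
      convert this
      exact (ConcreteCategory.congr_hom (Scheme.ΓSpecIso (.of ℂ)).hom_inv_id _).symm
    have h2 := SpecC.basicOpen_of_isUnit h1
    exact ((Scheme.basicOpen_appLE p.hom ⊤ U h f).symm.trans h2).ge.trans inf_le_right

theorem hom_eq_of_isAffineOpen (p : ComplexPoint s) {U : X.Opens} (hU : IsAffineOpen U)
    (h : p.LiesIn U) :
    p.hom = Spec.map ((p.hom.appLE U ⊤ h) ≫ (Scheme.ΓSpecIso (.of ℂ)).hom) ≫ hU.fromSpec := by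
  have := IsAffineOpen.SpecMap_appLE_fromSpec p.hom hU (isAffineOpen_top SpecC) h
  rw [IsAffineOpen.fromSpec_top, Scheme.isoSpec_Spec_inv] at this
  rw [Spec.map_comp, Category.assoc, this, ← Spec.map_comp_assoc, Iso.inv_hom_id, Spec.map_id,
    Category.id_comp]

theorem toPoint_injective {U : X.Opens} (hU : IsAffineOpen U) {p q : ComplexPoint s}
    (hp : p.LiesIn U) (hq : q.LiesIn U) (h : p.toPoint hp = q.toPoint hq) : p = q := by
  refine ComplexPoint.ext ?_
  rw [p.hom_eq_of_isAffineOpen hU hp, q.hom_eq_of_isAffineOpen hU hq]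
  congr 2
  ext g
  exact DFunLike.congr_fun h g

/-- The complex point of an affine open subscheme given by an evaluation. -/
def ofPoint {U : X.Opens} (hU : IsAffineOpen U) (x : Points (Sec s U)) : ComplexPoint s where
  hom := Spec.map (CommRingCat.ofHom (x : Sec s U →+* ℂ) : Γ(X, U) ⟶ _) ≫ hU.fromSpec
  w := by
    rw [Category.assoc, fromSpec_comp_eq, ← Spec.map_comp, ← Spec.map_id]
    congr 1
    ext z
    exact x.commutes z

theorem liesIn_ofPoint {U : X.Opens} (hU : IsAffineOpen U) (x : Points (Sec s U)) :
    (ofPoint hU x).LiesIn U := by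
  rw [liesIn_iff]
  have : (ofPoint hU x).pt ∈ Set.range hU.fromSpec := ⟨_, rfl⟩
  rwa [hU.range_fromSpec] at this

theorem toPoint_ofPoint {U : X.Opens} (hU : IsAffineOpen U) (x : Points (Sec s U)) :
    (ofPoint hU x).toPoint (liesIn_ofPoint hU x) = x := by
  have h := (ofPoint hU x).hom_eq_of_isAffineOpen hU (liesIn_ofPoint hU x)
  have h2 : Spec.map (CommRingCat.ofHom (x : Sec s U →+* ℂ) : Γ(X, U) ⟶ _) ≫ hU.fromSpec =
    Spec.map (((ofPoint hU x).hom.appLE U ⊤ (liesIn_ofPoint hU x)) ≫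
      (Scheme.ΓSpecIso (.of ℂ)).hom) ≫ hU.fromSpec := h
  rw [cancel_mono] at h2
  have h3 := Spec.map_injective h2
  refine AlgHom.ext fun g => ?_
  exact (DFunLike.congr_fun (congrArg CommRingCat.Hom.hom h3) g).symm

theorem isOpen_liesIn (U : X.Opens) : IsOpen {p : ComplexPoint s | p.LiesIn U} := by
  refine TopologicalSpace.isOpen_generateFrom_of_mem ⟨U, 0, Set.univ, isOpen_univ, ?_⟩
  ext p; simp

theorem isOpen_value_mem {U : X.Opens} (g : Γ(X, U)) {W : Set ℂ} (hW : IsOpen W) :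
    IsOpen {p : ComplexPoint s | ∃ h : p.LiesIn U, p.value h g ∈ W} :=
  TopologicalSpace.isOpen_generateFrom_of_mem ⟨U, g, W, hW, rfl⟩

theorem continuous_map (f : X ⟶ Y) (s : Y ⟶ SpecC) :
    Continuous (ComplexPoint.map f s) := by
  refine continuous_generateFrom_iff.2 ?_
  rintro _ ⟨U, g, W, hW, rfl⟩
  convert isOpen_value_mem (s := f ≫ s) (f.app U g) hW using 1
  ext p
  have : ∀ h : p.LiesIn (f ⁻¹ᵁ U), (p.map f s).value (U := U) h g = p.value h (f.app U g) :=
    fun h => DFunLike.congr_fun (toPoint_map f s p h) g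
  exact exists_congr fun h => by exact iff_of_eq (congrArg (· ∈ W) (this h))

theorem continuous_toPoint (U : X.Opens) :
    Continuous (fun p : {p : ComplexPoint s // p.LiesIn U} => p.1.toPoint p.2) := by
  refine Points.continuous_iff.2 fun g => ?_
  rw [continuous_def]
  intro W hW
  convert (isOpen_value_mem (s := s) (U := U) g hW).preimage continuous_subtype_val using 1
  ext p
  exact ⟨fun h => ⟨p.2, h⟩, fun ⟨_, h⟩ => h⟩

/-- The topology of the complex points tests sections over every open `V`, not only over `U`. Near a
given point such a section is a fraction `b / f ^ n` with `b` and `f` defined on `U`, which is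
continuous for pointwise convergence. -/
theorem continuous_ofPoint {U : X.Opens} (hU : IsAffineOpen U) :
    Continuous (ofPoint (s := s) hU) := by
  refine continuous_generateFrom_iff.2 ?_
  rintro _ ⟨V, g, W, hW, rfl⟩
  rw [isOpen_iff_mem_nhds]
  rintro x ⟨hV, hgW⟩
  set p := ofPoint hU x with hp
  have hpU : p.LiesIn U := liesIn_ofPoint hU x
  obtain ⟨f, hfV, hpf⟩ := hU.exists_basicOpen_le ⟨p.pt, (p.liesIn_iff V).1 hV⟩
    ((p.liesIn_iff U).1 hpU)
  have hfU : X.basicOpen f ≤ U := X.basicOpen_le f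
  have hmem : ∀ y : Points (Sec s U), (ofPoint hU y).LiesIn (X.basicOpen f) ↔ y f ≠ 0 := by
    intro y
    rw [liesIn_basicOpen _ (liesIn_ofPoint hU y), ← toPoint_apply, toPoint_ofPoint]
  have hloc := hU.isLocalization_basicOpen f
  obtain ⟨n, (b : Sec s U), hb⟩ := IsLocalization.Away.surj f (X.presheaf.map (homOfLE hfV).op g)
  have hval : ∀ (y : Points (Sec s U)) (h : y f ≠ 0),
      (ofPoint hU y).value (((hmem y).2 h).mono hfV) g = y b / y f ^ n := by
    intro y h
    have hy := (hmem y).2 h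
    rw [← value_res _ hy hfV, eq_div_iff (pow_ne_zero _ h)]
    have hres : ∀ c : Γ(X, U), (ofPoint hU y).toPoint hy
        (X.presheaf.map (homOfLE hfU).op c) = y c := by
      intro c
      rw [toPoint_apply, value_res, ← toPoint_apply, toPoint_ofPoint]
    have h1 := congrArg ((ofPoint hU y).toPoint hy) hb
    refine Eq.trans ?_ (h1.trans (hres b))
    refine Eq.trans ?_ (map_mul ((ofPoint hU y).toPoint hy) _ _).symm
    refine congrArg _ ?_
    refine Eq.trans ?_ (map_pow ((ofPoint hU y).toPoint hy) _ _).symm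
    exact congrArg (fun z : ℂ => z ^ n) (hres f).symm
  have hc : ContinuousAt (fun y : Points (Sec s U) => y b / y f ^ n) x :=
    (Points.continuous_apply b).continuousAt.div
      ((Points.continuous_apply (A := Sec s U) f).continuousAt.pow n)
      (pow_ne_zero _ ((hmem x).1 ((liesIn_iff _ _).2 hpf)))
  have hxf := (hmem x).1 ((liesIn_iff _ _).2 hpf)
  have hx0 : x b / x f ^ n ∈ W := by rw [← hval x hxf]; exact hgW
  filter_upwards [hc.preimage_mem_nhds (hW.mem_nhds hx0),
    (Points.continuous_apply (A := Sec s U) f).continuousAt.eventually_ne hxf] with y hy hyf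
  refine ⟨((hmem y).2 hyf).mono hfV, ?_⟩
  rw [hval y hyf]
  exact hy

/-- Complex points of an affine open subscheme are evaluations of its ring of sections. -/
def affineHomeo {U : X.Opens} (hU : IsAffineOpen U) :
    {p : ComplexPoint s // p.LiesIn U} ≃ₜ Points (Sec s U) where
  toFun p := p.1.toPoint p.2
  invFun x := ⟨ofPoint hU x, liesIn_ofPoint hU x⟩
  left_inv p := Subtype.ext (toPoint_injective hU _ p.2 (toPoint_ofPoint hU _))
  right_inv x := toPoint_ofPoint hU x
  continuous_toFun := continuous_toPoint U
  continuous_invFun := (continuous_ofPoint hU).subtype_mk _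

end ComplexPoint

end AffinePoints

/-! ### Degrees and restrictions to affine opens -/

section Degree

variable {X Y Z : Scheme.{0}}

theorem exists_image_eq {O W : Y.Opens} (h : W ≤ O) : ∃ W' : O.toScheme.Opens, O.ι ''ᵁ W' = W := by
  refine ⟨O.ι ⁻¹ᵁ W, ?_⟩
  rw [Scheme.Hom.image_preimage_eq_opensRange_inf, Scheme.Opens.opensRange_ι]
  exact inf_eq_right.2 h

theorem isAffineOpen_preimage_of_le (f : X ⟶ Y) {O W : Y.Opens} (hO : IsFinite (f ∣_ O))
    (h : W ≤ O) (hW : IsAffineOpen W) : IsAffineOpen (f ⁻¹ᵁ W) := by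
  obtain ⟨W', rfl⟩ := exists_image_eq h
  rw [Scheme.Hom.isAffineOpen_iff_of_isOpenImmersion] at hW
  rw [← image_morphismRestrict_preimage, Scheme.Hom.isAffineOpen_iff_of_isOpenImmersion]
  exact hW.preimage _

theorem finite_app_of_le (f : X ⟶ Y) {O W : Y.Opens} (hO : IsFinite (f ∣_ O))
    (h : W ≤ O) (hW : IsAffineOpen W) : (f.app W).hom.Finite := by
  obtain ⟨W', rfl⟩ := exists_image_eq h
  rw [Scheme.Hom.isAffineOpen_iff_of_isOpenImmersion] at hW
  have := (f ∣_ O).finite_app W' hW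
  rw [morphismRestrict_app] at this
  exact (RingHom.finite_respectsIso.cancel_right_isIso (f.app (O.ι ''ᵁ W'))
    (X.presheaf.map (eqToHom (image_morphismRestrict_preimage f O W')).op)).1 this

theorem etale_app_of_le (f : X ⟶ Y) {O W : Y.Opens} (hO : IsFinite (f ∣_ O))
    (hO' : Etale (f ∣_ O)) (h : W ≤ O) (hW : IsAffineOpen W) : (f.app W).hom.Etale := by
  obtain ⟨W', rfl⟩ := exists_image_eq h
  rw [Scheme.Hom.isAffineOpen_iff_of_isOpenImmersion] at hW
  have := (f ∣_ O).etale_appLE hW (hW.preimage (f ∣_ O)) le_rfl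
  rw [Scheme.Hom.appLE_eq_app, morphismRestrict_app] at this
  exact (RingHom.Etale.respectsIso.cancel_right_isIso (f.app (O.ι ''ᵁ W'))
    (X.presheaf.map (eqToHom (image_morphismRestrict_preimage f O W')).op)).1 this

/-- The hypothesis `h` makes `x` behave as the generic point of `W`: no nonzero section vanishes
there, and residues of germs are quotients of residues of sections. It serves to compute degrees as
ranks of rings of sections. -/
theorem isFractionRing_residueField {W : X.Opens} (hW : IsAffineOpen W) {x : X} (hx : x ∈ W)
    (h : ∀ g : Γ(X, W), g ≠ 0 → x ∈ X.basicOpen g) :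
    @IsFractionRing Γ(X, W) _ (X.residueField x) _ (X.evaluation W x hx).hom.toAlgebra := by
  letI := (X.evaluation W x hx).hom.toAlgebra
  have hinj : Function.Injective (algebraMap Γ(X, W) (X.residueField x)) := by
    refine (injective_iff_map_eq_zero _).2 fun g hg => ?_
    by_contra hne
    exact (X.evaluation_ne_zero_iff_mem_basicOpen x hx g).2 (h g hne) hg
  haveI : FaithfulSMul Γ(X, W) (X.residueField x) :=
    (faithfulSMul_iff_algebraMap_injective _ _).2 hinj
  refine IsFractionRing.of_field _ _ fun z => ?_
  obtain ⟨y, rfl⟩ := X.residue_surjective x z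
  letI := TopCat.Presheaf.algebra_section_stalk X.presheaf (⟨x, hx⟩ : W)
  haveI := hW.isLocalization_stalk ⟨x, hx⟩
  obtain ⟨⟨a, b⟩, hab⟩ := IsLocalization.surj (hW.primeIdealOf ⟨x, hx⟩).asIdeal.primeCompl y
  have hab' : y * X.presheaf.germ W x hx b = X.presheaf.germ W x hx a := hab
  have hb : IsUnit (X.presheaf.germ W x hx b.1) :=
    IsLocalization.map_units (M := (hW.primeIdealOf ⟨x, hx⟩).asIdeal.primeCompl)
      (X.presheaf.stalk x) b
  have hb' := (hb.map (X.residue x).hom).ne_zero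
  refine ⟨a, b, ?_⟩
  refine (eq_div_iff hb').2 ?_
  exact ((X.residue x).hom.map_mul _ _).symm.trans (congrArg (X.residue x).hom hab')

theorem residueDegree_eq_finrank (f : X ⟶ Y) {W : Y.Opens} (hW : IsAffineOpen W)
    (hW' : IsAffineOpen (f ⁻¹ᵁ W)) {x : X} (hx : f x ∈ W)
    (h : ∀ g : Γ(Y, W), g ≠ 0 → f x ∈ Y.basicOpen g)
    (h' : ∀ g : Γ(X, f ⁻¹ᵁ W), g ≠ 0 → x ∈ X.basicOpen g) :
    f.residueDegree x = @Module.finrank Γ(Y, W) Γ(X, f ⁻¹ᵁ W) _ _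
      (f.app W).hom.toAlgebra.toModule := by
  letI a₁ := (f.app W).hom.toAlgebra
  letI a₂ := (Y.evaluation W (f x) hx).hom.toAlgebra
  letI a₃ := (X.evaluation (f ⁻¹ᵁ W) x hx).hom.toAlgebra
  letI a₄ := (f.residueFieldMap x).hom.toAlgebra
  letI a₅ : Algebra Γ(Y, W) (X.residueField x) :=
    ((X.evaluation (f ⁻¹ᵁ W) x hx).hom.comp (f.app W).hom).toAlgebra
  haveI := isFractionRing_residueField hW hx h
  haveI := isFractionRing_residueField hW' (x := x) hx h'
  haveI : IsScalarTower Γ(Y, W) Γ(X, f ⁻¹ᵁ W) (X.residueField x) :=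
    IsScalarTower.of_algebraMap_eq fun r => rfl
  haveI : IsScalarTower Γ(Y, W) (Y.residueField (f x)) (X.residueField x) :=
    IsScalarTower.of_algebraMap_eq fun r => (Scheme.evaluation_naturality_apply f x hx r).symm
  exact IsFractionRing.finrank_eq Γ(Y, W) (Y.residueField (f x)) Γ(X, f ⁻¹ᵁ W) (X.residueField x)

theorem residueDegree_comp (f : X ⟶ Y) (g : Y ⟶ Z) (x : X) :
    (f ≫ g).residueDegree x = g.residueDegree (f x) * f.residueDegree x := by
  letI a₁ := (f.residueFieldMap x).hom.toAlgebra
  letI a₂ := (g.residueFieldMap (f x)).hom.toAlgebra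
  letI a₃ : Algebra (Z.residueField (g (f x))) (X.residueField x) :=
    ((f.residueFieldMap x).hom.comp (g.residueFieldMap (f x)).hom).toAlgebra
  haveI : IsScalarTower (Z.residueField (g (f x))) (Y.residueField (f x)) (X.residueField x) :=
    IsScalarTower.of_algebraMap_eq fun r => rfl
  have := Module.finrank_mul_finrank (Z.residueField (g (f x))) (Y.residueField (f x))
    (X.residueField x)
  refine Eq.trans ?_ this.symm
  unfold Scheme.Hom.residueDegree
  have h := Scheme.residueFieldMap_comp f g x
  have key : ((f ≫ g).residueFieldMap x).hom.toAlgebra = a₃ :=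
    congrArg (fun k : Z.residueField (g (f x)) ⟶ X.residueField x => k.hom.toAlgebra) h
  exact congrArg (fun a : Algebra (Z.residueField (g (f x))) (X.residueField x) =>
    @Module.finrank _ _ _ _ a.toModule) key

theorem residueDegree_of_isOpenImmersion (f : X ⟶ Y) [IsOpenImmersion f] (x : X) :
    f.residueDegree x = 1 := by
  letI a₁ := (f.residueFieldMap x).hom.toAlgebra
  have hb : Function.Bijective (algebraMap (Y.residueField (f x)) (X.residueField x)) :=
    ConcreteCategory.bijective_of_isIso (f.residueFieldMap x)
  exact Module.finrank_eq_of_rank_eq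
    ((LinearEquiv.ofBijective (Algebra.linearMap _ (X.residueField x)) hb).symm.rank_eq.trans
      (Module.rank_self _))

theorem genericPoint_mem [IrreducibleSpace X] {U : X.Opens} (h : (U : Set X).Nonempty) :
    genericPoint X ∈ U :=
  ((genericPoint_spec X).mem_open_set_iff U.2).2 (by simpa using h)

theorem map_genericPoint_mem [IrreducibleSpace X] (f : X ⟶ Y) [IsDominant f] {U : Y.Opens}
    (h : (U : Set Y).Nonempty) : f (genericPoint X) ∈ U := by
  obtain ⟨x, hx⟩ := f.denseRange.exists_mem_open U.2 h
  exact genericPoint_mem (U := f ⁻¹ᵁ U) ⟨x, hx⟩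

theorem basicOpen_nonempty {W : X.Opens} (hW : IsAffineOpen W) [_root_.IsReduced Γ(X, W)]
    {g : Γ(X, W)} (hg : g ≠ 0) : (X.basicOpen g : Set X).Nonempty := by
  rw [Set.nonempty_iff_ne_empty]
  intro h
  have h2 : X.basicOpen g = ⊥ := TopologicalSpace.Opens.ext h
  exact hg ((Scheme.isNilpotent_iff_basicOpen_eq_bot_of_isCompact hW.isCompact g).2 h2).eq_zero

theorem degree_eq_finrank [IsIntegral X] (f : X ⟶ Y) [IsDominant f] {W : Y.Opens}
    (hW : IsAffineOpen W) (hne : (W : Set Y).Nonempty) [_root_.IsReduced Γ(Y, W)]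
    (hW' : IsAffineOpen (f ⁻¹ᵁ W)) :
    degree f = @Module.finrank Γ(Y, W) Γ(X, f ⁻¹ᵁ W) _ _ (f.app W).hom.toAlgebra.toModule :=
  residueDegree_eq_finrank f hW hW' (map_genericPoint_mem f hne)
    (fun _ hg => map_genericPoint_mem f (basicOpen_nonempty hW hg))
    (fun _ hg => genericPoint_mem (basicOpen_nonempty hW' hg))

theorem app_injective [IsIntegral X] (f : X ⟶ Y) [IsDominant f] {W : Y.Opens}
    (hW : IsAffineOpen W) [_root_.IsReduced Γ(Y, W)] : Function.Injective (f.app W).hom := by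
  refine (injective_iff_map_eq_zero _).2 fun g hg => ?_
  by_contra hne
  have h := map_genericPoint_mem f (basicOpen_nonempty hW hne)
  have h2 : genericPoint X ∈ f ⁻¹ᵁ Y.basicOpen g := h
  rw [Scheme.preimage_basicOpen] at h2
  have h3 : f.app W g = 0 := hg
  rw [h3, Scheme.basicOpen_zero] at h2
  exact h2

theorem degree_comp [IrreducibleSpace X] [IrreducibleSpace Y] (f : X ⟶ Y) [IsDominant f]
    (g : Y ⟶ Z) : degree (f ≫ g) = degree g * degree f := by
  rw [degree, residueDegree_comp]
  have : f (genericPoint X) = genericPoint Y := by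
    refine ((genericPoint_spec X).image f.continuous).eq ?_
    rw [Set.image_univ, f.denseRange.closure_range]
    exact genericPoint_spec Y
  rw [this]
  rfl

end Degree

/-! ### Charts with a coordinate -/

section Charts

open Polynomial

/-- Transport of a coordinate along an isomorphism. -/
def LineCoord.ofBijective {R R' : Type} [CommRing R] [Algebra ℂ R] [CommRing R'] [Algebra ℂ R']
    (c : LineCoord R) (φ : R →ₐ[ℂ] R') (hφ : Function.Bijective φ) : LineCoord R' where
  τ := φ c.τ
  g := c.g
  inj p q h := c.inj (hφ.1 (by rwa [aeval_algHom_apply, aeval_algHom_apply] at h))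
  isUnit := by
    rw [aeval_algHom_apply]
    exact c.isUnit.map φ
  surj r := by
    obtain ⟨r, rfl⟩ := hφ.2 r
    obtain ⟨n, p, h⟩ := c.surj r
    exact ⟨n, p, by rw [aeval_algHom_apply, aeval_algHom_apply, ← h, map_mul, map_pow]⟩

/-- A coordinate on a localization. -/
theorem LineCoord.exists_away {R R' : Type} [CommRing R] [Algebra ℂ R] [CommRing R'] [Algebra ℂ R']
    [Algebra R R'] [IsScalarTower ℂ R R'] (c : LineCoord R) {r : R} (hr : r ≠ 0)
    [IsLocalization.Away r R'] : Nonempty (LineCoord R') := by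
  haveI := c.isDomain
  obtain ⟨n, P, hP⟩ := c.surj r
  have hinj : Function.Injective (algebraMap R R') :=
    IsLocalization.injective R' (powers_le_nonZeroDivisors_of_noZeroDivisors hr)
  have hmap : ∀ p : ℂ[X], aeval (algebraMap R R' c.τ) p = algebraMap R R' (aeval c.τ p) :=
    fun p => aeval_algebraMap_apply R' c.τ p
  refine ⟨⟨algebraMap R R' c.τ, c.g * P, fun p q h => ?_, ?_, fun r' => ?_⟩⟩
  · rw [hmap, hmap] at h
    exact c.inj (hinj h)
  · rw [hmap, map_mul, ← hP, map_mul, map_mul]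
    refine (c.isUnit.map _).mul (((c.isUnit.pow n).map _).mul ?_)
    exact IsLocalization.Away.algebraMap_isUnit r
  · obtain ⟨m, a, ha⟩ := IsLocalization.Away.surj r r'
    obtain ⟨k, p, hp⟩ := c.surj a
    refine ⟨m + k, c.g ^ m * P ^ k * c.g ^ (n * m) * p, ?_⟩
    have h1 : algebraMap R R' (aeval c.τ P) ^ m * r' =
        algebraMap R R' (aeval c.τ c.g) ^ (n * m) * algebraMap R R' a := by
      rw [← hP, map_mul, map_pow, mul_pow, ← ha]; ring
    simp only [hmap, map_mul, map_pow, mul_pow, ← hp]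
    calc _ = algebraMap R R' (aeval c.τ c.g) ^ (m + k) * algebraMap R R' (aeval c.τ P) ^ k *
          (algebraMap R R' (aeval c.τ P) ^ m * r') := by ring
      _ = _ := by rw [h1]; ring

variable {X Y Z : Scheme.{0}}

theorem appC_comp_appLE (f : X ⟶ Y) (s : Y ⟶ SpecC) (U : Y.Opens) (V : X.Opens)
    (e : V ≤ f ⁻¹ᵁ U) : appC s U ≫ f.appLE U V e = appC (f ≫ s) V := by
  rw [appC, appC, Category.assoc]
  exact congrArg (fun k => (Scheme.ΓSpecIso (.of ℂ)).inv ≫ k)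
    (Scheme.Hom.appLE_comp_appLE f s ⊤ U V (le_preimage_top s U) e)

/-- Pull back of sections as a map of `ℂ`-algebras. -/
def secMap (f : X ⟶ Y) (s : Y ⟶ SpecC) (U : Y.Opens) (V : X.Opens) (e : V ≤ f ⁻¹ᵁ U) :
    Sec s U →ₐ[ℂ] Sec (f ≫ s) V :=
  { (f.appLE U V e).hom with
    commutes' := fun z => ConcreteCategory.congr_hom (appC_comp_appLE f s U V e) z }

/-- An affine open subscheme with a coordinate identifying it with an open subset of the line. -/
structure Chart (s : Y ⟶ SpecC) where
  /-- the open subset -/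
  W : Y.Opens
  affine : IsAffineOpen W
  /-- the coordinate -/
  c : LineCoord (Sec s W)

/-- Every neighbourhood of a complex point contains a chart around the point. -/
def HasCharts (s : Y ⟶ SpecC) : Prop :=
  ∀ (p : ComplexPoint s) (O : Y.Opens), p.LiesIn O → ∃ K : Chart s, K.W ≤ O ∧ p.LiesIn K.W

theorem Chart.exists_le {s : Y ⟶ SpecC} (K : Chart s) {p : ComplexPoint s} {O : Y.Opens}
    (hp : p.LiesIn K.W) (hO : p.LiesIn O) :
    ∃ K' : Chart s, K'.W ≤ O ∧ K'.W ≤ K.W ∧ p.LiesIn K'.W := by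
  obtain ⟨r, hrO, hpr⟩ := K.affine.exists_basicOpen_le ⟨p.pt, (p.liesIn_iff O).1 hO⟩
    ((p.liesIn_iff K.W).1 hp)
  have hloc := K.affine.isLocalization_basicOpen r
  have hle : Y.basicOpen r ≤ K.W := Y.basicOpen_le r
  have hr : r ≠ 0 := by
    rintro rfl
    rw [Scheme.basicOpen_zero] at hpr
    exact hpr
  letI : Algebra (Sec s K.W) (Sec s (Y.basicOpen r)) :=
    inferInstanceAs (Algebra Γ(Y, K.W) Γ(Y, Y.basicOpen r))
  haveI : @IsLocalization.Away (Sec s K.W) _ r (Sec s (Y.basicOpen r)) _ _ := hloc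
  haveI : IsScalarTower ℂ (Sec s K.W) (Sec s (Y.basicOpen r)) :=
    IsScalarTower.of_algebraMap_eq' (by
      change (appC s (Y.basicOpen r)).hom =
        (Y.presheaf.map (homOfLE hle).op).hom.comp (appC s K.W).hom
      rw [← CommRingCat.hom_comp]
      refine congrArg _ ?_
      rw [appC, appC, Category.assoc]
      exact congrArg (fun k => (Scheme.ΓSpecIso (.of ℂ)).inv ≫ k)
        (Scheme.Hom.appLE_map s (le_preimage_top s K.W) (homOfLE hle).op).symm)
  obtain ⟨c'⟩ := LineCoord.exists_away (R := Sec s K.W) K.c (r := r) (R' := Sec s (Y.basicOpen r)) hr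
  exact ⟨⟨Y.basicOpen r, K.affine.basicOpen r, c'⟩, hrO, hle, (p.liesIn_iff _).2 hpr⟩

theorem secMap_bijective (j : Z ⟶ Y) [IsOpenImmersion j] (s : Y ⟶ SpecC) (W : Z.Opens) :
    Function.Bijective (secMap j s (j ''ᵁ W) W (j.preimage_image_eq W).ge) := by
  have h : IsIso (j.appLE (j ''ᵁ W) W (j.preimage_image_eq W).ge) := by
    rw [← Scheme.Hom.appIso_hom']; infer_instance
  exact ConcreteCategory.bijective_of_isIso (j.appLE (j ''ᵁ W) W (j.preimage_image_eq W).ge)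

theorem HasCharts.comp {s : Y ⟶ SpecC} (h : HasCharts s) (j : Z ⟶ Y) [IsOpenImmersion j] :
    HasCharts (j ≫ s) := by
  intro p O hp
  obtain ⟨⟨W, hW, c⟩, hKO, hpK⟩ := h (p.map j s) (j ''ᵁ O) ((ComplexPoint.liesIn_map j s p _).2
    (hp.mono (j.preimage_image_eq O).ge))
  have hKO' : W ≤ j ''ᵁ O := hKO
  obtain ⟨W', rfl⟩ : ∃ W' : Z.Opens, j ''ᵁ W' = W := by
    refine ⟨j ⁻¹ᵁ W, ?_⟩
    rw [Scheme.Hom.image_preimage_eq_opensRange_inf]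
    exact inf_eq_right.2 (hKO'.trans (j.image_le_opensRange O))
  refine ⟨⟨W', (j.isAffineOpen_iff_of_isOpenImmersion).1 hW,
    c.ofBijective _ (secMap_bijective j s W')⟩, (j.image_le_image_iff _ _).1 hKO', ?_⟩
  have h2 : p.LiesIn (j ⁻¹ᵁ (j ''ᵁ W')) := hpK
  rwa [j.preimage_image_eq] at h2

theorem exists_chart_of_spec {s : Y ⟶ SpecC} {R : Type} [CommRing R] [Algebra ℂ R]
    (c : LineCoord R) (j : Spec (.of R) ⟶ Y) [IsOpenImmersion j]
    (hj : j ≫ s = Spec.map (CommRingCat.ofHom (algebraMap ℂ R))) :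
    ∃ K : Chart s, K.W = j.opensRange := by
  have h1 : appC (j ≫ s) ⊤ =
      CommRingCat.ofHom (algebraMap ℂ R) ≫ (Scheme.ΓSpecIso (.of R)).inv := by
    rw [Scheme.ΓSpecIso_inv_naturality, hj]
    refine congrArg (fun k => (Scheme.ΓSpecIso (.of ℂ)).inv ≫ k) ?_
    exact Scheme.Hom.appLE_eq_app _
  let φ : R →ₐ[ℂ] Sec (j ≫ s) ⊤ :=
    { (Scheme.ΓSpecIso (.of R)).inv.hom with
      commutes' := fun z => (ConcreteCategory.congr_hom h1 z).symm }
  have hφ : Function.Bijective φ :=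
    ConcreteCategory.bijective_of_isIso (Scheme.ΓSpecIso (.of R)).inv
  let e := AlgEquiv.ofBijective _ (secMap_bijective j s ⊤)
  refine ⟨⟨j ''ᵁ ⊤, (isAffineOpen_top _).image_of_isOpenImmersion j,
    (c.ofBijective φ hφ).ofBijective e.symm.toAlgHom e.symm.bijective⟩, ?_⟩
  exact j.image_top_eq_opensRange

theorem HasCharts.of_cover {s : Y ⟶ SpecC}
    (h : ∀ y : Y, ∃ K : Chart s, y ∈ K.W) : HasCharts s := by
  intro p O hp
  obtain ⟨K, hK⟩ := h p.pt
  obtain ⟨K', h1, -, h2⟩ := K.exists_le ((p.liesIn_iff _).2 hK) hp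
  exact ⟨K', h1, h2⟩

end Charts

/-! ### Charts of the projective line -/

section ProjectiveLine

open HomogeneousLocalization

attribute [local instance] MvPolynomial.gradedAlgebra

/-- The homogeneous coordinate ring of the line. -/
abbrev LinePoly : Type := MvPolynomial (Fin (1 + 1)) ℂ

/-- The grading of the homogeneous coordinate ring of the line. -/
abbrev lineGrading : ℕ → Submodule ℂ LinePoly :=
  MvPolynomial.homogeneousSubmodule (Fin (1 + 1)) ℂ

/-- The ring of a standard affine chart of the line. -/
abbrev LineAway (i : Fin (1 + 1)) : Type := Away lineGrading (MvPolynomial.X i)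

/-- The localization containing the ring of a standard affine chart of the line. -/
abbrev LineLoc (i : Fin (1 + 1)) : Type :=
  Localization.Away (MvPolynomial.X i : LinePoly)

theorem X_mem_lineGrading (i : Fin (1 + 1)) :
    (MvPolynomial.X i : LinePoly) ∈ lineGrading 1 :=
  MvPolynomial.isHomogeneous_X ℂ i

instance (i : Fin (1 + 1)) : Algebra ℂ (LineAway i) where
  smul z r := z • r
  algebraMap := (fromZeroRingHom lineGrading _).comp (algebraMap ℂ (lineGrading 0))
  commutes' _ _ := mul_comm _ _
  smul_def' z r := by
    apply HomogeneousLocalization.val_injective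
    refine (HomogeneousLocalization.val_smul _ z r).trans ?_
    rw [HomogeneousLocalization.val_mul, Algebra.smul_def,
      IsScalarTower.algebraMap_apply ℂ LinePoly
        (LineLoc i)]
    rfl

/-- The affine coordinate of a standard chart of the line. -/
def lineCoordinate (i j : Fin (1 + 1)) : LineAway i :=
  Away.mk lineGrading (X_mem_lineGrading i) 1 (MvPolynomial.X j) (X_mem_lineGrading j)

/-- Dehomogenization. -/
def dehom (i : Fin (1 + 1)) : LinePoly →ₐ[ℂ] Polynomial ℂ :=
  MvPolynomial.aeval fun k => if k = i then 1 else Polynomial.X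

theorem aeval_mul_of_isHomogeneous {S : Type} [CommRing S] [Algebra ℂ S] {σ : Type}
    {f : MvPolynomial σ ℂ} {n : ℕ} (hf : f.IsHomogeneous n) (c : S) (v : σ → S) :
    MvPolynomial.aeval (fun k => c * v k) f = c ^ n * MvPolynomial.aeval v f := by
  rw [MvPolynomial.aeval_def, MvPolynomial.aeval_def, MvPolynomial.eval₂_eq,
    MvPolynomial.eval₂_eq, Finset.mul_sum]
  refine Finset.sum_congr rfl fun d hd => ?_
  rw [hf.degree_eq_sum_deg_support hd]
  simp only [mul_pow, Finset.prod_mul_distrib, Finset.prod_pow_eq_pow_sum]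
  ring

instance (i : Fin (1 + 1)) :
    @IsScalarTower ℂ (LineAway i) (LineLoc i) Algebra.toSMul Algebra.toSMul Algebra.toSMul :=
  IsScalarTower.of_algebraMap_eq (R := ℂ) (S := LineAway i)
    (A := LineLoc i) fun z => by
    rw [IsScalarTower.algebraMap_apply ℂ LinePoly
      (LineLoc i)]
    rfl

/-- The fraction `f / X_i ^ n` is the dehomogenization of `f` at `X_j / X_i`. After multiplication
by `X_i ^ n` this is the homogeneity of `f`. -/
theorem aeval_lineCoordinate {i j : Fin (1 + 1)} (hij : ∀ k, k ≠ i → k = j) (r : LineAway i) :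
    ∃ p : Polynomial ℂ, Polynomial.aeval (lineCoordinate i j) p = r := by
  obtain ⟨n, f, hf, rfl⟩ := Away.mk_surjective lineGrading (X_mem_lineGrading i) r
  have hf' : f.IsHomogeneous n := by simpa using hf
  refine ⟨dehom i f, ?_⟩
  have hinj : Function.Injective (algebraMap (LineAway i) (LineLoc i)) :=
    HomogeneousLocalization.val_injective _
  apply hinj
  rw [← Polynomial.aeval_algebraMap_apply (LineLoc i)]
  let c : (LineLoc i) := algebraMap LinePoly (LineLoc i) (MvPolynomial.X i)
  have hc : IsUnit c := IsLocalization.Away.algebraMap_isUnit _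
  have hmk : ∀ (m : ℕ) (a : LinePoly) (ha : a ∈ lineGrading (m • 1)),
      c ^ m * algebraMap (LineAway i) (LineLoc i) (Away.mk lineGrading (X_mem_lineGrading i) m a ha) =
        algebraMap LinePoly (LineLoc i) a := by
    intro m a ha
    rw [HomogeneousLocalization.algebraMap_apply, Away.val_mk, Localization.mk_eq_mk', ← map_pow]
    exact IsLocalization.mk'_spec' (LineLoc i) a _
  refine (hc.pow n).mul_left_cancel ?_
  rw [hmk, dehom]
  set x := algebraMap (LineAway i) (LineLoc i) (lineCoordinate i j) with hx
  have hcx : c * x = algebraMap LinePoly (LineLoc i) (MvPolynomial.X j) := by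
    have := hmk 1 (MvPolynomial.X j) (X_mem_lineGrading j)
    rwa [pow_one] at this
  have h1 : Polynomial.aeval x (MvPolynomial.aeval
      (fun k => if k = i then 1 else (Polynomial.X : Polynomial ℂ)) f) =
      MvPolynomial.aeval (fun k => if k = i then 1 else x) f := by
    rw [← AlgHom.comp_apply]
    congr 1
    refine MvPolynomial.algHom_ext fun k => ?_
    rw [AlgHom.comp_apply, MvPolynomial.aeval_X, MvPolynomial.aeval_X]
    split_ifs <;> simp
  rw [h1, ← aeval_mul_of_isHomogeneous hf']
  have h2 : (fun k => c * if k = i then 1 else x) =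
      fun k => algebraMap LinePoly (LineLoc i) (MvPolynomial.X k) := by
    funext k
    split_ifs with hk
    · rw [hk, mul_one]
    · rw [hij k hk, hcx]
  rw [h2]
  have h3 : MvPolynomial.aeval (fun k => algebraMap LinePoly (LineLoc i) (MvPolynomial.X k)) =
      IsScalarTower.toAlgHom ℂ LinePoly (LineLoc i) :=
    MvPolynomial.algHom_ext fun k => by rw [MvPolynomial.aeval_X]; rfl
  rw [h3]
  rfl

/-- Dehomogenization sends `X_i` to 1, so it extends to the localization and is a left inverse. -/
theorem aeval_lineCoordinate_injective {i j : Fin (1 + 1)} (hij : j ≠ i) :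
    Function.Injective (Polynomial.aeval (R := ℂ) (lineCoordinate i j)) := by
  have hu : IsUnit ((dehom i).toRingHom (MvPolynomial.X i)) := by
    simp [dehom]
  let Λ : (LineLoc i) →+* Polynomial ℂ := IsLocalization.Away.lift (MvPolynomial.X i) hu
  have hΛ : ∀ a, Λ (algebraMap LinePoly (LineLoc i) a) = dehom i a :=
    fun a => IsLocalization.Away.lift_eq _ hu a
  let Λ' : LineAway i →ₐ[ℂ] Polynomial ℂ :=
    { Λ.comp (algebraMap (LineAway i) (LineLoc i)) with
      commutes' := fun z => by
        change Λ (algebraMap (LineAway i) (LineLoc i) (algebraMap ℂ (LineAway i) z)) = _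
        rw [← IsScalarTower.algebraMap_apply ℂ (LineAway i) (LineLoc i),
          IsScalarTower.algebraMap_apply ℂ LinePoly (LineLoc i), hΛ]
        exact (dehom i).commutes z }
  have hτ : Λ' (lineCoordinate i j) = Polynomial.X := by
    have h1 : algebraMap LinePoly (LineLoc i) (MvPolynomial.X i) *
        algebraMap (LineAway i) (LineLoc i) (lineCoordinate i j) =
          algebraMap LinePoly (LineLoc i) (MvPolynomial.X j) := by
      rw [HomogeneousLocalization.algebraMap_apply, lineCoordinate, Away.val_mk,
        Localization.mk_eq_mk']
      convert IsLocalization.mk'_spec' (LineLoc i) (MvPolynomial.X j)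
        (⟨MvPolynomial.X i ^ 1, 1, rfl⟩ : Submonoid.powers (MvPolynomial.X i)) using 2
      simp
    have h2 := congrArg Λ h1
    rw [map_mul, hΛ, hΛ] at h2
    have h3 : dehom i (MvPolynomial.X i) = 1 := by simp [dehom]
    have h4 : dehom i (MvPolynomial.X j) = Polynomial.X := by simp [dehom, hij]
    rwa [h3, h4, one_mul] at h2
  have hid : ∀ p, Λ' (Polynomial.aeval (lineCoordinate i j) p) = p := by
    intro p
    rw [← Polynomial.aeval_algHom_apply, hτ, Polynomial.aeval_X_left_apply]
  exact Function.LeftInverse.injective hid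

/-- The coordinate of a standard chart of the line. -/
def lineAwayCoord {i j : Fin (1 + 1)} (h : j ≠ i) (hij : ∀ k, k ≠ i → k = j) :
    LineCoord (LineAway i) where
  τ := lineCoordinate i j
  g := 1
  inj := aeval_lineCoordinate_injective h
  isUnit := by simp
  surj r := by
    obtain ⟨p, hp⟩ := aeval_lineCoordinate hij r
    exact ⟨0, p, by simp [hp]⟩

theorem hasCharts_line : HasCharts (ProjSpace.structMap 1) := by
  have hcov : ⨆ i : Fin (1 + 1), Proj.basicOpen lineGrading (MvPolynomial.X i) = ⊤ := by
    refine Proj.iSup_basicOpen_eq_top' _ _ (fun i => ⟨1, X_mem_lineGrading i⟩) ?_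
    refine top_le_iff.1 fun f _ => ?_
    have h := (MvPolynomial.adjoin_range_X (R := ℂ) (σ := Fin (1 + 1))).ge
      (Algebra.mem_top (x := f))
    refine Algebra.adjoin_induction (fun x hx => Algebra.subset_adjoin hx) (fun z => ?_)
      (fun _ _ _ _ h1 h2 => add_mem h1 h2) (fun _ _ _ _ h1 h2 => mul_mem h1 h2) h
    exact Subalgebra.algebraMap_mem _ (algebraMap ℂ (lineGrading 0) z)
  refine HasCharts.of_cover fun y => ?_
  have hy : y ∈ ⨆ i : Fin (1 + 1), Proj.basicOpen lineGrading (MvPolynomial.X i) := by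
    rw [hcov]; trivial
  obtain ⟨i, hi⟩ := Opens.mem_iSup.1 hy
  obtain ⟨j, h, hij⟩ : ∃ j, j ≠ i ∧ ∀ k, k ≠ i → k = j := by
    have : ∀ i : Fin (1 + 1), i.rev ≠ i ∧ ∀ k, k ≠ i → k = i.rev := by decide
    exact ⟨i.rev, this i⟩
  let jm : Spec (.of (LineAway i)) ⟶ ProjSpace 1 :=
    Proj.awayι lineGrading (MvPolynomial.X i) (X_mem_lineGrading i) one_pos
  haveI : IsOpenImmersion jm := inferInstanceAs (IsOpenImmersion
    (Proj.awayι lineGrading (MvPolynomial.X i) (X_mem_lineGrading i) one_pos))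
  obtain ⟨K, hK⟩ := exists_chart_of_spec (s := ProjSpace.structMap 1) (lineAwayCoord h hij) jm (by
    refine (Category.assoc _ _ _).symm.trans ?_
    refine (congrArg (· ≫ _) (Proj.awayι_toSpecZero lineGrading _ _ _)).trans ?_
    rw [← Spec.map_comp]
    rfl)
  refine ⟨K, ?_⟩
  rw [hK]
  exact (Proj.opensRange_awayι lineGrading _ (X_mem_lineGrading i) one_pos).ge hi

end ProjectiveLine

/-! ### Sheets, path lifting and parallel relations -/

section Coverings

open Filter Topology

variable {E B : Type} [TopologicalSpace E] [TopologicalSpace B]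

/-- A decomposition of the preimage of an open set into finitely many sheets. -/
structure Sheets (p : E → B) (N : Set B) (d : ℕ) where
  /-- the sections -/
  s : Fin d → B → E
  isOpen_base : IsOpen N
  isOpen_preimage : IsOpen (p ⁻¹' N)
  continuousOn_proj : ContinuousOn p (p ⁻¹' N)
  continuousOn : ∀ i, ContinuousOn (s i) N
  proj : ∀ i, ∀ b ∈ N, p (s i b) = b
  inj : ∀ b ∈ N, ∀ i j, s i b = s j b → i = j
  surj : ∀ x, p x ∈ N → ∃ i, x = s i (p x)
  isOpen_sheet : ∀ i, IsOpen {x | p x ∈ N ∧ x = s i (p x)}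

namespace Sheets

variable {p : E → B} {N : Set B} {d : ℕ} (S : Sheets p N d)

include S in
theorem isEvenlyCovered {w : B} (hw : w ∈ N) : IsEvenlyCovered p w (Fin d) := by
  refine ⟨inferInstance, N, hw, S.isOpen_base, S.isOpen_preimage, ?_⟩
  choose idx hidx using fun x : p ⁻¹' N => S.surj x.1 x.2
  have hmem : ∀ (b : N) i, S.s i b ∈ p ⁻¹' N := fun b i => by
    rw [Set.mem_preimage, S.proj i b b.2]; exact b.2
  refine ⟨{
    toFun := fun x => (⟨p x.1, x.2⟩, idx x)
    invFun := fun u => ⟨S.s u.2 u.1, hmem u.1 u.2⟩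
    left_inv := fun x => Subtype.ext (hidx x).symm
    right_inv := fun u => by
      have h1 := S.proj u.2 u.1 u.1.2
      refine Prod.ext (Subtype.ext h1) (S.inj _ u.1.2 _ _ ?_)
      have h2 := hidx ⟨S.s u.2 u.1, hmem u.1 u.2⟩
      rw [h1] at h2
      exact h2.symm
    continuous_toFun := ?_
    continuous_invFun := ?_ }, fun x => rfl⟩
  · refine Continuous.prodMk (S.continuousOn_proj.domRestrict.subtype_mk _) ?_
    rw [continuous_discrete_rng]
    intro i
    convert (S.isOpen_sheet i).preimage continuous_subtype_val using 1
    ext x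
    constructor
    · rintro rfl
      exact ⟨x.2, hidx x⟩
    · rintro ⟨-, h⟩
      exact S.inj _ x.2 _ _ ((hidx x).symm.trans h)
  · refine Continuous.subtype_mk ?_ _
    rw [continuous_prod_of_discrete_right]
    exact fun i => (S.continuousOn i).domRestrict

/-- The sheets number the fibre over each point. -/
def fiberEquiv {w : B} (hw : w ∈ N) : Fin d ≃ {x : E // p x = w} :=
  Equiv.ofBijective (fun i => ⟨S.s i w, S.proj i w hw⟩) (by
    refine ⟨fun i j h => S.inj w hw i j (congrArg Subtype.val h), ?_⟩
    rintro ⟨x, rfl⟩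
    obtain ⟨i, hi⟩ := S.surj x hw
    exact ⟨i, Subtype.ext hi.symm⟩)

/-- Restriction to a smaller open set. -/
def restrict {N' : Set B} (hN' : IsOpen N') (h : N' ⊆ N) : Sheets p N' d where
  s := S.s
  isOpen_base := hN'
  isOpen_preimage := by
    have := S.continuousOn_proj.isOpen_inter_preimage S.isOpen_preimage hN'
    rwa [← Set.preimage_inter, Set.inter_eq_right.2 h] at this
  continuousOn_proj := S.continuousOn_proj.mono (Set.preimage_mono h)
  continuousOn i := (S.continuousOn i).mono h
  proj i b hb := S.proj i b (h hb)
  inj b hb := S.inj b (h hb)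
  surj x hx := S.surj x (h hx)
  isOpen_sheet i := by
    have h1 := S.continuousOn_proj.isOpen_inter_preimage S.isOpen_preimage hN'
    convert h1.inter (S.isOpen_sheet i) using 1
    ext x
    exact ⟨fun hx => ⟨⟨h hx.1, hx.1⟩, h hx.1, hx.2⟩, fun hx => ⟨hx.1.2, hx.2.2⟩⟩

end Sheets

/-! ### Lifting of paths and loops. -/

section PathLifting

variable {p : E → B} {W : Set B} (hp : IsCoveringMapOn p W)

include hp

theorem exists_path_lift {u v : B} (γ : Path u v) (hγ : ∀ t, γ t ∈ W) {x : E} (hx : p x = u) :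
    ∃ (y : E) (Γ : Path x y), ∀ t, p (Γ t) = γ t := by
  have hc := hp.isCoveringMap_restrictPreimage
  let γ' : C(unitInterval, W) := ⟨fun t => ⟨γ t, hγ t⟩, by fun_prop⟩
  have hxW : p x ∈ W := by rw [hx, ← γ.source]; exact hγ 0
  obtain ⟨Γ, hΓ, hΓ0⟩ := hc.exists_path_lifts γ' ⟨x, hxW⟩ (Subtype.ext (by
    change γ 0 = p x
    rw [γ.source, hx]))
  refine ⟨(Γ 1).1, ⟨⟨fun t => (Γ t).1, by fun_prop⟩, ?_, rfl⟩, fun t => ?_⟩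
  · exact congrArg Subtype.val hΓ0
  · exact congrArg Subtype.val (congrFun hΓ t)

theorem path_lift_unique {x y y' : E} (Γ : Path x y) (Γ' : Path x y')
    (h : ∀ t, p (Γ t) = p (Γ' t)) (hW : ∀ t, p (Γ t) ∈ W) : y = y' := by
  have hc := hp.isCoveringMap_restrictPreimage
  have h1 : Continuous fun t => (⟨Γ t, hW t⟩ : p ⁻¹' W) := by fun_prop
  have h2 : Continuous fun t => (⟨Γ' t, by rw [Set.mem_preimage, ← h t]; exact hW t⟩ : p ⁻¹' W) :=
    by fun_prop
  have := hc.eq_of_comp_eq h1 h2 (funext fun t => Subtype.ext (h t)) 0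
    (Subtype.ext (Γ.source.trans Γ'.source.symm))
  have h3 := congrArg Subtype.val (congrFun this 1)
  simpa using h3

/-- Every loop induces a permutation of the fibre. -/
theorem exists_perm_of_loop {u : B} (γ : Path u u) (hγ : ∀ t, γ t ∈ W) :
    ∃ σ : Equiv.Perm {x : E // p x = u}, ∀ x, ∃ Γ : Path x.1 (σ x).1, ∀ t, p (Γ t) = γ t := by
  have hend : ∀ {x y : E} (γ : Path u u) (Γ : Path x y), (∀ t, p (Γ t) = γ t) → p y = u := by
    intro x y γ Γ h
    rw [← Γ.target, h 1, γ.target]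
  choose f F hF using fun x : {x : E // p x = u} => exists_path_lift hp γ hγ x.2
  choose f' F' hF' using fun x : {x : E // p x = u} =>
    exists_path_lift hp γ.symm (fun t => hγ _) x.2
  -- The inverse permutation lifts the reversed loop; uniqueness of lifts shows that the two are
  -- inverse to each other.
  refine ⟨⟨fun x => ⟨f x, hend γ (F x) (hF x)⟩, fun x => ⟨f' x, hend γ.symm (F' x) (hF' x)⟩,
    fun x => Subtype.ext ?_, fun x => Subtype.ext ?_⟩, fun x => ⟨F x, hF x⟩⟩
  · refine path_lift_unique hp (F' ⟨f x, hend γ (F x) (hF x)⟩) (F x).symm (fun t => ?_) fun t => ?_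
    · rw [hF']; exact (hF x _).symm
    · rw [hF']; exact hγ _
  · refine path_lift_unique hp (F ⟨f' x, hend γ.symm (F' x) (hF' x)⟩) (F' x).symm (fun t => ?_)
      fun t => ?_
    · rw [hF]
      refine Eq.trans ?_ (hF' x _).symm
      exact congrArg γ (unitInterval.symm_symm t).symm
    · rw [hF]; exact hγ _

end PathLifting

/-- Sheets on which a relation `r` between points of the same fibre is constant off the centre. -/
structure RelSheets (p : E → B) (r : E → E → Prop) (w : B) (d : ℕ) where
  /-- the neighbourhood -/
  N : Set B
  mem : w ∈ N
  sheets : Sheets p N d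
  isOpen_diff : IsOpen (N \ {w})
  neBot : ∀ b ∈ N, (𝓝[≠] b).NeBot
  /-- the relation between the sheets -/
  P : Fin d → Fin d → Prop
  rel_iff : ∀ i j, ∀ b ∈ N \ {w}, (r (sheets.s i b) (sheets.s j b) ↔ P i j)

/-- The continuation of a relation across isolated points of the base. -/
def Continued (p : E → B) (r : E → E → Prop) (x y : E) : Prop :=
  p x = p y ∧ ∃ᶠ z in 𝓝 x ×ˢ 𝓝 y, z.1 ≠ x ∧ p z.1 = p z.2 ∧ r z.1 z.2

namespace RelSheets

variable {p : E → B} {r : E → E → Prop} {w : B} {d : ℕ} (S : RelSheets p r w d)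

/-- Pairs near the two given points lie on sheets `i` and `j`, and the condition `z.1 ≠ x` moves the
base point off `b`. So the relation is tested off the centre even when `b = w`, and there `P`
decides it. -/
theorem continued_iff (i j : Fin d) {b : B} (hb : b ∈ S.N) :
    Continued p r (S.sheets.s i b) (S.sheets.s j b) ↔ S.P i j := by
  have hpi := S.sheets.proj i b hb
  have hpj := S.sheets.proj j b hb
  constructor
  · rintro ⟨-, h⟩
    have h1 : ∀ᶠ x in 𝓝 (S.sheets.s i b), p x ∈ S.N ∧ x = S.sheets.s i (p x) :=
      (S.sheets.isOpen_sheet i).mem_nhds ⟨by rwa [hpi], by rw [hpi]⟩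
    have h2 : ∀ᶠ x in 𝓝 (S.sheets.s j b), p x ∈ S.N ∧ x = S.sheets.s j (p x) :=
      (S.sheets.isOpen_sheet j).mem_nhds ⟨by rwa [hpj], by rw [hpj]⟩
    have h3 : ∀ᶠ x in 𝓝 (S.sheets.s i b), b = w ∨ p x ∈ S.N \ {w} := by
      by_cases hbw : b = w
      · exact Eventually.of_forall fun _ => Or.inl hbw
      · have hc : ContinuousAt p (S.sheets.s i b) := S.sheets.continuousOn_proj.continuousAt
          (S.sheets.isOpen_preimage.mem_nhds (by rwa [Set.mem_preimage, hpi]))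
        have := hc.preimage_mem_nhds (S.isOpen_diff.mem_nhds (by rw [hpi]; exact ⟨hb, hbw⟩))
        filter_upwards [this] with x hx using Or.inr hx
    obtain ⟨⟨x, y⟩, ⟨hne, hpxy, hr⟩, ⟨⟨hx, hx'⟩, hxw⟩, hy, hy'⟩ :=
      (h.and_eventually ((h1.and h3).prod_mk h2)).exists
    dsimp only at *
    have hpx : p x ∈ S.N \ {w} := by
      rcases hxw with rfl | h
      · refine ⟨hx, fun h => hne ?_⟩
        rw [hx']
        exact congrArg _ h
      · exact h
    rw [← S.rel_iff i j _ hpx, ← hx']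
    rw [hpxy, ← hy']
    exact hr
  · intro hP
    refine ⟨hpi.trans hpj.symm, ?_⟩
    haveI := S.neBot b hb
    have hci := (S.sheets.continuousOn i).continuousAt (S.sheets.isOpen_base.mem_nhds hb)
    have hcj := (S.sheets.continuousOn j).continuousAt (S.sheets.isOpen_base.mem_nhds hb)
    have ht : Tendsto (fun b' => (S.sheets.s i b', S.sheets.s j b')) (𝓝[≠] b)
        (𝓝 (S.sheets.s i b) ×ˢ 𝓝 (S.sheets.s j b)) :=
      (hci.tendsto.prodMk hcj.tendsto).mono_left nhdsWithin_le_nhds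
    refine ht.frequently (Eventually.frequently ?_)
    have hd : ∀ᶠ b' in 𝓝[≠] b, b' ∈ S.N \ {w} := by
      by_cases hbw : b = w
      · subst hbw
        filter_upwards [nhdsWithin_le_nhds (S.sheets.isOpen_base.mem_nhds hb),
          self_mem_nhdsWithin] with b' h1 h2 using ⟨h1, h2⟩
      · exact nhdsWithin_le_nhds (S.isOpen_diff.mem_nhds ⟨hb, hbw⟩)
    filter_upwards [hd, self_mem_nhdsWithin] with b' hb' hne
    have h1 := S.sheets.proj i b' hb'.1
    refine ⟨fun h => hne ?_, h1.trans (S.sheets.proj j b' hb'.1).symm, (S.rel_iff i j b' hb').2 hP⟩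
    rw [Set.mem_singleton_iff, ← h1, h, hpi]

end RelSheets

/-- A continued relation is invariant under parallel transport. -/
theorem continued_iff_of_paths {p : E → B} {r : E → E → Prop} {d : ℕ} {W : Set B}
    (hS : ∀ w ∈ W, Nonempty (RelSheets p r w d)) {x x' y y' : E} (Γ : Path x x') (Δ : Path y y')
    (h : ∀ t, p (Γ t) = p (Δ t)) (hW : ∀ t, p (Γ t) ∈ W) :
    Continued p r x y ↔ Continued p r x' y' := by
  have hloc : ∀ t, ∀ᶠ t' in 𝓝 t,
      (Continued p r (Γ t') (Δ t') ↔ Continued p r (Γ t) (Δ t)) := by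
    intro t
    obtain ⟨S⟩ := hS _ (hW t)
    obtain ⟨i, hi⟩ := S.sheets.surj (Γ t) S.mem
    obtain ⟨j, hj⟩ := S.sheets.surj (Δ t) (by rw [← h]; exact S.mem)
    have h1 := Γ.continuous.continuousAt.preimage_mem_nhds
      ((S.sheets.isOpen_sheet i).mem_nhds ⟨S.mem, hi⟩)
    have h2 := Δ.continuous.continuousAt.preimage_mem_nhds
      ((S.sheets.isOpen_sheet j).mem_nhds ⟨by rw [← h]; exact S.mem, hj⟩)
    filter_upwards [h1, h2] with t' ht ht'
    rw [hi, hj, ht.2, ht'.2, ← h t, ← h t', S.continued_iff i j S.mem, S.continued_iff i j ht.1]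
  have hconst : IsLocallyConstant fun t => Continued p r (Γ t) (Δ t) :=
    (IsLocallyConstant.iff_eventually_eq _).2 fun t => (hloc t).mono fun t' h => propext h
  have := hconst.apply_eq_of_isPreconnected isPreconnected_univ (Set.mem_univ 0) (Set.mem_univ 1)
  simpa using this

end Coverings

/-! ### Finite maps over charts -/

section ChartPoints

open Filter Topology

variable {X Y : Scheme.{0}} {s : Y ⟶ SpecC}

theorem LineCoord.isOpenEmbedding_apply {R : Type} [CommRing R] [Algebra ℂ R] (c : LineCoord R) :
    IsOpenEmbedding fun y : Points R => y c.τ := by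
  refine .of_continuous_injective_isOpenMap (Points.continuous_apply c.τ)
    (fun y y' h => c.ext_point h) fun U hU => ?_
  have hc : Continuous fun t : {t : ℂ // c.g.eval t ≠ 0} => (c.ev t.1 t.2 : Points R) := by
    refine Points.continuous_iff.2 fun r => ?_
    rw [continuous_iff_continuousAt]
    exact fun t => (c.differentiableAt_val r t.2).continuousAt.comp continuousAt_subtype_val
  have ho : IsOpen {t : ℂ | c.g.eval t ≠ 0} := LineCoord.isOpen_eval_ne_zero c.g
  convert ho.isOpenMap_subtype_val _ (hU.preimage hc) using 1
  ext t
  constructor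
  · rintro ⟨y, hy, rfl⟩
    refine ⟨⟨y c.τ, c.eval_g_ne_zero y⟩, ?_, rfl⟩
    rw [Set.mem_preimage, ← c.eq_ev y]
    exact hy
  · rintro ⟨⟨t, ht⟩, hU, rfl⟩
    exact ⟨_, hU, c.ev_τ t ht⟩

namespace Chart

variable (K : Chart s)

open Classical in
/-- The coordinate of a complex point. -/
def coord (q : ComplexPoint s) : ℂ := if h : q.LiesIn K.W then q.toPoint h K.c.τ else 0

variable {K}

theorem coord_eq {q : ComplexPoint s} (h : q.LiesIn K.W) : K.coord q = q.toPoint h K.c.τ :=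
  dif_pos h

theorem eval_g_coord {q : ComplexPoint s} (h : q.LiesIn K.W) : K.c.g.eval (K.coord q) ≠ 0 := by
  rw [coord_eq h]
  exact K.c.eval_g_ne_zero _

theorem eq_of_coord_eq {q q' : ComplexPoint s} (h : q.LiesIn K.W) (h' : q'.LiesIn K.W)
    (hc : K.coord q = K.coord q') : q = q' := by
  rw [coord_eq h, coord_eq h'] at hc
  exact ComplexPoint.toPoint_injective K.affine h h' (K.c.ext_point hc)

variable (K)

theorem isOpenEmbedding_coord :
    IsOpenEmbedding fun q : {q : ComplexPoint s // q.LiesIn K.W} => K.coord q.1 := by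
  have : (fun q : {q : ComplexPoint s // q.LiesIn K.W} => K.coord q.1) =
      (fun y : Points (Sec s K.W) => y K.c.τ) ∘ ComplexPoint.affineHomeo K.affine := by
    funext q
    exact coord_eq q.2
  rw [this]
  exact K.c.isOpenEmbedding_apply.comp (ComplexPoint.affineHomeo K.affine).isOpenEmbedding

theorem exists_coord_eq {t : ℂ} (ht : K.c.g.eval t ≠ 0) :
    ∃ q : ComplexPoint s, q.LiesIn K.W ∧ K.coord q = t := by
  have h := ComplexPoint.liesIn_ofPoint (s := s) K.affine (K.c.ev t ht)
  exact ⟨_, h, by rw [coord_eq h, ComplexPoint.toPoint_ofPoint, K.c.ev_τ]⟩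

theorem continuousOn_coord : ContinuousOn K.coord {q | q.LiesIn K.W} :=
  continuousOn_iff_continuous_domRestrict.2 K.isOpenEmbedding_coord.continuous

/-- The points of a chart whose coordinate lies in a given set. -/
def region (D : Set ℂ) : Set (ComplexPoint s) := {q | q.LiesIn K.W ∧ K.coord q ∈ D}

theorem isOpen_region {D : Set ℂ} (hD : IsOpen D) : IsOpen (K.region D) :=
  K.continuousOn_coord.isOpen_inter_preimage (ComplexPoint.isOpen_liesIn K.W) hD

theorem isPreconnected_region {D : Set ℂ} (hD : IsPreconnected D)
    (hg : ∀ t ∈ D, K.c.g.eval t ≠ 0) : IsPreconnected (K.region D) := by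
  have h := (hD.preimage_of_isOpenMap K.isOpenEmbedding_coord.injective
    K.isOpenEmbedding_coord.isOpenMap fun t ht => by
      obtain ⟨q, hq, rfl⟩ := K.exists_coord_eq (hg t ht)
      exact ⟨⟨q, hq⟩, rfl⟩).image Subtype.val continuous_subtype_val.continuousOn
  convert h using 1
  ext q
  exact ⟨fun h => ⟨⟨q, h.1⟩, h.2, rfl⟩, by rintro ⟨q, h, rfl⟩; exact ⟨q.2, h⟩⟩

theorem neBot_nhds {q : ComplexPoint s} (hq : q.LiesIn K.W) : (𝓝[≠] q).NeBot := by
  rw [← mem_closure_iff_nhdsWithin_neBot, mem_closure_iff]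
  intro U hU hqU
  have h1 := K.isOpenEmbedding_coord.isOpenMap _ (hU.preimage continuous_subtype_val)
  have h2 : K.coord q ∈ (fun q : {q : ComplexPoint s // q.LiesIn K.W} => K.coord q.1) ''
    (Subtype.val ⁻¹' U) := ⟨⟨q, hq⟩, hqU, rfl⟩
  have h3 : ∀ᶠ t in 𝓝[≠] (K.coord q), t ∈ (fun q : {q : ComplexPoint s // q.LiesIn K.W} =>
    K.coord q.1) '' (Subtype.val ⁻¹' U) := nhdsWithin_le_nhds (h1.mem_nhds h2)
  obtain ⟨t, ⟨q', hq', rfl⟩, ht⟩ := (h3.and self_mem_nhdsWithin).exists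
  exact ⟨q'.1, hq', fun h => ht (by rw [Set.mem_singleton_iff] at h ⊢; exact congrArg K.coord h)⟩

end Chart

/-- The map `f` is finite over the chart `K`, of degree the degree of `f`. -/
structure FinChart [IrreducibleSpace X] (f : X ⟶ Y) (K : Chart s) : Prop where
  affine : IsAffineOpen (f ⁻¹ᵁ K.W)
  isDomain : IsDomain (Sec (f ≫ s) (f ⁻¹ᵁ K.W))
  finite : Module.Finite (Sec s K.W) (Sec (f ≫ s) (f ⁻¹ᵁ K.W))
  torsionFree : Module.IsTorsionFree (Sec s K.W) (Sec (f ≫ s) (f ⁻¹ᵁ K.W))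
  finrank_eq : Module.finrank (Sec s K.W) (Sec (f ≫ s) (f ⁻¹ᵁ K.W)) = degree f

theorem Chart.nonempty (K : Chart s) : (K.W : Set Y).Nonempty := by
  obtain ⟨t, ht⟩ := (Polynomial.exists_eval_ne_zero_of_natDegree_lt_card K.c.g K.c.g_ne_zero
    ((Cardinal.natCast_lt_aleph0).trans_le (Cardinal.aleph0_le_mk ℂ)))
  obtain ⟨q, hq, -⟩ := K.exists_coord_eq ht
  exact ⟨q.pt, (q.liesIn_iff _).1 hq⟩

theorem Chart.isReduced (K : Chart s) : _root_.IsReduced Γ(Y, K.W) := by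
  haveI : IsDomain Γ(Y, K.W) := K.c.isDomain
  infer_instance

theorem finChart_of_finite [IsIntegral X] (f : X ⟶ Y) [IsDominant f] (K : Chart s)
    (hA : IsAffineOpen (f ⁻¹ᵁ K.W)) (hf : (f.app K.W).hom.Finite) : FinChart f K := by
  haveI := K.isReduced
  haveI : IsDomain (Sec s K.W) := K.c.isDomain
  have hne : Nonempty (f ⁻¹ᵁ K.W).toScheme :=
    ⟨⟨genericPoint X, map_genericPoint_mem f K.nonempty⟩⟩
  haveI hdom : IsDomain (Sec (f ≫ s) (f ⁻¹ᵁ K.W)) := inferInstanceAs (IsDomain Γ(X, f ⁻¹ᵁ K.W))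
  refine ⟨hA, hdom, hf, ?_, (degree_eq_finrank f K.affine K.nonempty hA).symm⟩
  have hinj : Function.Injective (algebraMap (Sec s K.W) (Sec (f ≫ s) (f ⁻¹ᵁ K.W))) :=
    app_injective f K.affine
  exact Module.isTorsionFree_iff_algebraMap_injective.2 hinj

theorem finChart_of_le [IsIntegral X] (f : X ⟶ Y) [IsDominant f] (K : Chart s) {O : Y.Opens}
    (hO : IsFinite (f ∣_ O)) (h : K.W ≤ O) : FinChart f K :=
  finChart_of_finite f K (isAffineOpen_preimage_of_le f hO h K.affine)
    (finite_app_of_le f hO h K.affine)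

/-- All points of the chart are unramified. -/
def Unram (f : X ⟶ Y) (K : Chart s) : Prop :=
  ∀ t, K.c.g.eval t ≠ 0 → K.c.Good (Sec (f ≫ s) (f ⁻¹ᵁ K.W)) t

theorem FinChart.unram [IrreducibleSpace X] {f : X ⟶ Y} {K : Chart s} (H : FinChart f K)
    {O : Y.Opens} (hO : IsFinite (f ∣_ O)) (hO' : Etale (f ∣_ O)) (h : K.W ≤ O) : Unram f K := by
  haveI := K.c.isDomain
  haveI := K.c.isPrincipalIdealRing
  haveI := H.isDomain
  haveI := H.finite
  haveI := H.torsionFree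
  haveI : Algebra.Etale (Sec s K.W) (Sec (f ≫ s) (f ⁻¹ᵁ K.W)) :=
    etale_app_of_le f hO hO' h K.affine
  exact fun t ht => K.c.good_of_etale ht

theorem exists_unramified_chart [IsIntegral X] (f : X ⟶ Y) [IsDominant f] (hs : HasCharts s)
    {w : ComplexPoint s} (hw : w.LiesIn (unbranchedLocus f)) {O : Y.Opens} (hwO : w.LiesIn O) :
    ∃ K : Chart s, w.LiesIn K.W ∧ K.W ≤ O ∧ K.W ≤ unbranchedLocus f ∧ FinChart f K ∧
      Unram f K := by
  rw [ComplexPoint.liesIn_iff, unbranchedLocus, Opens.mem_sSup] at hw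
  obtain ⟨O', ⟨h1, h2⟩, h3⟩ := hw
  obtain ⟨K, hK, hwK⟩ := hs w (O ⊓ O') ((w.liesIn_iff _).2 ⟨(w.liesIn_iff _).1 hwO, h3⟩)
  have hle : K.W ≤ O' := hK.trans inf_le_right
  have H := finChart_of_le f K h1 hle
  exact ⟨K, hwK, hK.trans inf_le_left, hle.trans (le_sSup ⟨h1, h2⟩), H, H.unram h1 h2 hle⟩

namespace FinChart

variable [IrreducibleSpace X] {f : X ⟶ Y} {K : Chart s} (H : FinChart f K)

theorem coord_map {x : ComplexPoint (f ≫ s)} (hx : x.LiesIn (f ⁻¹ᵁ K.W)) :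
    K.coord (x.map f s) = K.c.coord (x.toPoint hx) := by
  rw [Chart.coord_eq ((ComplexPoint.liesIn_map f s x K.W).2 hx)]
  exact DFunLike.congr_fun (ComplexPoint.toPoint_map f s x hx) K.c.τ

include H in
theorem eq_ofPoint {x : ComplexPoint (f ≫ s)} (hx : x.LiesIn (f ⁻¹ᵁ K.W)) :
    ComplexPoint.ofPoint H.affine (x.toPoint hx) = x :=
  ComplexPoint.toPoint_injective H.affine _ hx (ComplexPoint.toPoint_ofPoint H.affine _)

theorem map_ofPoint {z : Points (Sec (f ≫ s) (f ⁻¹ᵁ K.W))} {q : ComplexPoint s}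
    (hq : q.LiesIn K.W) (hz : K.c.coord z = K.coord q) :
    (ComplexPoint.ofPoint H.affine z).map f s = q := by
  have h := ComplexPoint.liesIn_ofPoint H.affine z
  refine Chart.eq_of_coord_eq ((ComplexPoint.liesIn_map f s _ K.W).2 h) hq ?_
  rw [coord_map h, ComplexPoint.toPoint_ofPoint, hz]

/-- A local system of sections gives sheets of the map on complex points. -/
def sheets {d : ℕ} {t₀ : ℂ} (S : LocalSystem K.c (Sec (f ≫ s) (f ⁻¹ᵁ K.W)) d t₀) :
    Sheets (ComplexPoint.map f s) (K.region S.disc) d where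
  s i q := ComplexPoint.ofPoint H.affine (S.s i (K.coord q))
  isOpen_base := K.isOpen_region S.isOpen_disc
  isOpen_preimage := (K.isOpen_region S.isOpen_disc).preimage (ComplexPoint.continuous_map f s)
  continuousOn_proj := (ComplexPoint.continuous_map f s).continuousOn
  continuousOn i := (ComplexPoint.continuous_ofPoint H.affine).comp_continuousOn
    ((S.continuousOn_s i).comp (K.continuousOn_coord.mono fun _ h => h.1) fun _ h => h.2)
  proj i q hq := H.map_ofPoint hq.1 (S.coord_s i _ hq.2)
  inj q hq i j h := S.inj _ hq.2 i j (by
    have h1 := ComplexPoint.toPoint_ofPoint H.affine (S.s i (K.coord q))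
    have h2 := ComplexPoint.toPoint_ofPoint H.affine (S.s j (K.coord q))
    simp only [h] at h1
    exact h1.symm.trans h2)
  surj x hx := by
    have hx1 : x.LiesIn (f ⁻¹ᵁ K.W) := hx.1
    have hc := coord_map hx1
    obtain ⟨i, hi⟩ := S.surj (x.toPoint hx1) (by rw [← hc]; exact hx.2)
    refine ⟨i, ?_⟩
    rw [hc, ← hi, H.eq_ofPoint hx1]
  isOpen_sheet i := by
    have h1 := (S.isOpen_sheet i).preimage (ComplexPoint.continuous_toPoint (s := f ≫ s)
      (f ⁻¹ᵁ K.W))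
    convert (ComplexPoint.isOpen_liesIn (s := f ≫ s) (f ⁻¹ᵁ K.W)).isOpenMap_subtype_val _ h1
      using 1
    ext x
    constructor
    · rintro ⟨hx, hxi⟩
      have hx1 : x.LiesIn (f ⁻¹ᵁ K.W) := hx.1
      have hc := coord_map hx1
      refine ⟨⟨x, hx1⟩, ⟨by rw [← hc]; exact hx.2, ?_⟩, rfl⟩
      obtain ⟨j, hj⟩ := S.surj (x.toPoint hx1) (by rw [← hc]; exact hx.2)
      have h2 := ComplexPoint.toPoint_ofPoint H.affine (S.s i (K.coord (x.map f s)))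
      simp only [← hxi] at h2
      rw [← hc]
      exact h2
    · rintro ⟨⟨x, hx1⟩, ⟨hx2, hxi⟩, rfl⟩
      have hc := coord_map hx1
      refine ⟨⟨hx1, by rw [hc]; exact hx2⟩, ?_⟩
      dsimp only at hxi ⊢
      rw [hc, ← hxi, H.eq_ofPoint hx1]

end FinChart

/-- A local system of sections around a point of an unramified chart. -/
theorem FinChart.exists_localSystem [IrreducibleSpace X] {f : X ⟶ Y} {K : Chart s}
    (H : FinChart f K) {t : ℂ} (ht : K.c.Good (Sec (f ≫ s) (f ⁻¹ᵁ K.W)) t) :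
    Nonempty (LocalSystem K.c (Sec (f ≫ s) (f ⁻¹ᵁ K.W)) (degree f) t) := by
  haveI := K.c.isDomain
  haveI := K.c.isPrincipalIdealRing
  haveI := H.isDomain
  haveI := H.finite
  haveI := H.torsionFree
  rw [← H.finrank_eq]
  exact ht.localSystem

/-- The map on complex points is a covering off the branch locus. -/
theorem isCoveringMapOn_map [IsIntegral X] (f : X ⟶ Y) [IsDominant f] (hs : HasCharts s) :
    IsCoveringMapOn (ComplexPoint.map f s) {w | w.LiesIn (unbranchedLocus f)} := by
  intro w hw
  obtain ⟨K, hwK, -, -, H, hK⟩ := exists_unramified_chart f hs hw hw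
  obtain ⟨S⟩ := H.exists_localSystem (hK _ (Chart.eval_g_coord hwK))
  exact ((H.sheets S).isEvenlyCovered ⟨hwK, S.center_mem⟩).to_isEvenlyCovered_preimage

/-- The fibre over an unramified point has as many elements as the degree. -/
theorem nonempty_fiber_equiv [IsIntegral X] (f : X ⟶ Y) [IsDominant f] (hs : HasCharts s)
    {w : ComplexPoint s} (hw : w.LiesIn (unbranchedLocus f)) :
    Nonempty (Fin (degree f) ≃ Fiber f w) := by
  obtain ⟨K, hwK, -, -, H, hK⟩ := exists_unramified_chart f hs hw hw
  obtain ⟨S⟩ := H.exists_localSystem (hK _ (Chart.eval_g_coord hwK))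
  exact ⟨(H.sheets S).fiberEquiv ⟨hwK, S.center_mem⟩⟩

/-- Every loop off the branch locus induces an element of the monodromy group. -/
theorem exists_mem_monodromyGroup [IsIntegral X] (f : X ⟶ Y) [IsDominant f] (hs : HasCharts s)
    {u : ComplexPoint s} (hu : u.LiesIn (unbranchedLocus f)) (γ : Path u u)
    (hγ : ∀ t, (γ t).LiesIn (unbranchedLocus f)) :
    ∃ σ ∈ monodromyGroup f u hu, InducedBy f γ σ := by
  obtain ⟨σ, hσ⟩ := exists_perm_of_loop (isCoveringMapOn_map f hs) γ hγ
  exact ⟨σ, ⟨γ, hγ, hσ⟩, hσ⟩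

/-- Two points of the fibre in an unramified chart are joined over the chart. -/
theorem exists_path_of_unram [IrreducibleSpace X] {f : X ⟶ Y} {K : Chart s} (H : FinChart f K)
    (hK : Unram f K) {x y : ComplexPoint (f ≫ s)} (hx : x.LiesIn (f ⁻¹ᵁ K.W))
    (hy : y.LiesIn (f ⁻¹ᵁ K.W)) : ∃ Γ : Path x y, ∀ t, (Γ t).LiesIn (f ⁻¹ᵁ K.W) := by
  haveI := K.c.isDomain
  haveI := K.c.isPrincipalIdealRing
  haveI := H.isDomain
  haveI := H.finite
  haveI := H.torsionFree
  obtain ⟨Γ⟩ := joined_points hK (x.toPoint hx) (y.toPoint hy)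
  refine ⟨(Γ.map (ComplexPoint.continuous_ofPoint H.affine)).cast (H.eq_ofPoint hx).symm
    (H.eq_ofPoint hy).symm, fun t => ?_⟩
  exact ComplexPoint.liesIn_ofPoint H.affine (Γ t)

/-- The monodromy group of an irreducible covering is transitive. -/
theorem isPretransitive_monodromyGroup [IsIntegral X] (f : X ⟶ Y) [IsDominant f]
    (hs : HasCharts s) {u : ComplexPoint s} (hu : u.LiesIn (unbranchedLocus f)) :
    MulAction.IsPretransitive (monodromyGroup f u hu) (Fiber f u) := by
  refine ⟨fun x y => ?_⟩
  obtain ⟨K, huK, -, hle, H, hK⟩ := exists_unramified_chart f hs hu hu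
  have hlies : ∀ x : Fiber f u, x.1.LiesIn (f ⁻¹ᵁ K.W) := fun x =>
    (ComplexPoint.liesIn_map f s x.1 K.W).1 (by rw [x.2]; exact huK)
  -- A path joining two points of the fibre projects to a loop off the branch locus, and by unique
  -- lifting the permutation of this loop carries one to the other.
  obtain ⟨Γ, hΓ⟩ := exists_path_of_unram H hK (hlies x) (hlies y)
  let γ : Path u u := (Γ.map (ComplexPoint.continuous_map f s)).cast x.2.symm y.2.symm
  have hγ : ∀ t, (γ t).LiesIn (unbranchedLocus f) := fun t =>
    ComplexPoint.LiesIn.mono ((ComplexPoint.liesIn_map f s (Γ t) K.W).2 (hΓ t)) hle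
  obtain ⟨σ, hσ, h⟩ := exists_mem_monodromyGroup f hs hu γ hγ
  refine ⟨⟨σ, hσ⟩, Subtype.ext ?_⟩
  obtain ⟨Δ, hΔ⟩ := h x
  exact path_lift_unique (isCoveringMapOn_map f hs) Δ Γ hΔ fun t => by rw [hΔ]; exact hγ t

end ChartPoints

/-! ### The intermediate ring of a decomposition -/

namespace Decomposition

variable {X Y : Scheme.{0}} {π : X ⟶ Y} (D : Decomposition π)

/-- The intermediate variety as a scheme over the target. -/
def toBase : D.V ⟶ Y := D.β ≫ D.U.ι

instance : IsDominant D.toBase := by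
  haveI := D.isDominant_β
  haveI := Opens.isDominant_ι D.dense
  exact inferInstanceAs (IsDominant (D.β ≫ D.U.ι))

theorem α_toBase : D.α ≫ D.toBase = (π ⁻¹ᵁ D.U).ι ≫ π := by
  rw [toBase, ← Category.assoc, D.fac, morphismRestrict_ι]

theorem degree_toBase : degree D.toBase = D.degβ := by
  rw [degree, toBase, residueDegree_comp, residueDegree_of_isOpenImmersion, one_mul]
  rfl

theorem degree_eq [IsIntegral X] [IsDominant π] : degree π = D.degβ * D.degα := by
  haveI := D.irreducibleSpace_preimage
  haveI := D.isDominant_α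
  have h1 : degree (D.α ≫ D.toBase) = D.degβ * D.degα := by
    rw [degree_comp, degree_toBase]
    rfl
  rw [← h1, D.α_toBase, degree, degree, residueDegree_comp,
    residueDegree_of_isOpenImmersion (π ⁻¹ᵁ D.U).ι, mul_one, genericPoint_eq_of_isOpenImmersion]

theorem finChart {s : Y ⟶ SpecC} (K : Chart s) (hK : K.W ≤ D.U) : FinChart D.toBase K := by
  haveI := D.isFinite_β
  have hU : IsAffineOpen (D.U.ι ⁻¹ᵁ K.W) :=
    K.affine.preimage_of_isOpenImmersion _ (by rwa [Scheme.Opens.opensRange_ι])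
  have hiso : IsIso (D.U.ι.app K.W) :=
    Scheme.Hom.isIso_app _ _ (by rwa [Scheme.Opens.opensRange_ι])
  refine finChart_of_finite D.toBase K (hU.preimage D.β) ?_
  have h := D.β.finite_app _ hU
  exact (RingHom.finite_respectsIso.cancel_left_isIso (D.U.ι.app K.W)
    (D.β.app (D.U.ι ⁻¹ᵁ K.W))).2 h

/-- On sections this is `α` over the chart. It lands in sections of the open subscheme over `U`,
which are identified with those of `X` since the chart lies in `U`. -/
theorem exists_ringHom [IsIntegral X] [IsDominant π] {s : Y ⟶ SpecC} (K : Chart s)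
    (hK : K.W ≤ D.U) : ∃ κ : Γ(D.V, D.toBase ⁻¹ᵁ K.W) ⟶ Γ(X, π ⁻¹ᵁ K.W),
      D.toBase.app K.W ≫ κ = π.app K.W ∧ κ.hom.Finite ∧ Function.Injective κ.hom := by
  haveI := D.isFinite_α
  haveI := D.isDominant_α
  haveI := D.irreducibleSpace_preimage
  haveI : IsIntegral (π ⁻¹ᵁ D.U).toScheme := isIntegral_of_isOpenImmersion (π ⁻¹ᵁ D.U).ι
  set j := (π ⁻¹ᵁ D.U).ι with hj
  have H := D.finChart K hK
  have hVdom := H.isDomain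
  haveI : _root_.IsReduced Γ(D.V, D.toBase ⁻¹ᵁ K.W) := by
    haveI : IsDomain Γ(D.V, D.toBase ⁻¹ᵁ K.W) := hVdom
    infer_instance
  have hjiso : IsIso (j.app (π ⁻¹ᵁ K.W)) :=
    Scheme.Hom.isIso_app _ _ ((show π ⁻¹ᵁ K.W ≤ π ⁻¹ᵁ D.U from fun x hx => hK hx).trans
      (Scheme.Opens.opensRange_ι _).ge)
  have hopens : j ⁻¹ᵁ π ⁻¹ᵁ K.W = D.α ⁻¹ᵁ D.toBase ⁻¹ᵁ K.W := by
    have := congrArg (fun k => k ⁻¹ᵁ K.W) D.α_toBase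
    exact this.symm
  have happ : D.α.appLE (D.toBase ⁻¹ᵁ K.W) (j ⁻¹ᵁ π ⁻¹ᵁ K.W) hopens.le =
      D.α.app (D.toBase ⁻¹ᵁ K.W) ≫ (π ⁻¹ᵁ D.U).toScheme.presheaf.map (eqToHom hopens).op := rfl
  refine ⟨D.α.appLE (D.toBase ⁻¹ᵁ K.W) (j ⁻¹ᵁ π ⁻¹ᵁ K.W) hopens.le ≫ inv (j.app (π ⁻¹ᵁ K.W)),
    ?_, ?_, ?_⟩
  · rw [← Category.assoc, IsIso.comp_inv_eq]
    refine (Scheme.Hom.comp_appLE D.α D.toBase K.W _ hopens.le).symm.trans ?_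
    have h2 : (j ≫ π).appLE K.W (j ⁻¹ᵁ π ⁻¹ᵁ K.W) le_rfl = π.app K.W ≫ j.app (π ⁻¹ᵁ K.W) :=
      (Scheme.Hom.comp_appLE j π K.W _ le_rfl).trans 
        (congrArg (fun k => π.app K.W ≫ k) (Scheme.Hom.appLE_eq_app (f := j) (U := π ⁻¹ᵁ K.W)))
    refine Eq.trans ?_ h2
    have h3 : ∀ (k k' : (π ⁻¹ᵁ D.U).toScheme ⟶ Y) (h : k = k') (O : (π ⁻¹ᵁ D.U).toScheme.Opens)
        (e : O ≤ k ⁻¹ᵁ K.W) (e' : O ≤ k' ⁻¹ᵁ K.W), k.appLE K.W O e = k'.appLE K.W O e' := by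
      rintro k _ rfl O e e'; rfl
    exact h3 _ _ D.α_toBase _ _ _
  · rw [CommRingCat.hom_comp, RingHom.finite_respectsIso.cancel_right_isIso, happ,
      CommRingCat.hom_comp, RingHom.finite_respectsIso.cancel_right_isIso]
    exact D.α.finite_app _ H.affine
  · rw [CommRingCat.hom_comp, RingHom.coe_comp, happ, CommRingCat.hom_comp, RingHom.coe_comp]
    exact (ConcreteCategory.bijective_of_isIso (inv (j.app (π ⁻¹ᵁ K.W)))).1.comp
      ((ConcreteCategory.bijective_of_isIso
        ((π ⁻¹ᵁ D.U).toScheme.presheaf.map (eqToHom hopens).op)).1.comp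
        (app_injective D.α H.affine))

end Decomposition

/-! ### Spectra of extensions of domains -/

section Spectra

theorem isDominant_specMap {R A : CommRingCat.{0}} (φ : R ⟶ A) (h : Function.Injective φ.hom) :
    IsDominant (Spec.map φ) := by
  refine ⟨(PrimeSpectrum.denseRange_comap_iff_ker_le_nilRadical φ.hom).2 ?_⟩
  rw [(RingHom.injective_iff_ker_eq_bot _).1 h]
  exact bot_le

theorem degree_specMap {R A : CommRingCat.{0}} [IsDomain R] [IsDomain A] (φ : R ⟶ A)
    (h : Function.Injective φ.hom) :
    degree (Spec.map φ) = @Module.finrank R A _ _ φ.hom.toAlgebra.toModule := by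
  haveI := isDominant_specMap φ h
  have hred : _root_.IsReduced Γ(Spec R, ⊤) := inferInstance
  rw [degree_eq_finrank (Spec.map φ) (isAffineOpen_top _) Set.univ_nonempty (isAffineOpen_top _)]
  letI := φ.hom.toAlgebra
  letI := ((Spec.map φ).app ⊤).hom.toAlgebra
  refine Algebra.finrank_eq_of_equiv_equiv
    (R₀ := Γ(Spec R, ⊤)) (S₀ := Γ(Spec A, (Spec.map φ) ⁻¹ᵁ ⊤)) (R₁ := R) (S₁ := A)
    (Scheme.ΓSpecIso R).commRingCatIsoToRingEquiv (Scheme.ΓSpecIso A).commRingCatIsoToRingEquiv ?_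
  have h2 := congrArg CommRingCat.Hom.hom (Scheme.ΓSpecIso_naturality φ)
  exact h2.symm

end Spectra

/-! ### From blocks to decompositions -/

/-- The hypothesis says that `a` is not a fraction of elements of `R`, so 1 and `a` are linearly
independent. -/
theorem two_le_finrank {R M : Type} [CommRing R] [IsDomain R] [CommRing M] [IsDomain M]
    [Algebra R M] [Module.Finite R M] [Module.IsTorsionFree R M] {a : M}
    (h : ∀ r s : R, s ≠ 0 → algebraMap R M s * a ≠ algebraMap R M r) :
    2 ≤ Module.finrank R M := by
  have hli : LinearIndependent R ![1, a] := by
    rw [LinearIndependent.pair_iff]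
    intro r s hrs
    have hs : s = 0 := by
      by_contra hs
      refine h (-r) s hs ?_
      rw [Algebra.smul_def, Algebra.smul_def, mul_one] at hrs
      rw [map_neg]
      linear_combination hrs
    rw [hs, zero_smul, add_zero, Algebra.smul_def, mul_one] at hrs
    refine ⟨?_, hs⟩
    exact (map_eq_zero_iff _ (Module.isTorsionFree_iff_algebraMap_injective.1 inferInstance)).1 hrs
  simpa using hli.fintype_card_le_finrank

theorem two_le_finrank_adjoin {R A : Type} [CommRing R] [IsDomain R]
    [IsPrincipalIdealRing R] [CommRing A] [IsDomain A] [Algebra R A] [Module.Finite R A] [Module.IsTorsionFree R A] {h a : A}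
    (h1 : ∀ r s : R, s ≠ 0 → algebraMap R A s * h ≠ algebraMap R A r)
    (h2 : ∀ s : R, s ≠ 0 → algebraMap R A s * a ∉ Algebra.adjoin R {h}) :
    Module.Finite R (Algebra.adjoin R {h}) ∧ Module.Finite (Algebra.adjoin R {h}) A ∧
    2 ≤ Module.finrank R (Algebra.adjoin R {h}) ∧ 2 ≤ Module.finrank (Algebra.adjoin R {h}) A := by
  have hinj : Function.Injective (algebraMap R A) :=
    Module.isTorsionFree_iff_algebraMap_injective.1 inferInstance
  have f1 : Module.Finite R (Algebra.adjoin R {h}) :=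
    inferInstanceAs (Module.Finite R (Subalgebra.toSubmodule (Algebra.adjoin R {h})))
  have f2 : Module.Finite (Algebra.adjoin R {h}) A := Module.Finite.of_restrictScalars_finite R _ _
  haveI t1 : Module.IsTorsionFree R (Algebra.adjoin R {h}) :=
    Module.isTorsionFree_iff_algebraMap_injective.2 fun r s hrs => hinj (congrArg Subtype.val hrs)
  haveI t2 : Module.IsTorsionFree (Algebra.adjoin R {h}) A :=
    Module.isTorsionFree_iff_algebraMap_injective.2 Subtype.val_injective
  refine ⟨f1, f2, two_le_finrank (a := ⟨h, Algebra.self_mem_adjoin_singleton R h⟩)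
    fun r s hs hrs => h1 r s hs (congrArg Subtype.val hrs),
    two_le_finrank (a := a) fun d s hs hds => ?_⟩
  -- A denominator in `R[h]` divides a nonzero element of `R`, so it may be replaced by an element
  -- of `R`, to which `h2` applies.
  obtain ⟨r, hr, s', hss⟩ := (Algebra.IsIntegral.isIntegral (R := R)
    s).isAlgebraic.exists_nonzero_dvd (mem_nonZeroDivisors_of_ne_zero hs)
  refine h2 r hr ?_
  have h3 : algebraMap R A r = s * s' := congrArg Subtype.val hss
  have h4 : (s : A) * a = d := hds
  rw [h3, mul_comm (s : A), mul_assoc, h4]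
  exact (s' * d).2

theorem exists_decomposition {X Y : Scheme.{0}} [IsIntegral X] (π : X ⟶ Y) [IsDominant π]
    {W : Y.Opens} (hW : IsAffineOpen W) (hne : (W : Set Y).Nonempty)
    (hW' : IsAffineOpen (π ⁻¹ᵁ W)) {D : CommRingCat.{0}} [IsDomain D] [IsDomain Γ(Y, W)]
    [IsDomain Γ(X, π ⁻¹ᵁ W)] (φ : Γ(Y, W) ⟶ D) (ψ : D ⟶ Γ(X, π ⁻¹ᵁ W)) (hc : φ ≫ ψ = π.app W)
    (hφ : φ.hom.Finite) (hψ : ψ.hom.Finite) (iφ : Function.Injective φ.hom)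
    (iψ : Function.Injective ψ.hom) :
    ∃ 𝒟 : Decomposition π,
      𝒟.degα = @Module.finrank D Γ(X, π ⁻¹ᵁ W) _ _ ψ.hom.toAlgebra.toModule ∧
      𝒟.degβ = @Module.finrank Γ(Y, W) D _ _ φ.hom.toAlgebra.toModule := by
  haveI := isDominant_specMap φ iφ
  haveI := isDominant_specMap ψ iψ
  haveI : IsFinite (Spec.map φ) := (IsFinite.SpecMap_iff φ).2 hφ
  haveI : IsFinite (Spec.map ψ) := (IsFinite.SpecMap_iff ψ).2 hψ
  have fac : (hW'.isoSpec.hom ≫ Spec.map ψ) ≫ Spec.map φ ≫ hW.isoSpec.inv = π ∣_ W := by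
    rw [← cancel_mono W.ι, morphismRestrict_ι]
    simp only [Category.assoc]
    rw [IsAffineOpen.isoSpec_inv_ι, ← Spec.map_comp_assoc, hc, Scheme.Hom.app_eq_appLE,
      IsAffineOpen.SpecMap_appLE_fromSpec π hW hW' le_rfl]
    rw [← Category.assoc, IsAffineOpen.isoSpec_hom_fromSpec]
  let 𝒟 : Decomposition π :=
    { U := W
      dense := by
        rw [dense_iff_inter_open]
        intro O hO hOne
        -- Every nonempty open subset of `Y` contains the image of the generic point of `X`, and so
        -- does `W`.
        obtain ⟨x, hx⟩ := π.denseRange.exists_mem_open hO hOne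
        have h1 : genericPoint X ∈ π ⁻¹ᵁ ⟨O, hO⟩ := genericPoint_mem ⟨x, hx⟩
        exact ⟨π (genericPoint X), h1, map_genericPoint_mem π hne⟩
      V := Spec D
      isIntegral := inferInstance
      α := hW'.isoSpec.hom ≫ Spec.map ψ
      β := Spec.map φ ≫ hW.isoSpec.inv
      isFinite_α := inferInstance
      isFinite_β := inferInstance
      isDominant_α := inferInstance
      isDominant_β := inferInstance
      fac := fac }
  refine ⟨𝒟, ?_, ?_⟩
  · haveI := 𝒟.irreducibleSpace_preimage
    haveI : IrreducibleSpace (π ⁻¹ᵁ W).toScheme := this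
    rw [← degree_specMap ψ iψ]
    have h1 : 𝒟.degα = degree (hW'.isoSpec.hom ≫ Spec.map ψ) := rfl
    rw [h1, degree_comp, degree, degree,
      residueDegree_of_isOpenImmersion hW'.isoSpec.hom, mul_one]
  · rw [← degree_specMap φ iφ]
    have h1 : 𝒟.degβ = degree (Spec.map φ ≫ hW.isoSpec.inv) := rfl
    rw [h1, degree, residueDegree_comp, residueDegree_of_isOpenImmersion hW.isoSpec.inv, one_mul]
    rfl

theorem isDecomposable_of_isImprimitive {X Y : Scheme.{0}} [IsIntegral X] (π : X ⟶ Y)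
    [IsDominant π] {s : Y ⟶ SpecC} (hs : HasCharts s) {u : ComplexPoint s}
    (hu : u.LiesIn (unbranchedLocus π))
    (h : IsImprimitive (monodromyGroup π u hu) (Fiber π u)) : IsDecomposable π := by
  obtain ⟨-, B, hblock, htriv⟩ := h
  rw [MulAction.IsTrivialBlock, not_or] at htriv
  obtain ⟨x₁, hx₁, x₂, hx₂, hne⟩ := Set.not_subsingleton_iff.1 htriv.1
  obtain ⟨y, hy⟩ := (Set.ne_univ_iff_exists_notMem B).1 htriv.2
  obtain ⟨K, huK, -, hle, H, hK⟩ := exists_unramified_chart π hs hu hu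
  haveI := K.c.isDomain
  haveI := K.c.isPrincipalIdealRing
  haveI := H.isDomain
  haveI := H.finite
  haveI := H.torsionFree
  have hlies : ∀ x : Fiber π u, x.1.LiesIn (π ⁻¹ᵁ K.W) := fun x =>
    (ComplexPoint.liesIn_map π s x.1 K.W).1 (by rw [x.2]; exact huK)
  have hcoord : ∀ x : Fiber π u, K.c.coord (x.1.toPoint (hlies x)) = K.coord u := fun x => by
    rw [← FinChart.coord_map, x.2]
  let B' : Set (Points (Sec (π ≫ s) (π ⁻¹ᵁ K.W))) :=
    {z | ∃ x ∈ B, x.1 = ComplexPoint.ofPoint H.affine z}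
  have hB' : ∀ x : Fiber π u, x.1.toPoint (hlies x) ∈ B' ↔ x ∈ B := by
    intro x
    constructor
    · rintro ⟨x', hx', h⟩
      rw [H.eq_ofPoint] at h
      rwa [← Subtype.ext h]
    · exact fun hx => ⟨x, hx, (H.eq_ofPoint _).symm⟩
  have hinj : ∀ x x' : Fiber π u, x.1.toPoint (hlies x) = x'.1.toPoint (hlies x') → x = x' :=
    fun x x' h => Subtype.ext (ComplexPoint.toPoint_injective H.affine _ _ h)
  have hBu : ∀ z ∈ B', K.c.coord z = K.coord u := by
    rintro z ⟨x, hx, h⟩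
    have h2 := ComplexPoint.liesIn_ofPoint H.affine z
    rw [← x.2, h, FinChart.coord_map h2, ComplexPoint.toPoint_ofPoint]
  obtain ⟨h, h1, a, h2⟩ := exists_intermediate hK (Chart.eval_g_coord huK) hBu
    ((hB' x₁).2 hx₁) ((hB' x₂).2 hx₂) (fun h => hne (hinj _ _ h)) (fun h => hy ((hB' y).1 h))
    (hcoord y) (by
      -- The path `Γ` projects to a loop with permutation `σ`, which sends a point of `B` into `B`;
      -- the block property gives `σ B = B`. The parallel path `Γ'` lifts the same loop, so its end
      -- is the image under `σ` of a point of `B`.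
      rintro x x' z z' Γ Γ' ⟨x₀, hx₀, hx⟩ ⟨x₀', hx₀', hx'⟩ ⟨z₀, hz₀, hz⟩ hΓ
      have hz'u : (ComplexPoint.ofPoint H.affine z').map π s = u := by
        refine H.map_ofPoint huK ?_
        have h1 := hΓ 1
        rw [Γ.target, Γ'.target] at h1
        rw [← h1, hBu z ⟨z₀, hz₀, hz⟩]
      let Δ : Path x₀.1 z₀.1 := (Γ.map (ComplexPoint.continuous_ofPoint H.affine)).cast hx hz
      let Δ' : Path x₀'.1 (ComplexPoint.ofPoint H.affine z') :=
        (Γ'.map (ComplexPoint.continuous_ofPoint H.affine)).cast hx' rfl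
      have hΔΔ : ∀ t, (Δ t).map π s = (Δ' t).map π s := by
        intro t
        have hl := ComplexPoint.liesIn_ofPoint H.affine (Γ' t)
        refine H.map_ofPoint ((ComplexPoint.liesIn_map π s _ K.W).2 hl) ?_
        change K.c.coord (Γ t) = K.coord ((ComplexPoint.ofPoint H.affine (Γ' t)).map π s)
        rw [FinChart.coord_map hl, ComplexPoint.toPoint_ofPoint, hΓ]
      have hΔ : ∀ t, ((Δ t).map π s).LiesIn (unbranchedLocus π) := fun t =>
        ComplexPoint.LiesIn.mono ((ComplexPoint.liesIn_map π s (Δ t) K.W).2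
          (ComplexPoint.liesIn_ofPoint H.affine (Γ t))) hle
      let γ : Path u u := (Δ.map (ComplexPoint.continuous_map π s)).cast x₀.2.symm z₀.2.symm
      obtain ⟨σ, hσ, hγσ⟩ := exists_mem_monodromyGroup π hs hu γ hΔ
      have hcov := isCoveringMapOn_map π hs
      have hz₀σ : σ x₀ = z₀ := by
        obtain ⟨Ξ, hΞ⟩ := hγσ x₀
        exact Subtype.ext (path_lift_unique hcov Ξ Δ hΞ fun t => by rw [hΞ]; exact hΔ t)
      have hz'σ : σ x₀' = ⟨_, hz'u⟩ := by
        obtain ⟨Ξ, hΞ⟩ := hγσ x₀'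
        exact Subtype.ext (path_lift_unique hcov Ξ Δ' (fun t => (hΞ t).trans (hΔΔ t))
          fun t => by rw [hΞ]; exact hΔ t)
      refine ⟨_, ?_, (rfl : (⟨_, hz'u⟩ : Fiber π u).1 = _)⟩
      rw [← hz'σ]
      rcases hblock.smul_eq_or_disjoint (⟨σ, hσ⟩ : monodromyGroup π u hu) with h | h
      · rw [← h]
        exact ⟨x₀', hx₀', rfl⟩
      · exact (Set.disjoint_left.1 h ⟨x₀, hx₀, rfl⟩ (by
          change σ x₀ ∈ B
          rw [hz₀σ]; exact hz₀)).elim)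
  obtain ⟨f1, f2, d1, d2⟩ := two_le_finrank_adjoin h1 h2
  haveI : IsDomain Γ(Y, K.W) := K.c.isDomain
  haveI : IsDomain Γ(X, π ⁻¹ᵁ K.W) := H.isDomain
  obtain ⟨𝒟, hα, hβ⟩ := exists_decomposition π K.affine K.nonempty H.affine
    (D := .of (Algebra.adjoin (Sec s K.W) {h}))
    (CommRingCat.ofHom (algebraMap (Sec s K.W) (Algebra.adjoin (Sec s K.W) {h})))
    (CommRingCat.ofHom (algebraMap (Algebra.adjoin (Sec s K.W) {h})
      (Sec (π ≫ s) (π ⁻¹ᵁ K.W)))) rfl ((RingHom.finite_algebraMap).2 f1)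
    ((RingHom.finite_algebraMap).2 f2) (fun r r' hr => by
      exact Module.isTorsionFree_iff_algebraMap_injective.1 H.torsionFree (congrArg Subtype.val hr))
    Subtype.val_injective
  refine ⟨𝒟, ?_, ?_⟩
  · rw [hα]
    refine d2.trans (le_of_eq ?_)
    congr 1
  · rw [hβ]
    refine d1.trans (le_of_eq ?_)
    congr 1

open Filter Topology

/-! ### The relation cut out by an intermediate algebra -/

/-- The exponential maps a half plane onto the punctured disc. -/
theorem isPreconnected_ball_diff_singleton (t : ℂ) {ε : ℝ} (hε : 0 < ε) :
    IsPreconnected (Metric.ball t ε \ {t}) := by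
  have h := (convex_halfSpace_re_lt (Real.log ε)).isPreconnected.image
    (fun z : ℂ => t + Complex.exp z) (by fun_prop)
  convert h using 1
  ext z
  rw [Set.mem_sdiff, mem_ball_iff_norm, Set.mem_singleton_iff]
  constructor
  · rintro ⟨h1, h2⟩
    have h3 : z - t ≠ 0 := sub_ne_zero.2 h2
    refine ⟨Complex.log (z - t), ?_, ?_⟩
    · rw [Set.mem_ofPred_eq, Complex.log_re]
      exact Real.log_lt_log (norm_pos_iff.2 h3) h1
    · simp only [Complex.exp_log h3]
      ring
  · rintro ⟨y, hy, rfl⟩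
    rw [Set.mem_ofPred_eq] at hy
    refine ⟨?_, by simp⟩
    rw [add_sub_cancel_left, Complex.norm_exp]
    exact (Real.lt_log_iff_exp_lt hε).1 hy

section Algebra

variable {R : Type} [CommRing R] [Algebra ℂ R] {c : LineCoord R}
  {D : Type} [CommRing D] [Algebra ℂ D] [Algebra R D] [IsScalarTower ℂ R D]
  [IsDomain R] [IsPrincipalIdealRing R] [IsDomain D] [Module.Finite R D] [Module.IsTorsionFree R D]

/-- Lifts of a map of a connected space to points off the ramification agree if they agree
somewhere. -/
theorem eq_of_coord_eq_of_good {B : Type} [TopologicalSpace B] [PreconnectedSpace B]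
    {F F' : B → Points D} (hF : Continuous F) (hF' : Continuous F')
    (h : ∀ b, c.coord (F b) = c.coord (F' b)) (hgood : ∀ b, c.Good D (c.coord (F b))) {b₀ : B}
    (h₀ : F b₀ = F' b₀) : F = F' := by
  have hclopen : IsClopen {b | F b = F' b} := by
    refine ⟨isClosed_eq hF hF', isOpen_iff_mem_nhds.2 fun b hb => ?_⟩
    obtain ⟨S⟩ := (hgood b).localSystem
    obtain ⟨i, hi⟩ := S.surj (F b) S.center_mem
    have hb' : F b = F' b := hb
    have h1 := (S.isOpen_sheet i).mem_nhds ⟨S.center_mem, hi⟩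
    have h2 : {x : Points D | c.coord x ∈ S.disc ∧ x = S.s i (c.coord x)} ∈ 𝓝 (F' b) := by
      rw [← hb']
      exact h1
    filter_upwards [hF.continuousAt.preimage_mem_nhds h1, hF'.continuousAt.preimage_mem_nhds h2]
      with b' hb1 hb2
    exact hb1.2.trans ((congrArg (S.s i) (h b')).trans hb2.2.symm)
  have := hclopen.eq_univ ⟨b₀, h₀⟩
  exact funext fun b => this.ge (Set.mem_univ b)

/-- Points lift along finite injective maps of algebras. -/
theorem exists_point_comp_eq (c : LineCoord R) {A : Type} [CommRing A] [Algebra ℂ A]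
    [Algebra R A] [IsScalarTower ℂ R A] [IsDomain A] [Module.Finite R A]
    [Module.IsTorsionFree R A] (κ : D →ₐ[ℂ] A)
    (hfin : (κ : D →+* A).Finite) (hinj : Function.Injective κ) (y : Points D) :
    ∃ x : Points A, x.comp κ = y := by
  letI := (κ : D →+* A).toAlgebra
  haveI : Module.Finite D A := hfin
  haveI : IsScalarTower ℂ D A := IsScalarTower.of_algebraMap_eq fun z => (κ.commutes z).symm
  haveI := c.finiteType
  have hy : Function.Surjective y := fun z => ⟨algebraMap ℂ D z, y.commutes z⟩
  haveI : (RingHom.ker (y : D →+* ℂ)).IsMaximal := RingHom.ker_isMaximal_of_surjective _ hy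
  obtain ⟨M, hM, hcomap⟩ := Ideal.exists_ideal_over_maximal_of_isIntegral (S := A)
    (RingHom.ker (y : D →+* ℂ)) (by
      have h2 : Function.Injective (algebraMap D A) := hinj
      rw [(RingHom.injective_iff_ker_eq_bot _).1 h2]
      exact bot_le)
  obtain ⟨x, hx⟩ := exists_point_of_isMaximal (R := R) M
  refine ⟨x, AlgHom.ext fun a => ?_⟩
  have h1 : a - algebraMap ℂ D (y a) ∈ RingHom.ker (y : D →+* ℂ) := by
    rw [RingHom.mem_ker]
    change y (a - algebraMap ℂ D (y a)) = 0
    rw [map_sub, y.commutes]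
    exact sub_self _
  rw [← hcomap, Ideal.mem_comap, ← hx] at h1
  have h2 : x (κ (a - algebraMap ℂ D (y a))) = 0 := h1
  rw [map_sub, map_sub, κ.commutes, x.commutes, sub_eq_zero] at h2
  exact h2

end Algebra

/-! ### Fibres of the intermediate map as a relation on the fibres of `π`. -/

section Relation

variable {X Y : Scheme.{0}} {s : Y ⟶ SpecC}

/-- The points of a chart off a finite set lie in a given open subset meeting the chart. -/
theorem Chart.exists_polynomial_liesIn (K : Chart s) {O : Y.Opens}
    (h : ((K.W ⊓ O : Y.Opens) : Set Y).Nonempty) :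
    ∃ p : Polynomial ℂ, p ≠ 0 ∧
      ∀ q : ComplexPoint s, q.LiesIn K.W → p.eval (K.coord q) ≠ 0 → q.LiesIn O := by
  obtain ⟨y, hyK, hyO⟩ := h
  obtain ⟨r, hrO, hyr⟩ := K.affine.exists_basicOpen_le ⟨y, hyO⟩ hyK
  have hr : r ≠ 0 := by
    rintro rfl
    rw [Scheme.basicOpen_zero] at hyr
    exact hyr
  obtain ⟨p, hp, hpr⟩ := K.c.exists_polynomial_of_ne_zero (r := (r : Sec s K.W)) hr
  refine ⟨p, hp, fun q hq hpq => ?_⟩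
  refine ComplexPoint.LiesIn.mono ((q.liesIn_basicOpen hq r).2 ?_) hrO
  rw [← ComplexPoint.toPoint_apply]
  have h1 := K.c.apply_eq_val (q.toPoint hq) r
  rw [← Chart.coord_eq hq] at h1
  rw [h1]
  exact hpr _ (Chart.eval_g_coord hq) hpq

theorem meet_nonempty [IsIntegral X] (π : X ⟶ Y) [IsDominant π] {U V : Y.Opens}
    (hU : (U : Set Y).Nonempty) (hV : (V : Set Y).Nonempty) :
    ((U ⊓ V : Y.Opens) : Set Y).Nonempty :=
  ⟨_, map_genericPoint_mem π hU, map_genericPoint_mem π hV⟩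

variable {π : X ⟶ Y} {K₀ : Chart s}
  {D : Type} [CommRing D] [Algebra ℂ D] [Algebra (Sec s K₀.W) D] [IsScalarTower ℂ (Sec s K₀.W) D]
  (κ : D →ₐ[ℂ] Sec (π ≫ s) (π ⁻¹ᵁ K₀.W))

/-- Two points over the chart have the same image in the points of the intermediate algebra, away
from its ramification. -/
def SameImage (x y : ComplexPoint (π ≫ s)) : Prop :=
  K₀.c.Good D (K₀.coord (x.map π s)) ∧
    ∃ (hx : x.LiesIn (π ⁻¹ᵁ K₀.W)) (hy : y.LiesIn (π ⁻¹ᵁ K₀.W)),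
      (x.toPoint hx).comp κ = (y.toPoint hy).comp κ

variable {κ} (hκ : ∀ r, κ (algebraMap (Sec s K₀.W) D r) = algebraMap (Sec s K₀.W) _ r)

include hκ in
theorem coord_comp [IrreducibleSpace X] {x : ComplexPoint (π ≫ s)} (hx : x.LiesIn (π ⁻¹ᵁ K₀.W)) :
    K₀.c.coord ((x.toPoint hx).comp κ) = K₀.coord (x.map π s) := by
  rw [FinChart.coord_map hx]
  exact congrArg (x.toPoint hx) (hκ _)

theorem continuous_toPoint_comp (κ : D →ₐ[ℂ] Sec (π ≫ s) (π ⁻¹ᵁ K₀.W)) {B : Type}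
    [TopologicalSpace B] {G : B → ComplexPoint (π ≫ s)} (hG : Continuous G)
    (h : ∀ b, (G b).LiesIn (π ⁻¹ᵁ K₀.W)) :
    Continuous fun b => (((G b).toPoint (h b)).comp κ : Points D) := by
  refine Points.continuous_iff.2 fun a => ?_
  exact (Points.continuous_apply (κ a)).comp
    ((ComplexPoint.continuous_toPoint (s := π ≫ s) (π ⁻¹ᵁ K₀.W)).comp (hG.subtype_mk h))

/-- Only finitely many coordinates in `K` belong to points outside `K₀` or to bad points for `D`. A
small punctured disc avoids them; its centre may be one of them. -/
theorem exists_disc [IsIntegral X] [IsDominant π] [IsDomain (Sec s K₀.W)]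
    [IsPrincipalIdealRing (Sec s K₀.W)] [IsDomain D]
    [Module.Finite (Sec s K₀.W) D] [Module.IsTorsionFree (Sec s K₀.W) D] (K : Chart s)
    (t : ℂ) {ε : ℝ} (hε : 0 < ε) :
    ∃ δ, 0 < δ ∧ δ ≤ ε ∧ ∀ q : ComplexPoint s, q.LiesIn K.W →
      K.coord q ∈ Metric.ball t δ \ {t} → q.LiesIn K₀.W ∧ K₀.c.Good D (K₀.coord q) := by
  obtain ⟨p, hp, hgood⟩ := K₀.c.exists_polynomial_good (A := D)
  -- The basic open set of `p(τ)` lies in `K₀` and consists of good points, so one nonvanishing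
  -- condition covers both requirements.
  let f : Γ(Y, K₀.W) := Polynomial.aeval K₀.c.τ p
  have hf : f ≠ 0 := fun h => hp (K₀.c.inj (h.trans (map_zero _).symm))
  haveI := K₀.isReduced
  obtain ⟨p₁, hp₁, h1⟩ := K.exists_polynomial_liesIn
    (meet_nonempty π K.nonempty (basicOpen_nonempty K₀.affine hf))
  obtain ⟨δ, hδ, hball⟩ := Metric.mem_nhdsWithin_iff.1 (eventually_eval_ne_zero hp₁ t)
  refine ⟨min δ ε, lt_min hδ hε, min_le_right _ _, fun q hq hqt => ?_⟩
  have h2 := h1 q hq (hball ⟨Metric.ball_subset_ball (min_le_left _ _) hqt.1, hqt.2⟩)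
  have h3 : q.LiesIn K₀.W := h2.mono (Y.basicOpen_le f)
  refine ⟨h3, hgood _ (Chart.eval_g_coord h3) ?_⟩
  have h4 := (q.liesIn_basicOpen h3 f).1 h2
  rw [← ComplexPoint.toPoint_apply] at h4
  rw [Chart.coord_eq h3, ← K₀.c.apply_aeval]
  exact h4

-- The chart `K` around `w` makes `π` a covering; the fixed chart `K₀`, which carries `D`, need not
-- contain `w`. Over the punctured disc the images of two sections in the points of `D` lift the
-- same map off the ramification, so they agree everywhere or nowhere. The labels `q` are read off
-- over one point `b₀`, and all occur because points lift along `κ`.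
include hκ in
theorem exists_relSheets [IsIntegral X] [IsDominant π] (hs : HasCharts s) (H₀ : FinChart π K₀)
    [IsDomain D] [Module.Finite (Sec s K₀.W) D] [Module.IsTorsionFree (Sec s K₀.W) D]
    (hfin : (κ : D →+* Sec (π ≫ s) (π ⁻¹ᵁ K₀.W)).Finite) (hinj : Function.Injective κ)
    {w : ComplexPoint s} (hw : w.LiesIn (unbranchedLocus π)) :
    ∃ (S : RelSheets (ComplexPoint.map π s) (SameImage κ) w (degree π))
      (q : Fin (degree π) → Fin (Module.finrank (Sec s K₀.W) D)),
      Function.Surjective q ∧ ∀ i j, S.P i j ↔ q i = q j := by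
  haveI := K₀.c.isDomain
  haveI := K₀.c.isPrincipalIdealRing
  haveI := H₀.isDomain
  haveI := H₀.finite
  haveI := H₀.torsionFree
  obtain ⟨K, hwK, -, -, H, hK⟩ := exists_unramified_chart π hs hw hw
  obtain ⟨S⟩ := H.exists_localSystem (hK _ (Chart.eval_g_coord hwK))
  obtain ⟨δ, hδ, hδS, hδK⟩ := exists_disc (π := π) (K₀ := K₀) (D := D) K (K.coord w) S.pos
  have hsub : K.region (Metric.ball (K.coord w) δ) ⊆ K.region S.disc := fun q hq =>
    ⟨hq.1, Metric.ball_subset_ball hδS hq.2⟩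
  obtain ⟨T⟩ : Nonempty (Sheets (ComplexPoint.map π s) (K.region (Metric.ball (K.coord w) δ))
    (degree π)) := ⟨(H.sheets S).restrict (K.isOpen_region Metric.isOpen_ball) hsub⟩
  set N := K.region (Metric.ball (K.coord w) δ) with hN
  have hwN : w ∈ N := ⟨hwK, Metric.mem_ball_self hδ⟩
  have hdiff : N \ {w} = K.region (Metric.ball (K.coord w) δ \ {K.coord w}) := by
    ext q
    constructor
    · rintro ⟨⟨h1, h2⟩, h3⟩
      exact ⟨h1, h2, fun h => h3 (Chart.eq_of_coord_eq h1 hwK h)⟩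
    · rintro ⟨h1, h2, h3⟩
      exact ⟨⟨h1, h2⟩, fun h => h3 (congrArg K.coord h)⟩
  have hgd : ∀ b ∈ N \ {w}, b.LiesIn K₀.W ∧ K₀.c.Good D (K₀.coord b) := fun b hb => by
    rw [hdiff] at hb
    exact hδK b hb.1 hb.2
  have hopen : IsOpen (N \ {w}) := by
    rw [hdiff]
    exact K.isOpen_region (Metric.isOpen_ball.sdiff isClosed_singleton)
  have hneBot : ∀ b ∈ N, (𝓝[≠] b).NeBot := fun b hb => K.neBot_nhds hb.1
  have hpre : IsPreconnected (N \ {w}) := by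
    rw [hdiff]
    exact K.isPreconnected_region (isPreconnected_ball_diff_singleton _ hδ) fun t ht =>
      S.sub t (Metric.ball_subset_ball hδS ht.1)
  haveI : PreconnectedSpace ↥(N \ {w}) := isPreconnected_iff_preconnectedSpace.1 hpre
  have hTproj : ∀ i, ∀ b ∈ N, (T.s i b).map π s = b := T.proj
  have hlies : ∀ i, ∀ b ∈ N \ {w}, (T.s i b).LiesIn (π ⁻¹ᵁ K₀.W) := fun i b hb =>
    (ComplexPoint.liesIn_map π s _ K₀.W).1 (by rw [hTproj i b hb.1]; exact (hgd b hb).1)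
  let F : Fin (degree π) → ↥(N \ {w}) → Points D := fun i b =>
    ((T.s i b.1).toPoint (hlies i b.1 b.2)).comp κ
  have hFc : ∀ i, Continuous (F i) := fun i => by
    have h1 : Continuous fun b : ↥(N \ {w}) => T.s i b.1 :=
      ((T.continuousOn i).mono Set.sdiff_subset).comp_continuous continuous_subtype_val
        fun b => b.2
    exact continuous_toPoint_comp κ h1 fun b => hlies i b.1 b.2
  have hFcoord : ∀ i b, K₀.c.coord (F i b) = K₀.coord b.1 := fun i b => by
    rw [coord_comp hκ, hTproj i b.1 b.2.1]
  have hrel : ∀ i j, ∀ b : ↥(N \ {w}),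
      SameImage κ (T.s i b.1) (T.s j b.1) ↔ F i b = F j b := by
    intro i j b
    constructor
    · rintro ⟨-, hx, hy, h⟩
      exact h
    · intro h
      refine ⟨?_, hlies i b.1 b.2, hlies j b.1 b.2, h⟩
      rw [hTproj i b.1 b.2.1]
      exact (hgd b.1 b.2).2
  have hconst : ∀ i j, ∀ b b' : ↥(N \ {w}), F i b = F j b → F i b' = F j b' := by
    intro i j b b' h
    refine congrFun (eq_of_coord_eq_of_good (c := K₀.c) (hFc i) (hFc j)
      (fun b => by rw [hFcoord, hFcoord]) (fun b => ?_) h) b'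
    rw [hFcoord]
    exact (hgd b.1 b.2).2
  obtain ⟨b₀, hb₀⟩ : ∃ b, b ∈ N \ {w} := by
    haveI := hneBot w hwN
    have h : ∀ᶠ b in 𝓝[≠] w, b ∈ N \ {w} := by
      filter_upwards [nhdsWithin_le_nhds ((K.isOpen_region Metric.isOpen_ball).mem_nhds hwN),
        self_mem_nhdsWithin] with b' h1 h2 using ⟨h1, h2⟩
    exact h.exists
  let b₁ : ↥(N \ {w}) := ⟨b₀, hb₀⟩
  obtain ⟨E⟩ := ((hgd b₀ hb₀).2).localSystem
  have hE : ∀ i, ∃ k, F i b₁ = E.s k (K₀.coord b₀) := fun i => by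
    have := E.surj (F i b₁) (by rw [hFcoord]; exact E.center_mem)
    rwa [hFcoord] at this
  choose q hq using hE
  refine ⟨⟨N, hwN, T, hopen, hneBot, fun i j => F i b₁ = F j b₁, fun i j b hb => ?_⟩, q, ?_, ?_⟩
  · rw [hrel i j ⟨b, hb⟩]
    exact ⟨hconst i j _ _, hconst i j _ _⟩
  · intro k
    obtain ⟨x, hx⟩ := exists_point_comp_eq K₀.c κ hfin hinj (E.s k (K₀.coord b₀))
    have hl := ComplexPoint.liesIn_ofPoint H₀.affine x
    have hxb : (ComplexPoint.ofPoint H₀.affine x).map π s = b₀ := by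
      refine H₀.map_ofPoint (hgd b₀ hb₀).1 ?_
      have h1 := coord_comp hκ hl
      rw [FinChart.coord_map hl, ComplexPoint.toPoint_ofPoint, hx,
        E.coord_s k _ E.center_mem] at h1
      exact h1.symm
    obtain ⟨i, hi⟩ := T.surj (ComplexPoint.ofPoint H₀.affine x) (by rw [hxb]; exact hb₀.1)
    rw [hxb] at hi
    refine ⟨i, E.inj _ E.center_mem _ _ ?_⟩
    rw [← hq i, ← hx]
    have h2 : ∀ z (hz : z.LiesIn (π ⁻¹ᵁ K₀.W)), z = ComplexPoint.ofPoint H₀.affine x →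
        z.toPoint hz = x := by
      rintro z hz rfl
      exact ComplexPoint.toPoint_ofPoint H₀.affine x
    exact congrArg (fun z => AlgHom.comp z κ) (h2 _ (hlies i b₀ hb₀) hi.symm)
  · intro i j
    constructor
    · intro h
      refine E.inj _ E.center_mem _ _ ?_
      rw [← hq i, ← hq j]
      exact h
    · intro h
      change F i b₁ = F j b₁
      rw [hq i, hq j, h]

end Relation

/-- A decomposition gives an invariant map from the fibre onto a set of `deg β` elements. -/
theorem exists_blockMap {X Y : Scheme.{0}} [IsIntegral X] (π : X ⟶ Y) [IsDominant π]
    {s : Y ⟶ SpecC} (hs : HasCharts s) {u : ComplexPoint s} (hu : u.LiesIn (unbranchedLocus π))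
    (𝒟 : Decomposition π) :
    ∃ Q : Fiber π u → Fin 𝒟.degβ, Function.Surjective Q ∧
      ∀ σ ∈ monodromyGroup π u hu, ∀ x y, Q x = Q y ↔ Q (σ x) = Q (σ y) := by
  -- This chart is chosen without regard to `u`, which need not lie over `𝒟.U`.
  obtain ⟨K₀, hK₀⟩ : ∃ K₀ : Chart s, K₀.W ≤ 𝒟.U := by
    obtain ⟨K, -, -, -, -, -⟩ := exists_unramified_chart π hs hu hu
    haveI : Nonempty Y := ⟨π (genericPoint X)⟩
    obtain ⟨p, hp, h⟩ := K.exists_polynomial_liesIn (meet_nonempty π K.nonempty 𝒟.dense.nonempty)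
    obtain ⟨t, ht⟩ := Polynomial.exists_eval_ne_zero_of_natDegree_lt_card (p * K.c.g)
      (mul_ne_zero hp K.c.g_ne_zero) ((Cardinal.natCast_lt_aleph0).trans_le
        (Cardinal.aleph0_le_mk ℂ))
    rw [Polynomial.eval_mul] at ht
    obtain ⟨q, hqK, hq⟩ := K.exists_coord_eq (right_ne_zero_of_mul ht)
    obtain ⟨K₀, hK₀, -⟩ := hs q 𝒟.U (h q hqK (by rw [hq]; exact left_ne_zero_of_mul ht))
    exact ⟨K₀, hK₀⟩
  have H₁ := 𝒟.finChart K₀ hK₀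
  obtain ⟨κ₀, hκ₀, hfin, hinj⟩ := 𝒟.exists_ringHom K₀ hK₀
  haveI := K₀.c.isDomain
  haveI := H₁.isDomain
  haveI := H₁.finite
  haveI := H₁.torsionFree
  have hκr : ∀ r : Sec s K₀.W, κ₀.hom (algebraMap (Sec s K₀.W)
      (Sec (𝒟.toBase ≫ s) (𝒟.toBase ⁻¹ᵁ K₀.W)) r) =
      algebraMap (Sec s K₀.W) (Sec (π ≫ s) (π ⁻¹ᵁ K₀.W)) r := fun r =>
    ConcreteCategory.congr_hom hκ₀ r
  let κ : Sec (𝒟.toBase ≫ s) (𝒟.toBase ⁻¹ᵁ K₀.W) →ₐ[ℂ] Sec (π ≫ s) (π ⁻¹ᵁ K₀.W) :=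
    { κ₀.hom with
      commutes' := fun z => by
        rw [IsScalarTower.algebraMap_apply ℂ (Sec s K₀.W)
            (Sec (𝒟.toBase ≫ s) (𝒟.toBase ⁻¹ᵁ K₀.W)),
          IsScalarTower.algebraMap_apply ℂ (Sec s K₀.W) (Sec (π ≫ s) (π ⁻¹ᵁ K₀.W))]
        exact hκr _ }
  have hfinπ : (π.app K₀.W).hom.Finite := by
    rw [← hκ₀, CommRingCat.hom_comp]
    exact hfin.comp H₁.finite
  have H₀ : FinChart π K₀ := by
    haveI := 𝒟.isFinite_α
    haveI := 𝒟.isFinite_β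
    refine finChart_of_le π K₀ (O := 𝒟.U) ?_ hK₀
    rw [← 𝒟.fac]
    infer_instance
  have key : ∀ w : ComplexPoint s, w.LiesIn (unbranchedLocus π) → _ := fun w hw =>
    exists_relSheets (κ := κ) hκr hs H₀ hfin hinj hw
  obtain ⟨S, q, hq, hqP⟩ := key u hu
  have hdeg : Module.finrank (Sec s K₀.W) (Sec (𝒟.toBase ≫ s) (𝒟.toBase ⁻¹ᵁ K₀.W)) = 𝒟.degβ := by
    rw [H₁.finrank_eq, 𝒟.degree_toBase]
  let e := S.sheets.fiberEquiv S.mem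
  have he : ∀ x : Fiber π u, S.sheets.s (e.symm x) u = x.1 := fun x =>
    congrArg Subtype.val (e.apply_symm_apply x)
  -- Equality of labels is expressed by `Continued`, which involves neither the disc nor the
  -- numbering of sheets and is therefore comparable along a loop.
  have hQ : ∀ x y : Fiber π u, q (e.symm x) = q (e.symm y) ↔
      Continued (ComplexPoint.map π s) (SameImage κ) x.1 y.1 := fun x y => by
    rw [← hqP, ← S.continued_iff _ _ S.mem, he, he]
  refine ⟨fun x => finCongr hdeg (q (e.symm x)),
    (finCongr hdeg).surjective.comp (hq.comp e.symm.surjective), fun σ hσ x y => ?_⟩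
  rw [(finCongr hdeg).injective.eq_iff, (finCongr hdeg).injective.eq_iff, hQ, hQ]
  obtain ⟨γ, hγ, hind⟩ := hσ
  obtain ⟨Γ, hΓ⟩ := hind x
  obtain ⟨Δ, hΔ⟩ := hind y
  refine continued_iff_of_paths (W := {w | w.LiesIn (unbranchedLocus π)})
    (fun w (hw : w.LiesIn (unbranchedLocus π)) => ⟨(key w hw).choose⟩) Γ Δ (fun t => (hΓ t).trans (hΔ t).symm) fun t => ?_
  rw [hΓ]
  exact hγ t

/-! ### Imprimitive permutation groups and wreath products -/

section Wreath

variable {a b : ℕ}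

theorem Wreath.smul_def (w : Wreath a b) (x : Fin b × Fin a) :
    w • x = (w.right x.1, w.left (w.right x.1) x.2) := rfl

/-- With nonempty blocks the action is faithful; for `a = 0` the permutation of the blocks would be
invisible. -/
theorem Wreath.eq_of_smul_eq (ha : 0 < a) {w w' : Wreath a b}
    (h : ∀ x : Fin b × Fin a, w • x = w' • x) : w = w' := by
  have h1 : w.right = w'.right := Equiv.ext fun j => congrArg Prod.fst (h (j, ⟨0, ha⟩))
  refine SemidirectProduct.ext (funext fun j => Equiv.ext fun i => ?_) h1
  have h2 := congrArg Prod.snd (h (w.right⁻¹ j, i))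
  simp only [Wreath.smul_def, ← h1] at h2
  rwa [show w.right (w.right⁻¹ j) = j from w.right.apply_symm_apply j] at h2

theorem Wreath.exists_smul_eq (ha : 0 < a) (p : Equiv.Perm (Fin b × Fin a))
    (hp : ∀ x y, x.1 = y.1 ↔ (p x).1 = (p y).1) : ∃ w : Wreath a b, ∀ x, p x = w • x := by
  have h1 : Function.Injective fun j => (p (j, ⟨0, ha⟩)).1 := fun j j' h => (hp (j, _) (j', _)).2 h
  let τ : Equiv.Perm (Fin b) := Equiv.ofBijective _ (Finite.injective_iff_bijective.1 h1)
  have hτ : ∀ x, (p x).1 = τ x.1 := fun x => (hp x (x.1, ⟨0, ha⟩)).1 rfl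
  -- The action applies the component indexed by the target block, so the component at `j` is read
  -- off from the block `τ⁻¹ j`.
  have h2 : ∀ j, Function.Injective fun i => (p (τ⁻¹ j, i)).2 := fun j i i' h => by
    have h3 : p (τ⁻¹ j, i) = p (τ⁻¹ j, i') := Prod.ext ((hτ _).trans (hτ (_, i')).symm) h
    exact congrArg Prod.snd (p.injective h3)
  refine ⟨⟨fun j => Equiv.ofBijective _ (Finite.injective_iff_bijective.1 (h2 j)), τ⟩, fun x => ?_⟩
  rw [Wreath.smul_def]
  refine Prod.ext (hτ x) ?_
  simp

end Wreath

/-! ### Permutation groups preserving the fibres of a map. -/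

section Blocks

variable {Ω : Type} {a b : ℕ} (G : Subgroup (Equiv.Perm Ω)) [MulAction.IsPretransitive G Ω]
  {Q : Ω → Fin b} (hQ : Function.Surjective Q)
  (hG : ∀ σ ∈ G, ∀ x y, Q x = Q y ↔ Q (σ x) = Q (σ y))

include hQ hG

/-- The points of a transitive action, arranged in the blocks of an invariant map. -/
theorem exists_equiv_prod (hb : 0 < b) (e₀ : Fin (b * a) ≃ Ω) :
    ∃ e : Ω ≃ Fin b × Fin a, ∀ x, (e x).1 = Q x := by
  haveI : Finite Ω := Finite.of_equiv _ e₀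
  -- A group element carrying a point over `j` to a point over `j'` carries the whole fibre along,
  -- so all `b` fibres have the same size, necessarily `a`.
  have hfib : ∀ j j', Nonempty ({x // Q x = j} ≃ {x // Q x = j'}) := by
    intro j j'
    obtain ⟨x, rfl⟩ := hQ j
    obtain ⟨x', rfl⟩ := hQ j'
    obtain ⟨⟨σ, hσ⟩, h⟩ := MulAction.exists_smul_eq G x x'
    have h' : σ x = x' := h
    refine ⟨σ.subtypeEquiv fun y => ?_⟩
    rw [← h']
    exact hG σ hσ y x
  have hcard : ∀ j, Nat.card {x // Q x = j} = a := by
    intro j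
    have h1 : Nat.card Ω = ∑ j' : Fin b, Nat.card {x // Q x = j'} := by
      rw [← Nat.card_congr (Equiv.sigmaFiberEquiv Q), Nat.card_sigma]
    have h2 : ∀ j', Nat.card {x // Q x = j'} = Nat.card {x // Q x = j} := fun j' => by
      obtain ⟨f⟩ := hfib j' j
      exact Nat.card_congr f
    simp only [h2, Finset.sum_const, Finset.card_univ, Fintype.card_fin, smul_eq_mul] at h1
    rw [← Nat.card_congr e₀, Nat.card_fin] at h1
    exact (Nat.eq_of_mul_eq_mul_left hb h1).symm
  let f : ∀ j, {x // Q x = j} ≃ Fin a := fun j => Finite.equivFinOfCardEq (hcard j)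
  exact ⟨(Equiv.sigmaFiberEquiv Q).symm.trans ((Equiv.sigmaCongrRight f).trans
    (Equiv.sigmaEquivProd _ _)), fun x => rfl⟩

omit [MulAction.IsPretransitive G Ω] hQ in
/-- A permutation group preserving blocks embeds in the wreath product. -/
theorem exists_hom_wreath (ha : 0 < a) (e : Ω ≃ Fin b × Fin a) (he : ∀ x, (e x).1 = Q x) :
    ∃ φ : G →* Wreath a b, Function.Injective φ ∧ ∀ (g : G) x, e (g • x) = φ g • e x := by
  have hw : ∀ g : G, ∃ w : Wreath a b, ∀ x, e (g • x) = w • e x := by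
    intro g
    obtain ⟨w, hw⟩ := Wreath.exists_smul_eq ha (e.permCongr g.1) fun x y => by
      have h := hG g.1 g.2 (e.symm x) (e.symm y)
      rw [← he, ← he, ← he, ← he, e.apply_symm_apply, e.apply_symm_apply] at h
      exact h
    refine ⟨w, fun x => ?_⟩
    rw [← hw, Equiv.permCongr_apply, e.symm_apply_apply]
    rfl
  choose φ hφ using hw
  have hφ' : ∀ (g : G) y, φ g • y = e (g • e.symm y) := fun g y => by
    rw [hφ, e.apply_symm_apply]
  refine ⟨⟨⟨φ, Wreath.eq_of_smul_eq ha fun y => ?_⟩, fun g h => Wreath.eq_of_smul_eq ha fun y => ?_⟩,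
    fun g h hgh => ?_, hφ⟩
  · rw [hφ', one_smul, e.apply_symm_apply, one_smul]
  · rw [mul_smul, hφ' h, hφ' g, hφ', e.symm_apply_apply, mul_smul]
  · refine Subtype.ext (Equiv.ext fun x => e.injective ?_)
    have h1 : φ g = φ h := hgh
    have h2 := hφ g x
    rw [h1, ← hφ h x] at h2
    exact h2

-- A fibre of `Q` is a block; `a ≥ 2` gives it two points and `b ≥ 2` leaves points outside it.
omit [MulAction.IsPretransitive G Ω] hQ in
theorem exists_nontrivial_block (ha : 2 ≤ a) (hb : 2 ≤ b) (e : Ω ≃ Fin b × Fin a)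
    (he : ∀ x, (e x).1 = Q x) :
    ∃ B : Set Ω, MulAction.IsBlock G B ∧ ¬ MulAction.IsTrivialBlock B := by
  refine ⟨Q ⁻¹' {⟨0, by omega⟩}, ?_, ?_⟩
  · refine MulAction.isBlock_iff_smul_eq_of_mem.2 fun g x hx hgx => ?_
    have hg : ∀ y, Q (g • y) = ⟨0, by omega⟩ ↔ Q y = ⟨0, by omega⟩ := fun y => by
      rw [← (show Q (g • x) = _ from hgx)]
      refine (hG g.1 g.2 y x).symm.trans ?_
      rw [show Q x = _ from hx, show Q (g • x) = _ from hgx]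
    ext y
    rw [Set.mem_smul_set_iff_inv_smul_mem, Set.mem_preimage, Set.mem_singleton_iff, ← hg,
      smul_inv_smul]
    rfl
  · have hmem : ∀ j i, Q (e.symm (j, i)) = j := fun j i => by rw [← he, e.apply_symm_apply]
    rintro (h | h)
    · have h1 := e.symm.injective (h (hmem _ ⟨0, by omega⟩) (hmem _ ⟨1, by omega⟩))
      simp at h1
    · have h1 : Q _ = _ := h.ge (Set.mem_univ (e.symm (⟨1, by omega⟩, ⟨0, by omega⟩)))
      rw [hmem] at h1
      simp at h1

end Blocks

theorem exists_equiv_and_hom {X Y : Scheme.{0}} [IsIntegral X] (π : X ⟶ Y) [IsDominant π]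
    {s : Y ⟶ SpecC} (hs : HasCharts s) {u : ComplexPoint s} (hu : u.LiesIn (unbranchedLocus π))
    (D : Decomposition π) (hD : D.IsNontrivial) :
    (∃ (φ : monodromyGroup π u hu →* Wreath D.degα D.degβ)
        (e : Fiber π u ≃ Fin D.degβ × Fin D.degα),
      Function.Injective φ ∧ ∀ g x, e (g • x) = φ g • e x) ∧
    IsImprimitive (monodromyGroup π u hu) (Fiber π u) := by
  haveI := isPretransitive_monodromyGroup π hs hu
  obtain ⟨Q, hQ, hG⟩ := exists_blockMap π hs hu D
  obtain ⟨e₀⟩ := nonempty_fiber_equiv π hs hu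
  obtain ⟨e, he⟩ := exists_equiv_prod (monodromyGroup π u hu) hQ hG (by linarith [hD.2])
    ((finCongr D.degree_eq).symm.trans e₀)
  obtain ⟨φ, hφ, hφe⟩ := exists_hom_wreath (monodromyGroup π u hu) hG (by linarith [hD.1]) e he
  exact ⟨⟨φ, e, hφ, hφe⟩, ‹_›,
    exists_nontrivial_block (monodromyGroup π u hu) hG hD.1 hD.2 e he⟩

theorem exists_equiv_isPretransitive {X Y : Scheme.{0}} [IsIntegral X] (f : X ⟶ Y) [IsDominant f]
    {s : Y ⟶ SpecC} (hs : HasCharts s) {v : ComplexPoint s} (hv : v.LiesIn (unbranchedLocus f)) :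
    ∃ e : Fiber f v ≃ Fin (degree f),
      MulAction.IsPretransitive ((monodromyGroup f v hv).map e.permCongrHom.toMonoidHom)
        (Fin (degree f)) := by
  obtain ⟨e⟩ := nonempty_fiber_equiv f hs hv
  haveI := isPretransitive_monodromyGroup f hs hv
  refine ⟨e.symm, ⟨fun i j => ?_⟩⟩
  obtain ⟨g, hg⟩ := MulAction.exists_smul_eq (monodromyGroup f v hv) (e i) (e j)
  refine ⟨⟨_, Subgroup.mem_map_of_mem _ g.2⟩, ?_⟩
  have h : g.1 (e i) = e j := hg
  change e.symm (g.1 (e i)) = j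
  rw [h, e.symm_apply_apply]

end MonodromyDecomp

end

open MonodromyDecomp in
theorem mainTheorem1 (n : ℕ) (C : Scheme.{0}) [IsIntegral C]
    (hC : topologicalKrullDim C = 1)
    (i : C ⟶ ProjProd n) [IsClosedImmersion i]
    (π : C ⟶ ProjSpace 1) (hπ : π = i ≫ projToLine n) [IsDominant π]
    (u : ComplexPoint (ProjSpace.structMap 1)) (hu : u.LiesIn (unbranchedLocus π)) :
    (IsDecomposable π ↔ IsImprimitive (monodromyGroup π u hu) (Fiber π u)) ∧
    ∀ D : Decomposition π, D.IsNontrivial →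
      (∃ (φ : monodromyGroup π u hu →* Wreath D.degα D.degβ)
          (e : Fiber π u ≃ Fin D.degβ × Fin D.degα),
        Function.Injective φ ∧ ∀ g x, e (g • x) = φ g • e x) ∧
      ∀ (v : ComplexPoint (D.U.ι ≫ ProjSpace.structMap 1)) (hv : v.LiesIn (unbranchedLocus D.β)),
        ∃ e : Fiber D.β v ≃ Fin D.degβ,
          MulAction.IsPretransitive ((monodromyGroup D.β v hv).map e.permCongrHom.toMonoidHom)
            (Fin D.degβ) := by
  refine ⟨⟨?_, isDecomposable_of_isImprimitive π hasCharts_line hu⟩, fun D hD =>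
    ⟨(exists_equiv_and_hom π hasCharts_line hu D hD).1, fun v hv => ?_⟩⟩
  · rintro ⟨D, hD⟩
    exact (exists_equiv_and_hom π hasCharts_line hu D hD).2
  · haveI := D.isDominant_β
    -- The target of `β` is the open subscheme `U`, which inherits charts from the line.
    exact exists_equiv_isPretransitive D.β (hasCharts_line.comp D.U.ι) hv
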